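/- Let $n\ge 1$ and $T>0$. **Weak solutions.** A weak solution of the Euler equations on $[0,T]$ with initial datum $u_0\in L^2(\mathbb R^n;\mathbb R^n)$ is a field $u\in C_w([0,T];L^2(\mathbb R^n;\mathbb R^n))$ (weakly continuous in time, represented by a jointly measurable function) such that $\nabla\cdot u(t)=0$ in the sense of distributions for all $t\in[0,T]$, and for all $\psi\in C_c^\infty([0,T]\times\mathbb R^n;\mathbb R^n)$ with $\nabla_x\cdot\psi=0$ and all $0\le t\le T$ $$\int u(t)\cdot\psi(t)\,dx-\int u_0\cdot\psi(0)\,dx-\int_0^t\!\!\int u\cdot\partial_s\psi\,dx\,ds=\int_0^t\!\!\int (u\otimes u):\nabla\psi\,dx\,ds .$$ Its pressure is the distribution $p=-\sum_{l,k}R_lR_k(u_lu_k)$, where $R_l$ has the Fourier multiplier $\xi_l/|\xi|$. **Surfaces.** Let $S(t)$, $t\in[0,T]$, be a $C^1$-family of closed oriented $C^2$-hypersurfaces of $\mathbb R^n$ (each $S(t)$ a closed set): there is a field $\vec\nu(x,t)$ of unit normals to $S(t)$, continuous on $S=\{(x,t):x\in S(t)\}$, and for every $(x_0,t_0)\in S$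 there are an open $U\ni x_0$, a relatively open interval $I\subset[0,T]$ with $t_0\in I$, and parametrizations $r(\cdot,t)$ of $S(t)\cap U$, $t\in I$, over the unit ball of $\mathbb R^{n-1}$, which are immersions, for which $D_yr$, $D_y^2r$, $\partial_tr$ exist and are continuous in $(y,t)$, and for which $(y,t)\mapsto(r(y,t),t)$ is a homeomorphism onto its image. Let $\sigma_t$ be the surface measure on $S(t)$, and let $\mu_t$ be the signed measure on $S(t)$ given by $$d\mu_t=\frac{\partial_tH}{|\nabla_xH|}\,d\sigma_t,$$ where $H$ is any local $C^1$ function with $\{H(\cdot,t)=0\}=S(t)$ for which $\nabla_xH\neq0$ is a positive multiple of $\vec\nu$ on $S(t)$ (the density does not depend on the choice of $H$). **Slits.** For a function or field $f$ put $f_\pm(x,t)=\lim_{s\to0^\pm}f(x+s\vec\nu(x,t),t)$, where the limit exists, and, for $\varepsilon>0$, $f^*_+(x,t)=\sup_{0\le s\le\varepsilon}|f(x+s\vec\nu(x,t),t)|$ and $f^*_-(x,t)=\sup_{-\varepsilon\le s\le0}|f(x+s\vec\nu(x,t),t)|$. The family $S$ is a slit of $u$ if near $S$, at times in $(0,T)$,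 the pressure is given by a locally integrable function $p$; the limits $u_\pm$ and $p_\pm$ exist for a.e. $t\in[0,T]$ and $\sigma_t$-a.e. $x\in S(t)$; and every point of $S$ has a neighbourhood and an $\varepsilon>0$ such that, on the part of $S$ in this neighbourhood, $u^*_\pm\in L^2(d\sigma_t\,dt)$ and $p^*_\pm\in L^1(d\sigma_t\,dt)$. **Lemma.** Let $u$ be a weak solution of the Euler equations on $[0,T]$ and let $S$ be a slit of $u$. Then: 1. $u_+\cdot\vec\nu=u_-\cdot\vec\nu=:u_\nu$ and $p_+=p_-$ for a.e. $t\in[0,T]$ and $\sigma_t$-a.e. $x\in S(t)$; 2. for a.e. $t\in[0,T]$, $d\mu_t+u_\nu\,d\sigma_t=0$ on the set $\{x\in S(t):u_+(x,t)\neq u_-(x,t)\}$; that is, for every bounded Borel subset $A$ of this set, the density of $\mu_t$ and $u_\nu$ are $\sigma_t$-integrable on $A$, and $\mu_t(A)+\int_Au_\nu\,d\sigma_t=0$. -/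

import Mathlib

open MeasureTheory Set Filter Topology
open scoped ENNReal FourierTransform ContDiff

noncomputable section

namespace SlitEuler

/-- Physical space `ℝⁿ` with its Euclidean norm. -/
abbrev Space (n : ℕ) : Type := EuclideanSpace ℝ (Fin n)

/-! ### Weak solutions of the Euler equations -/

/-- The divergence `∑ᵢ ∂ᵢ vᵢ` of a vector field at a point. -/
def divergence {n : ℕ} (v : Space n → Space n) (x : Space n) : ℝ :=
  ∑ i, fderiv ℝ v x (EuclideanSpace.single i 1) i

/-- `u` is a weak solution of the Euler equations on `[0,T]` with initial datum `u₀`. The field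
`u : [0,T] × ℝⁿ → ℝⁿ` is given by a jointly measurable representative (values at times outside
`[0,T]` are irrelevant), and `(u ⊗ u) : ∇ψ = ∑ uᵢ uⱼ ∂ᵢ ψⱼ = u · (Dψ u)`. The restrictions to
`[0,T] × ℝⁿ` of the functions in `C_c^∞(ℝ × ℝⁿ)` are the test functions in
`C_c^∞([0,T] × ℝⁿ)`; they need not vanish at times `0` and `T`. -/
structure IsWeakSolution {n : ℕ} (T : ℝ) (u : ℝ → Space n → Space n)
    (u₀ : Space n → Space n) : Prop where
  measurable : AEStronglyMeasurable (fun q : ℝ × Space n => u q.1 q.2)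
    ((volume.restrict (Icc 0 T)).prod volume)
  memLp : ∀ t ∈ Icc 0 T, MemLp (u t) 2 volume
  weaklyContinuous : ∀ φ : Space n → Space n, MemLp φ 2 volume →
    ContinuousOn (fun t => ∫ x, inner ℝ (u t x) (φ x)) (Icc 0 T)
  memLp_initial : MemLp u₀ 2 volume
  momentum : ∀ ψ : ℝ × Space n → Space n, ContDiff ℝ ∞ ψ → HasCompactSupport ψ →
    (∀ t ∈ Icc 0 T, ∀ x, divergence (fun z => ψ (t, z)) x = 0) →
    ∀ t ∈ Icc 0 T,
      (∫ x, inner ℝ (u t x) (ψ (t, x))) - (∫ x, inner ℝ (u₀ x) (ψ (0, x)))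
        - (∫ s in (0 : ℝ)..t, ∫ x, inner ℝ (u s x) (deriv (fun τ => ψ (τ, x)) s))
      = ∫ s in (0 : ℝ)..t, ∫ x, inner ℝ (u s x) (fderiv ℝ (fun z => ψ (s, z)) x (u s x))
  divergenceFree : ∀ t ∈ Icc 0 T, ∀ φ : Space n → ℝ, ContDiff ℝ ∞ φ → HasCompactSupport φ →
    ∫ x, fderiv ℝ φ x (u t x) = 0

/-- `R_l R_k φ` for a test function `φ`, where `R_l` is the Riesz projection with Fourier
multiplier `ξ_l / |ξ|`. -/
def doubleRiesz {n : ℕ} (l k : Fin n) (φ : Space n → ℝ) (x : Space n) : ℝ :=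
  (𝓕⁻ (fun ξ : Space n => ((ξ l * ξ k / ‖ξ‖ ^ 2 : ℝ) : ℂ) *
    𝓕 (fun z : Space n => (φ z : ℂ)) ξ) x).re

/-- The pairing `⟨p, φ⟩` of the distribution `p = - ∑ R_l R_k (v_l v_k)` with a test function
`φ`, for `v ∈ L²`. As `v_l v_k` is in `L¹` and `R_l R_k` has an even multiplier, the operator is
moved onto `φ`, and `R_l R_k φ` is a bounded function. -/
def pressurePairing {n : ℕ} (v : Space n → Space n) (φ : Space n → ℝ) : ℝ :=
  - ∑ l, ∑ k, ∫ x, v x l * v x k * doubleRiesz l k φ x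

/-- The pressure distribution of `u` is given by the locally integrable function `p` on the open
set `W` of space-time (contained in `(0,T) × ℝⁿ`). -/
structure IsPressureOn {n : ℕ} (T : ℝ) (u : ℝ → Space n → Space n) (p : ℝ → Space n → ℝ)
    (W : Set (ℝ × Space n)) : Prop where
  locallyIntegrable : LocallyIntegrableOn (fun q : ℝ × Space n => p q.1 q.2) W volume
  pairing : ∀ φ : ℝ × Space n → ℝ, ContDiff ℝ ∞ φ → HasCompactSupport φ → tsupport φ ⊆ W →
    ∫ t in (0 : ℝ)..T, pressurePairing (u t) (fun x => φ (t, x))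
      = ∫ q : ℝ × Space n, p q.1 q.2 * φ q

/-! ### Moving hypersurfaces -/

/-- `r` is a local parametrization, over the relatively open time set `I` and with the unit ball
`B` of `ℝᵈ` as parameter domain, of the hypersurfaces `S(t) ∩ U ⊆ ℝᵈ⁺¹`, `t ∈ I`. It is of class
`C^{2,1}` (the derivatives `D_y r`, `D_y² r`, `∂_t r` exist and are jointly continuous), an
immersion in `y`, and `(t, y) ↦ (t, r(y,t))` is a homeomorphism onto its image. Moreover
`ν(·,t)` is normal to the surface on `S(t) ∩ U`. -/
structure IsParametrization {d : ℕ} (S : ℝ → Set (Space (d + 1)))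
    (ν : ℝ → Space (d + 1) → Space (d + 1)) (U : Set (Space (d + 1))) (I : Set ℝ)
    (r : ℝ → Space d → Space (d + 1)) : Prop where
  image : ∀ t ∈ I, r t '' Metric.ball 0 1 = S t ∩ U
  embedding : IsEmbedding
    ((I ×ˢ Metric.ball (0 : Space d) 1).domRestrict fun q => (q.1, r q.1 q.2))
  contDiffOn : ∀ t ∈ I, ContDiffOn ℝ 2 (r t) (Metric.ball 0 1)
  continuous_fderiv : ContinuousOn (fun q : ℝ × Space d => fderiv ℝ (r q.1) q.2)
    (I ×ˢ Metric.ball 0 1)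
  continuous_fderiv_fderiv : ContinuousOn
    (fun q : ℝ × Space d => fderiv ℝ (fderiv ℝ (r q.1)) q.2) (I ×ˢ Metric.ball 0 1)
  differentiable_time : ∀ y ∈ Metric.ball (0 : Space d) 1,
    DifferentiableOn ℝ (fun t => r t y) I
  continuous_time : ContinuousOn
    (fun q : ℝ × Space d => derivWithin (fun t => r t q.2) I q.1) (I ×ˢ Metric.ball 0 1)
  immersion : ∀ t ∈ I, ∀ y ∈ Metric.ball (0 : Space d) 1,
    Function.Injective (fderiv ℝ (r t) y)
  normal : ∀ t ∈ I, ∀ y ∈ Metric.ball (0 : Space d) 1, ∀ v,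
    inner ℝ (fderiv ℝ (r t) y v) (ν t (r t y)) = 0

/-- `S(t)`, `0 ≤ t ≤ T`, is a `C¹`-family of closed `C²` hypersurfaces of `ℝᵈ⁺¹`, oriented by
the continuous field `ν` of unit normals. -/
structure IsHypersurfaceFamily {d : ℕ} (T : ℝ) (S : ℝ → Set (Space (d + 1)))
    (ν : ℝ → Space (d + 1) → Space (d + 1)) : Prop where
  isClosed : ∀ t ∈ Icc 0 T, IsClosed (S t)
  norm_normal : ∀ t ∈ Icc 0 T, ∀ x ∈ S t, ‖ν t x‖ = 1
  continuous_normal : ContinuousOn (fun q : ℝ × Space (d + 1) => ν q.1 q.2)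
    {q | q.1 ∈ Icc 0 T ∧ q.2 ∈ S q.1}
  exists_parametrization : ∀ t₀ ∈ Icc 0 T, ∀ x₀ ∈ S t₀,
    ∃ (U : Set (Space (d + 1))) (a b : ℝ) (r : ℝ → Space d → Space (d + 1)),
      IsOpen U ∧ x₀ ∈ U ∧ t₀ ∈ Ioo a b ∧ IsParametrization S ν U (Ioo a b ∩ Icc 0 T) r

/-- The surface measure `dσ_t` of a hypersurface `A = S(t)`: the `d`-dimensional Hausdorff
measure, normalized as the Lebesgue measure on `d`-planes, restricted to `A`. -/
def surfaceMeasure {d : ℕ} (A : Set (Space (d + 1))) : Measure (Space (d + 1)) :=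
  (Measure.euclideanHausdorffMeasure d).restrict A

/-- `c` is the value of `∂_t H / |∇_x H|` at `(t,x)` for some local defining function `H` of the
family: `H` is `C¹` near `(t,x)`, its zero set is `S(τ)` there for each time `τ ∈ [0,T]`, and
`∇_x H` is nonzero and points in the direction of `ν` on the surface. -/
def IsMuDensityAt {d : ℕ} (T : ℝ) (S : ℝ → Set (Space (d + 1)))
    (ν : ℝ → Space (d + 1) → Space (d + 1)) (t : ℝ) (x : Space (d + 1)) (c : ℝ) : Prop :=
  ∃ (J : Set ℝ) (U : Set (Space (d + 1))) (H : ℝ × Space (d + 1) → ℝ),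
    IsOpen J ∧ t ∈ J ∧ IsOpen U ∧ x ∈ U ∧ ContDiffOn ℝ 1 H (J ×ˢ U) ∧
    (∀ τ ∈ J ∩ Icc 0 T, {z ∈ U | H (τ, z) = 0} = S τ ∩ U) ∧
    (∀ τ ∈ J ∩ Icc 0 T, ∀ z ∈ S τ ∩ U,
      ∃ a : ℝ, 0 < a ∧ gradient (fun y => H (τ, y)) z = a • ν τ z) ∧
    c = deriv (fun τ => H (τ, x)) t / ‖gradient (fun y => H (t, y)) x‖

open Classical in
/-- The density `∂_t H / |∇_x H|` of `dμ_t` with respect to `dσ_t`, for any local defining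
function `H`; the value does not depend on `H`. -/
def muDensity {d : ℕ} (T : ℝ) (S : ℝ → Set (Space (d + 1)))
    (ν : ℝ → Space (d + 1) → Space (d + 1)) (t : ℝ) (x : Space (d + 1)) : ℝ :=
  if h : ∃ c, IsMuDensityAt T S ν t x c then h.choose else 0

/-- The value `μ_t(A)` on a bounded Borel set `A` of the (signed, locally finite) measure
`dμ_t = (∂_t H / |∇_x H|) dσ_t` on `S(t)`. -/
def mu {d : ℕ} (T : ℝ) (S : ℝ → Set (Space (d + 1)))
    (ν : ℝ → Space (d + 1) → Space (d + 1)) (t : ℝ) (A : Set (Space (d + 1))) : ℝ :=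
  ∫ x in A, muDensity T S ν t x ∂(surfaceMeasure (S t))

/-! ### Normal limits, normal maximal functions, slits -/

section Normal

variable {d : ℕ} {G : Type*} [NormedAddCommGroup G]

/-- The limit of `f` at `(x,t)` along the normal segments in the sense of the filter `l` on the
signed distance: `l = 𝓝[>] 0` for the positive and `l = 𝓝[<] 0` for the negative side. -/
def HasNormalLimit (l : Filter ℝ) (ν : ℝ → Space (d + 1) → Space (d + 1))
    (f : ℝ → Space (d + 1) → G) (t : ℝ) (x : Space (d + 1)) (a : G) : Prop :=
  Tendsto (fun s : ℝ => f t (x + s • ν t x)) l (𝓝 a)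

/-- The normal limit `f₊(x,t)`, where it exists. -/
def plus (ν : ℝ → Space (d + 1) → Space (d + 1)) (f : ℝ → Space (d + 1) → G)
    (t : ℝ) (x : Space (d + 1)) : G :=
  limUnder (𝓝[>] (0 : ℝ)) fun s : ℝ => f t (x + s • ν t x)

/-- The normal limit `f₋(x,t)`, where it exists. -/
def minus (ν : ℝ → Space (d + 1) → Space (d + 1)) (f : ℝ → Space (d + 1) → G)
    (t : ℝ) (x : Space (d + 1)) : G :=
  limUnder (𝓝[<] (0 : ℝ)) fun s : ℝ => f t (x + s • ν t x)

/-- The supremum of `|f(·,t)|` over the points `x + s ν(x,t)`, `s ∈ K`; this is the normal maximal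
function `f*₊` for `K = [0,ε]` and `f*₋` for `K = [-ε,0]`. -/
def normalMaximal (K : Set ℝ) (ν : ℝ → Space (d + 1) → Space (d + 1))
    (f : ℝ → Space (d + 1) → G) (t : ℝ) (x : Space (d + 1)) : ℝ≥0∞ :=
  ⨆ s ∈ K, ‖f t (x + s • ν t x)‖ₑ

end Normal

/-- `F ∈ L^q(dσ_t dt)` on the part of the space-time surface that lies in `J × U`: `F` agrees there
almost everywhere with a Borel function whose `q`-th power has a finite integral. -/
def InLq {d : ℕ} (T : ℝ) (S : ℝ → Set (Space (d + 1))) (J : Set ℝ) (U : Set (Space (d + 1)))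
    (q : ℝ) (F : ℝ → Space (d + 1) → ℝ≥0∞) : Prop :=
  ∃ g : ℝ × Space (d + 1) → ℝ≥0∞, Measurable g ∧
    (∀ᵐ t ∂(volume.restrict (Icc 0 T)), ∀ᵐ x ∂(surfaceMeasure (S t)),
      t ∈ J → x ∈ U → F t x = g (t, x)) ∧
    ∫⁻ t in J ∩ Icc 0 T, ∫⁻ x in U, g (t, x) ^ q ∂(surfaceMeasure (S t)) < ⊤

/-- The family `S(t)` with unit normals `ν` is a slit of the solution `u` with pressure `p`:
the pressure is given by the function `p` near the surface, the normal limits of `u` and `p` exist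
almost everywhere on both sides, and near each point of the surface the normal maximal functions
over sufficiently short normal segments are in `L²` for `u` and in `L¹` for `p`. -/
structure IsSlit {d : ℕ} (T : ℝ) (u : ℝ → Space (d + 1) → Space (d + 1))
    (p : ℝ → Space (d + 1) → ℝ) (S : ℝ → Set (Space (d + 1)))
    (ν : ℝ → Space (d + 1) → Space (d + 1)) : Prop where
  pressure : ∃ W : Set (ℝ × Space (d + 1)), IsOpen W ∧ W ⊆ Ioo 0 T ×ˢ univ ∧
    (∀ t ∈ Ioo 0 T, ∀ x ∈ S t, (t, x) ∈ W) ∧ IsPressureOn T u p W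
  limits : ∀ᵐ t ∂(volume.restrict (Icc 0 T)), ∀ᵐ x ∂(surfaceMeasure (S t)),
    (∃ a, HasNormalLimit (𝓝[>] 0) ν u t x a) ∧ (∃ a, HasNormalLimit (𝓝[<] 0) ν u t x a) ∧
    (∃ a, HasNormalLimit (𝓝[>] 0) ν p t x a) ∧ (∃ a, HasNormalLimit (𝓝[<] 0) ν p t x a)
  maximal : ∀ t₀ ∈ Icc 0 T, ∀ x₀ ∈ S t₀, ∃ (J : Set ℝ) (U : Set (Space (d + 1))) (ε : ℝ),
    IsOpen J ∧ t₀ ∈ J ∧ IsOpen U ∧ x₀ ∈ U ∧ 0 < ε ∧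
    InLq T S J U 2 (normalMaximal (Icc 0 ε) ν u) ∧
    InLq T S J U 2 (normalMaximal (Icc (-ε) 0) ν u) ∧
    InLq T S J U 1 (normalMaximal (Icc 0 ε) ν p) ∧
    InLq T S J U 1 (normalMaximal (Icc (-ε) 0) ν p)

end SlitEuler

end

/-! Near the slit the equations should say that the space-time fields (0, u) and Fᵢ = (uᵢ, uᵢ u + p
eᵢ) are divergence free, and the flux of such a field does not jump across S. For a local defining
function H, the differential of H on S is a positive multiple of (ω, ν), where ω is the density of
μ_t. Writing [·] for jumps, this gives ν·[u] = 0 and ω[uᵢ] + ν·[uᵢ u + p eᵢ] = 0 for every i. Since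
u_ν does not jump, the second family reads (ω + u_ν)[u] + [p]ν = 0. Its normal component yields [p]
= 0, and then ω + u_ν = 0 wherever [u] ≠ 0 (`rankineHugoniot`).

The first difficulty is the pressure. Only divergence free test fields are admitted, and p is
defined nonlocally. Testing with Δκ eᵢ - ∇∂ᵢκ and using R_l R_k Δ = ∂_l ∂_k
(`doubleRiesz_laplacian`) shows that Fᵢ is divergence free when tested with Laplacians Δκ, where κ
is supported in the region on which p is a function (`momentum_laplacian`). A general test function
φ is not such a Laplacian. Therefore a compactly supported parametrix E with ΔE = ρ - cδ₀ is used,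
where ρ is continuous and c = ∫ρ > 0. The choice κ = E∗φ shows that c Fᵢ - ρ∗Fᵢ is divergence free
(`isDivFreeOn_sub_smear`). The convolution acts in space only, so ρ∗Fᵢ is continuous in x at almost
every time. As the normal segments lie in time slices, it contributes no jump.

The second difficulty is that a divergence free field M is known only as a distribution, with
one-sided limits along normals. In `jump_eq_zero` it is tested with ψ θ((k+1)H), where θ is a bump
with θ(0) = 1. The term with the derivative of ψ tends to 0, because θ((k+1)H) tends to 0 off the
surface. The other term concentrates on the surface, and its limit is the integral of ψ DH(M₊ - M₋)
against a weight without zeros. The normal maximal functions justify the passage to the limit, and ψ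
is arbitrary. The limits exist only for a.e. t and then a.e. x, with no joint measurability given,
so they are replaced by limits of jointly measurable integrals.

The third difficulty is geometric. The unit normal is differentiable along S(t) but only continuous
in t. The change of variables to normal coordinates (t, r + sν) is therefore made at each fixed time
and then integrated (`exists_map_withDensity_eq`). The function H comes from the inverse function
theorem applied with a frozen direction in place of ν (`exists_definingFunction`). Both are combined
in `exists_normalChart`. Bi-Lipschitz bounds, uniform in time, carry null sets between parameters
and the surface, and countably many charts cover S at times in (0,T). -/

open scoped Pointwise

namespace SlitEuler

/-! ### Directional derivatives of smooth functions. -/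

section PartialDerivatives

variable {V : Type*} [NormedAddCommGroup V] [NormedSpace ℝ V]

/-- The directional derivative of `φ` in the direction `v`. -/
noncomputable def pd (v : V) (φ : V → ℝ) : V → ℝ := fun q => fderiv ℝ φ q v

theorem contDiff_pd (v : V) {φ : V → ℝ} (hφ : ContDiff ℝ ∞ φ) : ContDiff ℝ ∞ (pd v φ) := by
  have h : ContDiff ℝ ∞ (fderiv ℝ φ) := hφ.fderiv_right (by simp)
  exact h.clm_apply contDiff_const

theorem tsupport_pd_subset (v : V) (φ : V → ℝ) : tsupport (pd v φ) ⊆ tsupport φ := by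
  refine (closure_mono ?_).trans (tsupport_fderiv_subset ℝ)
  intro q hq
  simp only [Function.mem_support, pd] at hq ⊢
  intro h
  exact hq (by simp [h])

theorem hasCompactSupport_pd (v : V) {φ : V → ℝ} (hφ : HasCompactSupport φ) :
    HasCompactSupport (pd v φ) :=
  hφ.of_isClosed_subset (isClosed_tsupport _) (tsupport_pd_subset v φ)

theorem pd_pd_apply (v w : V) {φ : V → ℝ} (hφ : ContDiff ℝ ∞ φ) (q : V) :
    pd v (pd w φ) q = fderiv ℝ (fderiv ℝ φ) q v w := by
  have h : DifferentiableAt ℝ (fderiv ℝ φ) q :=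
    (hφ.fderiv_right (m := ∞) (by simp)).differentiable (by simp) q
  unfold pd
  rw [fderiv_clm_apply h (differentiableAt_const _)]
  simp

theorem pd_comm (v w : V) {φ : V → ℝ} (hφ : ContDiff ℝ ∞ φ) :
    pd v (pd w φ) = pd w (pd v φ) := by
  ext q
  rw [pd_pd_apply v w hφ, pd_pd_apply w v hφ]
  exact (hφ.contDiffAt.isSymmSndFDerivAt
    (by simpa using (WithTop.coe_le_coe.2 le_top : ((2 : ℕ∞) : ℕ∞ω) ≤ ((⊤ : ℕ∞) : ℕ∞ω)))) v w

theorem pd_sum {ι : Type*} (s : Finset ι) (v : V) {φ : ι → V → ℝ}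
    (hφ : ∀ i ∈ s, ContDiff ℝ ∞ (φ i)) :
    pd v (fun q => ∑ i ∈ s, φ i q) = fun q => ∑ i ∈ s, pd v (φ i) q := by
  ext q
  unfold pd
  rw [fderiv_fun_sum (fun i hi => (hφ i hi).differentiable (by simp) q)]
  simp

end PartialDerivatives

/-! ### The spatial Laplacian and time slices of functions on space-time. -/

section SpaceTime

variable {n : ℕ}

/-- The `i`-th unit vector, as a purely spatial direction in space-time. -/
noncomputable def sdir (i : Fin n) : ℝ × Space n := (0, EuclideanSpace.single i 1)

/-- The spatial Laplacian of a function on space-time. -/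
noncomputable def lap (φ : ℝ × Space n → ℝ) : ℝ × Space n → ℝ :=
  fun q => ∑ i, pd (sdir i) (pd (sdir i) φ) q

theorem contDiff_lap {φ : ℝ × Space n → ℝ} (hφ : ContDiff ℝ ∞ φ) : ContDiff ℝ ∞ (lap φ) :=
  ContDiff.sum fun _ _ => contDiff_pd _ (contDiff_pd _ hφ)

theorem tsupport_lap_subset (φ : ℝ × Space n → ℝ) : tsupport (lap φ) ⊆ tsupport φ := by
  refine closure_minimal ?_ (isClosed_tsupport _)
  intro q hq
  obtain ⟨i, -, hi⟩ := Finset.exists_ne_zero_of_sum_ne_zero hq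
  exact tsupport_pd_subset _ _ (tsupport_pd_subset _ _ (subset_closure hi))

theorem hasCompactSupport_lap {φ : ℝ × Space n → ℝ} (hφ : HasCompactSupport φ) :
    HasCompactSupport (lap φ) :=
  hφ.of_isClosed_subset (isClosed_tsupport _) (tsupport_lap_subset φ)

theorem pd_lap (v : ℝ × Space n) {φ : ℝ × Space n → ℝ} (hφ : ContDiff ℝ ∞ φ) :
    pd v (lap φ) = lap (pd v φ) := by
  unfold lap
  rw [pd_sum _ _ (fun i _ => contDiff_pd _ (contDiff_pd _ hφ))]
  ext q
  refine Finset.sum_congr rfl fun i _ => ?_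
  rw [pd_comm v _ (contDiff_pd _ hφ), pd_comm v _ hφ]

theorem hasFDerivAt_slice {G : Type*} [NormedAddCommGroup G] [NormedSpace ℝ G]
    {φ : ℝ × Space n → G} {t : ℝ} {x : Space n}
    (hφ : DifferentiableAt ℝ φ (t, x)) :
    HasFDerivAt (fun z => φ (t, z)) ((fderiv ℝ φ (t, x)).comp (ContinuousLinearMap.inr ℝ ℝ _)) x :=
  hφ.hasFDerivAt.comp x (hasFDerivAt_prodMk_right t x)

theorem fderiv_slice {φ : ℝ × Space n → ℝ} (hφ : ContDiff ℝ ∞ φ) (t : ℝ) (x w : Space n) :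
    fderiv ℝ (fun z => φ (t, z)) x w = pd (0, w) φ (t, x) := by
  rw [(hasFDerivAt_slice (hφ.differentiable (by simp) _)).fderiv]
  rfl

theorem pd_slice (i : Fin n) {φ : ℝ × Space n → ℝ} (hφ : ContDiff ℝ ∞ φ) (t : ℝ) :
    pd (EuclideanSpace.single i 1) (fun z => φ (t, z)) = fun z => pd (sdir i) φ (t, z) := by
  ext x
  exact fderiv_slice hφ t x _

theorem contDiff_slice {φ : ℝ × Space n → ℝ} (hφ : ContDiff ℝ ∞ φ) (t : ℝ) :
    ContDiff ℝ ∞ (fun z => φ (t, z)) := hφ.comp (contDiff_prodMk_right t)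

theorem hasCompactSupport_slice {G : Type*} [Zero G]
    {φ : ℝ × Space n → G} (hφ : HasCompactSupport φ) (t : ℝ) :
    HasCompactSupport (fun z => φ (t, z)) := by
  refine HasCompactSupport.intro (hφ.isCompact.image continuous_snd) fun x hx => ?_
  by_contra h
  exact hx ⟨(t, x), subset_tsupport _ h, rfl⟩

theorem fderiv_eq_sum_pd (φ : ℝ × Space n → ℝ) (q : ℝ × Space n) (v : Space n) :
    pd (0, v) φ q = ∑ k, v k * pd (sdir k) φ q := by
  have hv : ((0 : ℝ), v) = ∑ k, v k • (sdir k : ℝ × Space n) := by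
    have := (EuclideanSpace.basisFun (Fin n) ℝ).sum_repr v
    simp only [EuclideanSpace.basisFun_repr, EuclideanSpace.basisFun_apply] at this
    ext
    · simp [sdir, Prod.fst_sum]
    · conv_lhs => rw [← this]
      simp [sdir, Prod.snd_sum]
  unfold pd
  rw [hv, map_sum]
  simp

end SpaceTime

/-! ### Double Riesz transforms of Laplacians. -/

section Riesz

variable {n : ℕ}

/-- On the Fourier side the Laplacian is multiplication by (2πi)²|ξ|², which cancels the denominator
of the Riesz multiplier and leaves (2πi)² ξ_l ξ_k, the symbol of ∂_l ∂_k. Thus the nonlocal pressure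
becomes local when it is tested with Laplacians. -/
theorem doubleRiesz_laplacian (l k : Fin n) {χ : Space n → ℝ} (hχ : ContDiff ℝ ∞ χ)
    (hc : HasCompactSupport χ) (x : Space n) :
    doubleRiesz l k (fun z => ∑ i, pd (EuclideanSpace.single i 1)
      (pd (EuclideanSpace.single i 1) χ) z) x
      = pd (EuclideanSpace.single l 1) (pd (EuclideanSpace.single k 1) χ) x := by
  have hof : ∀ {f : Space n → ℝ}, ContDiff ℝ ∞ f → ContDiff ℝ ∞ fun z => (f z : ℂ) :=
    fun hf => Complex.ofRealCLM.contDiff.comp hf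
  have hcs : HasCompactSupport fun z => (χ z : ℂ) := hc.comp_left (g := ((↑) : ℝ → ℂ)) rfl
  set F : SchwartzMap (Space n) ℂ := hcs.toSchwartzMap (hof hχ) with hF
  let e : Fin n → Space n := fun i => EuclideanSpace.single i 1
  have hderiv : ∀ (G : SchwartzMap (Space n) ℂ) (f : Space n → ℝ), ContDiff ℝ ∞ f →
      (∀ z, G z = (f z : ℂ)) → ∀ v z, (LineDeriv.lineDerivOp v G : SchwartzMap (Space n) ℂ) z = ((pd v f z : ℝ) : ℂ) := by
    intro G f hf hG v z
    rw [SchwartzMap.lineDerivOp_apply_eq_fderiv]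
    have h1 : (G : Space n → ℂ) = fun z => (f z : ℂ) := funext hG
    rw [h1]
    have h2 : HasFDerivAt (fun z => (f z : ℂ)) (Complex.ofRealCLM.comp (fderiv ℝ f z)) z :=
      Complex.ofRealCLM.hasFDerivAt.comp z (hf.differentiable (by simp) z).hasFDerivAt
    rw [h2.fderiv]
    rfl
  have hF0 : ∀ z, F z = (χ z : ℂ) := fun z => rfl
  have hF2 : ∀ i j z, (LineDeriv.lineDerivOp (e i) (LineDeriv.lineDerivOp (e j) F : SchwartzMap (Space n) ℂ) :
      SchwartzMap (Space n) ℂ) z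
      = ((pd (e i) (pd (e j) χ) z : ℝ) : ℂ) := fun i j z =>
    hderiv _ _ (contDiff_pd _ hχ) (fun z => hderiv F χ hχ hF0 (e j) z) (e i) z
  have hfour : ∀ i j ξ, (𝓕 (LineDeriv.lineDerivOp (e i) (LineDeriv.lineDerivOp (e j) F :
      SchwartzMap (Space n) ℂ) : SchwartzMap (Space n) ℂ) : SchwartzMap (Space n) ℂ) ξ
      = (2 * Real.pi * Complex.I) ^ 2 * ((ξ i : ℂ) * (ξ j : ℂ)) * (𝓕 F) ξ := by
    intro i j ξ
    have ht : ∀ m : Space n, (fun x : Space n => (inner ℝ x m : ℝ)).HasTemperateGrowth := by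
      intro m; fun_prop
    rw [SchwartzMap.fourier_lineDerivOp_eq, SchwartzMap.fourier_lineDerivOp_eq]
    simp only [_root_.smul_apply, SchwartzMap.smulLeftCLM_apply_apply (ht _)]
    have hin : ∀ j, inner ℝ ξ (e j) = ξ j := by
      intro j; simp [e, EuclideanSpace.inner_single_right]
    simp only [hin, smul_eq_mul, Complex.real_smul]
    ring
  set D : SchwartzMap (Space n) ℂ :=
    ∑ i, LineDeriv.lineDerivOp (e i) (LineDeriv.lineDerivOp (e i) F) with hD
  have hDcoe : (fun z : Space n => ((∑ i, pd (e i) (pd (e i) χ) z : ℝ) : ℂ)) = (D : Space n → ℂ) := by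
    ext z
    rw [hD, _root_.sum_apply]
    push_cast
    exact Finset.sum_congr rfl fun i _ => (hF2 i i z).symm
  have hDf : ∀ ξ, 𝓕 (D : Space n → ℂ) ξ
      = (2 * Real.pi * Complex.I) ^ 2 * ((‖ξ‖ ^ 2 : ℝ) : ℂ) * (𝓕 F) ξ := by
    intro ξ
    rw [← SchwartzMap.fourier_coe, hD]
    have : 𝓕 (∑ i, LineDeriv.lineDerivOp (e i) (LineDeriv.lineDerivOp (e i) F))
        = ∑ i, 𝓕 (LineDeriv.lineDerivOp (e i) (LineDeriv.lineDerivOp (e i) F)) := by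
      simp only [← SchwartzMap.fourierTransformCLM_apply (𝕜 := ℂ), map_sum]
    rw [this, _root_.sum_apply]
    simp only [hfour]
    rw [EuclideanSpace.norm_sq_eq, ← Finset.sum_mul, ← Finset.mul_sum]
    congr 2
    push_cast
    refine Finset.sum_congr rfl fun i _ => ?_
    rw [Real.norm_eq_abs, ← Complex.ofReal_pow, sq_abs]
    push_cast; ring
  have hmul : (fun ξ : Space n => ((ξ l * ξ k / ‖ξ‖ ^ 2 : ℝ) : ℂ) * 𝓕 (D : Space n → ℂ) ξ)
      = ((𝓕 (LineDeriv.lineDerivOp (e l) (LineDeriv.lineDerivOp (e k) F)) :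
          SchwartzMap (Space n) ℂ) : Space n → ℂ) := by
    ext ξ
    rw [hDf, hfour]
    -- At the origin the multiplier is 0/0 = 0 by convention, and both symbols vanish there.
    by_cases hξ : ξ = 0
    · simp [hξ]
    · have : ((‖ξ‖ : ℝ) : ℂ) ≠ 0 := by simpa using hξ
      push_cast
      field_simp
  unfold doubleRiesz
  rw [hDcoe, hmul, ← SchwartzMap.fourierInv_coe, FourierTransform.fourierInv_fourier_eq, hF2]
  simp [e]

end Riesz

/-! ### The energy bound, uniform in time. -/

section Energy

variable {n : ℕ}

/-- A weakly continuous field has bounded energy, by the uniform boundedness principle. -/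
theorem IsWeakSolution.exists_eLpNorm_le {T : ℝ} {u : ℝ → Space n → Space n} {u₀ : Space n → Space n}
    (hu : IsWeakSolution T u u₀) :
    ∃ C : ℝ, ∀ t ∈ Icc 0 T, eLpNorm (u t) 2 volume ≤ ENNReal.ofReal C := by
  let E := Lp (Space n) 2 (volume : Measure (Space n))
  let w : Icc 0 T → E := fun t => (hu.memLp t t.2).toLp (u t)
  obtain ⟨C, hC⟩ := banach_steinhaus (g := fun t : Icc 0 T => innerSL ℝ (w t)) (fun φ => by
    have hcont := hu.weaklyContinuous φ (Lp.memLp φ)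
    obtain ⟨C, hC⟩ := isCompact_Icc.exists_bound_of_continuousOn hcont
    refine ⟨C, fun t => ?_⟩
    have : innerSL ℝ (w t) φ = ∫ x, inner ℝ (u t x) (φ x) := by
      rw [innerSL_apply_apply, L2.inner_def]
      refine integral_congr_ae ?_
      filter_upwards [(hu.memLp t t.2).coeFn_toLp] with x hx
      rw [hx]
    rw [this]
    exact hC t t.2)
  refine ⟨C, fun t ht => ?_⟩
  have h1 := hC ⟨t, ht⟩
  rw [innerSL_apply_norm, Lp.norm_toLp] at h1
  rw [← ENNReal.ofReal_toReal (hu.memLp t ht).eLpNorm_ne_top]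
  exact ENNReal.ofReal_le_ofReal h1

/-- Square integrability at each single time would not suffice; the bound of `exists_eLpNorm_le` is
uniform in time, and [0,T] has finite length. -/
theorem IsWeakSolution.lintegral_sq_lt_top {T : ℝ} {u : ℝ → Space n → Space n}
    {u₀ : Space n → Space n} (hu : IsWeakSolution T u u₀) :
    ∫⁻ q, ‖u q.1 q.2‖ₑ ^ 2 ∂((volume.restrict (Icc 0 T)).prod volume) < ⊤ := by
  obtain ⟨C, hC⟩ := hu.exists_eLpNorm_le
  rw [lintegral_prod _ (hu.measurable.enorm.pow_const 2)]
  calc ∫⁻ t in Icc 0 T, ∫⁻ x, ‖u t x‖ₑ ^ 2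
      ≤ ∫⁻ t in Icc 0 T, (ENNReal.ofReal C) ^ 2 := by
        refine setLIntegral_mono' measurableSet_Icc fun t ht => ?_
        have h := eLpNorm_nnreal_pow_eq_lintegral (f := u t) (μ := volume) (p := 2) (by simp)
        simp only [NNReal.coe_ofNat, ENNReal.rpow_ofNat] at h
        have h2 := hC t ht
        calc ∫⁻ x, ‖u t x‖ₑ ^ 2 = eLpNorm (u t) 2 volume ^ 2 := by
              rw [← h]; rfl
          _ ≤ _ := by gcongr
    _ < ⊤ := by
        rw [setLIntegral_const]
        exact ENNReal.mul_lt_top (by simp) (by simp)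

end Energy

/-! ### The momentum equation with pressure, tested with Laplacians. -/

section LocalMomentum

variable {n : ℕ}

/-- The vector field with the given components. -/
noncomputable def vec {X : Type*} (f : Fin n → X → ℝ) : X → Space n :=
  fun q => WithLp.toLp 2 fun j => f j q

theorem contDiff_vec {V : Type*} [NormedAddCommGroup V] [NormedSpace ℝ V] {f : Fin n → V → ℝ}
    (hf : ∀ j, ContDiff ℝ ∞ (f j)) : ContDiff ℝ ∞ (vec f) := by
  rw [contDiff_euclidean]
  exact hf

theorem fderiv_vec_apply {V : Type*} [NormedAddCommGroup V] [NormedSpace ℝ V] {f : Fin n → V → ℝ}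
    (hf : ∀ j, ContDiff ℝ ∞ (f j)) (q w : V) (j : Fin n) :
    fderiv ℝ (vec f) q w j = pd w (f j) q := by
  have h := (EuclideanSpace.proj (𝕜 := ℝ) j).hasFDerivAt.comp q
    ((contDiff_vec hf).differentiable (by simp) q).hasFDerivAt
  have h2 : (EuclideanSpace.proj (𝕜 := ℝ) j : Space n → ℝ) ∘ vec f = f j := rfl
  rw [h2] at h
  unfold pd
  rw [h.fderiv]
  rfl

theorem tsupport_vec_subset {X : Type*} [TopologicalSpace X] {f : Fin n → X → ℝ} {K : Set X}
    (hK : IsClosed K) (hf : ∀ j, tsupport (f j) ⊆ K) : tsupport (vec f) ⊆ K := by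
  refine closure_minimal (fun q hq => ?_) hK
  by_contra h
  refine hq ?_
  ext j
  exact image_eq_zero_of_notMem_tsupport (f := f j) (x := q) fun h' => h (hf j h')

variable {T : ℝ} {u : ℝ → Space n → Space n} {u₀ : Space n → Space n}

theorem IsWeakSolution.aestronglyMeasurable_coord (hu : IsWeakSolution T u u₀) (i : Fin n) :
    AEStronglyMeasurable (fun q : ℝ × Space n => u q.1 q.2 i)
      ((volume.restrict (Icc 0 T)).prod volume) :=
  (EuclideanSpace.proj (𝕜 := ℝ) i).continuous.comp_aestronglyMeasurable hu.measurable

theorem IsWeakSolution.integrable_sq (hu : IsWeakSolution T u u₀) :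
    Integrable (fun q : ℝ × Space n => ‖u q.1 q.2‖ ^ 2)
      ((volume.restrict (Icc 0 T)).prod volume) := by
  refine ⟨hu.measurable.norm.pow 2, ?_⟩
  refine lt_of_le_of_lt (lintegral_mono fun q => ?_) hu.lintegral_sq_lt_top
  simp

theorem IsWeakSolution.integrable_mul_mul (hu : IsWeakSolution T u u₀) (i j : Fin n)
    {g : ℝ × Space n → ℝ} (hg : Continuous g) (hc : HasCompactSupport g) :
    Integrable (fun q : ℝ × Space n => u q.1 q.2 i * u q.1 q.2 j * g q)
      ((volume.restrict (Icc 0 T)).prod volume) := by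
  obtain ⟨C, hC⟩ := hc.exists_bound_of_continuous hg
  refine Integrable.mono' (hu.integrable_sq.mul_const C)
    (((hu.aestronglyMeasurable_coord i).mul (hu.aestronglyMeasurable_coord j)).mul
      hg.aestronglyMeasurable) (ae_of_all _ fun q => ?_)
  rw [norm_mul, norm_mul, sq]
  gcongr
  · exact PiLp.norm_apply_le _ _
  · exact PiLp.norm_apply_le _ _
  · exact hC q

theorem IsWeakSolution.integrable_mul (hu : IsWeakSolution T u u₀) (i : Fin n)
    {g : ℝ × Space n → ℝ} (hg : Continuous g) (hc : HasCompactSupport g) :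
    Integrable (fun q : ℝ × Space n => u q.1 q.2 i * g q)
      ((volume.restrict (Icc 0 T)).prod volume) := by
  obtain ⟨C, hC⟩ := hc.exists_bound_of_continuous hg
  have hgi : Integrable g ((volume.restrict (Icc 0 T)).prod volume) :=
    hg.integrable_of_hasCompactSupport hc
  refine Integrable.mono' ((hu.integrable_sq.mul_const C).add hgi.norm)
    ((hu.aestronglyMeasurable_coord i).mul hg.aestronglyMeasurable) (ae_of_all _ fun q => ?_)
  have h1 : ‖u q.1 q.2 i‖ ≤ ‖u q.1 q.2‖ := PiLp.norm_apply_le _ _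
  -- Only the square of u is known to be integrable on the whole slab; the constant 1 becomes
  -- integrable through the factor g.
  have h2 : ‖u q.1 q.2 i‖ ≤ ‖u q.1 q.2‖ ^ 2 + 1 := by nlinarith [sq_nonneg (‖u q.1 q.2‖ - 1)]
  have h3 := hC q
  simp only [Pi.add_apply]
  rw [norm_mul]
  calc ‖u q.1 q.2 i‖ * ‖g q‖ ≤ (‖u q.1 q.2‖ ^ 2 + 1) * ‖g q‖ := by gcongr
    _ ≤ ‖u q.1 q.2‖ ^ 2 * C + ‖g q‖ := by
      rw [add_mul, one_mul]; gcongr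

theorem intervalIntegral_integral_eq {G : Type*} [NormedAddCommGroup G] [NormedSpace ℝ G]
    (hT : 0 ≤ T) {f : ℝ × Space n → G}
    (hf : Integrable f ((volume.restrict (Icc 0 T)).prod volume)) :
    ∫ t in (0 : ℝ)..T, ∫ x, f (t, x) = ∫ q, f q ∂((volume.restrict (Icc 0 T)).prod volume) := by
  rw [integral_prod _ hf, intervalIntegral.integral_of_le hT, integral_Icc_eq_integral_Ioc]

theorem restrict_Icc_prod_volume :
    (volume.restrict (Icc 0 T)).prod (volume : Measure (Space n))
      = (volume : Measure (ℝ × Space n)).restrict (Icc 0 T ×ˢ univ) := by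
  rw [Measure.volume_eq_prod, ← Measure.prod_restrict, Measure.restrict_univ]

/-- The Riesz transforms act in space only, so `doubleRiesz_laplacian` applies to each time slice of
χ. The products u_l u_k are integrable on the slab, which permits exchanging the finite sums with
the time integral and applying Fubini. -/
theorem IsWeakSolution.pressurePairing_laplacian (hu : IsWeakSolution T u u₀) (hT : 0 ≤ T)
    {χ : ℝ × Space n → ℝ} (hχ : ContDiff ℝ ∞ χ) (hc : HasCompactSupport χ) :
    ∫ t in (0 : ℝ)..T, pressurePairing (u t) (fun x => lap χ (t, x))
      = - ∑ l, ∑ k, ∫ q : ℝ × Space n, u q.1 q.2 l * u q.1 q.2 k * pd (sdir l) (pd (sdir k) χ) q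
          ∂((volume.restrict (Icc 0 T)).prod volume) := by
  have hpp : ∀ t, pressurePairing (u t) (fun x => lap χ (t, x))
      = - ∑ l, ∑ k, ∫ x, u t x l * u t x k * pd (sdir l) (pd (sdir k) χ) (t, x) := by
    intro t
    unfold pressurePairing
    congr 1
    refine Finset.sum_congr rfl fun l _ => Finset.sum_congr rfl fun k _ => ?_
    refine integral_congr_ae (ae_of_all _ fun x => ?_)
    have h1 : (fun x => lap χ (t, x)) = fun z => ∑ i, pd (EuclideanSpace.single i 1)
        (pd (EuclideanSpace.single i 1) fun z => χ (t, z)) z := by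
      ext z
      unfold lap
      refine Finset.sum_congr rfl fun i _ => ?_
      rw [pd_slice i hχ, pd_slice i (contDiff_pd _ hχ)]
    simp only
    rw [h1, doubleRiesz_laplacian l k (contDiff_slice hχ t) (hasCompactSupport_slice hc t),
      pd_slice k hχ, pd_slice l (contDiff_pd _ hχ)]
  simp only [hpp]
  have hint : ∀ l k, Integrable (fun q : ℝ × Space n => u q.1 q.2 l * u q.1 q.2 k *
      pd (sdir l) (pd (sdir k) χ) q) ((volume.restrict (Icc 0 T)).prod volume) := fun l k =>
    hu.integrable_mul_mul l k (contDiff_pd _ (contDiff_pd _ hχ)).continuous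
      (hasCompactSupport_pd _ (hasCompactSupport_pd _ hc))
  have hint2 : ∀ l k, IntervalIntegrable (fun t => ∫ x, u t x l * u t x k *
      pd (sdir l) (pd (sdir k) χ) (t, x)) volume 0 T := by
    intro l k
    rw [intervalIntegrable_iff_integrableOn_Icc_of_le hT]
    exact (hint l k).integral_prod_left
  rw [intervalIntegral.integral_neg, intervalIntegral.integral_finsetSum]
  · congr 1
    refine Finset.sum_congr rfl fun l _ => ?_
    rw [intervalIntegral.integral_finsetSum fun k _ => hint2 l k]
    exact Finset.sum_congr rfl fun k _ => intervalIntegral_integral_eq hT (hint l k)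
  · intro l _
    simpa only [Finset.sum_fn] using IntervalIntegrable.sum Finset.univ fun k _ => hint2 l k

/-- Testing the momentum equation with the divergence free field `Δκ eᵢ - ∇∂ᵢκ`. -/
theorem IsWeakSolution.momentum_curl (hu : IsWeakSolution T u u₀) (hT : 0 ≤ T)
    {κ : ℝ × Space n → ℝ} (hκ : ContDiff ℝ ∞ κ) (hc : HasCompactSupport κ)
    (hsupp : tsupport κ ⊆ Ioo 0 T ×ˢ univ) (i : Fin n) :
    (∫ q : ℝ × Space n, u q.1 q.2 i * pd (1, 0) (lap κ) q
        ∂((volume.restrict (Icc 0 T)).prod volume))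
      + (∫ q : ℝ × Space n, u q.1 q.2 i * pd (0, u q.1 q.2) (lap κ) q
        ∂((volume.restrict (Icc 0 T)).prod volume))
      - ∑ l, ∑ k, (∫ q : ℝ × Space n, u q.1 q.2 l * u q.1 q.2 k *
          pd (sdir l) (pd (sdir k) (pd (sdir i) κ)) q
        ∂((volume.restrict (Icc 0 T)).prod volume)) = 0 := by
  set μ := (volume.restrict (Icc 0 T)).prod (volume : Measure (Space n)) with hμ
  let f : Fin n → ℝ × Space n → ℝ := fun j q =>
    (if j = i then lap κ q else 0) - pd (sdir j) (pd (sdir i) κ) q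
  have hfa : ∀ j, ContDiff ℝ ∞ (fun q => if j = i then lap κ q else 0) := by
    intro j
    by_cases h : j = i
    · simpa [h] using contDiff_lap hκ
    · simpa [h] using contDiff_const
  have hf : ∀ j, ContDiff ℝ ∞ (f j) := fun j =>
    (hfa j).sub (contDiff_pd _ (contDiff_pd _ hκ))
  have hpdf : ∀ w j q, pd w (f j) q = (if j = i then pd w (lap κ) q else 0)
      - pd w (pd (sdir j) (pd (sdir i) κ)) q := by
    intro w j q
    have h1 := fderiv_fun_sub ((hfa j).differentiable (by simp) q)
      ((contDiff_pd (sdir j) (contDiff_pd (sdir i) hκ)).differentiable (by simp) q)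
    change fderiv ℝ (fun q => _ - _) q w = _
    rw [h1]
    by_cases h : j = i
    · simp [h, ← pd.eq_1]
    · simp [h, ← pd.eq_1]
  have hfs : ∀ j, tsupport (f j) ⊆ tsupport κ := by
    intro j
    refine closure_minimal (fun q hq => ?_) (isClosed_tsupport _)
    by_contra h
    refine hq ?_
    have h1 : lap κ q = 0 := image_eq_zero_of_notMem_tsupport fun h' => h (tsupport_lap_subset _ h')
    have h2 : pd (sdir j) (pd (sdir i) κ) q = 0 := image_eq_zero_of_notMem_tsupport fun h' =>
      h (tsupport_pd_subset _ _ (tsupport_pd_subset _ _ h'))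
    simp [f, h1, h2]
  let ψ := vec f
  have hψ : ContDiff ℝ ∞ ψ := contDiff_vec hf
  have hψs : tsupport ψ ⊆ tsupport κ := tsupport_vec_subset (isClosed_tsupport _) hfs
  have hψc : HasCompactSupport ψ := hc.of_isClosed_subset (isClosed_tsupport _) hψs
  -- The support of κ avoids the times 0 and T, so the terms at final and initial time drop out of
  -- the weak formulation.
  have hzero : ∀ t, t ∉ Ioo 0 T → ∀ x, ψ (t, x) = 0 := fun t ht x =>
    image_eq_zero_of_notMem_tsupport fun h => ht (hsupp (hψs h)).1
  have hslice : ∀ t x w, fderiv ℝ (fun z => ψ (t, z)) x w = fderiv ℝ ψ (t, x) (0, w) := by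
    intro t x w
    rw [(hasFDerivAt_slice (hψ.differentiable (by simp) _)).fderiv]
    rfl
  have hdiv : ∀ t ∈ Icc 0 T, ∀ x, divergence (fun z => ψ (t, z)) x = 0 := by
    intro t _ x
    unfold divergence
    simp only [hslice]
    have : ∀ j : Fin n, fderiv ℝ ψ (t, x) (0, EuclideanSpace.single j 1) j
        = pd (sdir j) (f j) (t, x) := fun j => fderiv_vec_apply hf _ _ j
    simp only [this, hpdf, Finset.sum_sub_distrib, Finset.sum_ite_eq', Finset.mem_univ, if_true]
    rw [pd_lap _ hκ, lap, sub_self]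
  have hmom := hu.momentum ψ hψ hψc hdiv T ⟨hT, le_rfl⟩
  simp only [hzero T (by simp), hzero 0 (by simp), inner_zero_right, integral_zero, sub_zero,
    zero_sub] at hmom
  have hdt : ∀ s x j, deriv (fun τ => ψ (τ, x)) s j = pd (1, 0) (f j) (s, x) := by
    intro s x j
    have h1 : HasDerivAt (fun τ => ψ (τ, x)) (fderiv ℝ ψ (s, x) (1, 0)) s :=
      HasFDerivAt.comp_hasDerivAt (f := fun τ => (τ, x)) s
        (hψ.differentiable (by simp) (s, x)).hasFDerivAt
        ((hasDerivAt_id s).prodMk (hasDerivAt_const s x))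
    rw [h1.deriv]
    exact fderiv_vec_apply hf _ _ j
  have hinner : ∀ v w : Space n, inner ℝ v w = ∑ j, v j * w j := by
    intro v w
    rw [PiLp.inner_apply]
    exact Finset.sum_congr rfl fun j _ => by simp [mul_comm]
  have hIa : Integrable (fun q : ℝ × Space n => u q.1 q.2 i * pd (1, 0) (lap κ) q) μ :=
    hu.integrable_mul i (contDiff_pd _ (contDiff_lap hκ)).continuous
      (hasCompactSupport_pd _ (hasCompactSupport_lap hc))
  have hIb : Integrable (fun q : ℝ × Space n => pd (0, u q.1 q.2) (pd (1, 0) (pd (sdir i) κ)) q)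
      μ := by
    simp only [fderiv_eq_sum_pd]
    refine integrable_finsetSum _ fun k _ => hu.integrable_mul k ?_ ?_
    · exact (contDiff_pd _ (contDiff_pd _ (contDiff_pd _ hκ))).continuous
    · exact hasCompactSupport_pd _ (hasCompactSupport_pd _ (hasCompactSupport_pd _ hc))
  have hIc : Integrable (fun q : ℝ × Space n => u q.1 q.2 i * pd (0, u q.1 q.2) (lap κ) q) μ := by
    simp only [fderiv_eq_sum_pd, Finset.mul_sum, ← mul_assoc]
    refine integrable_finsetSum _ fun k _ => hu.integrable_mul_mul i k ?_ ?_
    · exact (contDiff_pd _ (contDiff_lap hκ)).continuous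
    · exact hasCompactSupport_pd _ (hasCompactSupport_lap hc)
  have hId : ∀ l k, Integrable (fun q : ℝ × Space n => u q.1 q.2 l * u q.1 q.2 k *
      pd (sdir l) (pd (sdir k) (pd (sdir i) κ)) q) μ := fun l k =>
    hu.integrable_mul_mul l k (contDiff_pd _ (contDiff_pd _ (contDiff_pd _ hκ))).continuous
      (hasCompactSupport_pd _ (hasCompactSupport_pd _ (hasCompactSupport_pd _ hc)))
  have hL : ∀ s x, inner ℝ (u s x) (deriv (fun τ => ψ (τ, x)) s)
      = u s x i * pd (1, 0) (lap κ) (s, x)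
        - pd (0, u s x) (pd (1, 0) (pd (sdir i) κ)) (s, x) := by
    intro s x
    rw [hinner, fderiv_eq_sum_pd]
    simp only [hdt, hpdf, mul_sub, Finset.sum_sub_distrib, mul_ite, mul_zero, Finset.sum_ite_eq',
      Finset.mem_univ, if_true]
    congr 1
    refine Finset.sum_congr rfl fun j _ => ?_
    rw [pd_comm (1, 0) (sdir j) (contDiff_pd _ hκ)]
  have hR : ∀ s x, inner ℝ (u s x) (fderiv ℝ (fun z => ψ (s, z)) x (u s x))
      = u s x i * pd (0, u s x) (lap κ) (s, x)
        - ∑ l, ∑ k, u s x l * u s x k * pd (sdir l) (pd (sdir k) (pd (sdir i) κ)) (s, x) := by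
    intro s x
    rw [hinner]
    have : ∀ j, fderiv ℝ (fun z => ψ (s, z)) x (u s x) j = pd (0, u s x) (f j) (s, x) := by
      intro j
      rw [hslice]
      exact fderiv_vec_apply hf _ _ j
    simp only [this, hpdf, mul_sub, Finset.sum_sub_distrib, mul_ite, mul_zero, Finset.sum_ite_eq',
      Finset.mem_univ, if_true]
    congr 1
    refine Finset.sum_congr rfl fun j _ => ?_
    rw [fderiv_eq_sum_pd, Finset.mul_sum]
    refine Finset.sum_congr rfl fun k _ => ?_
    rw [pd_comm (sdir k) (sdir j) (contDiff_pd _ hκ), mul_assoc]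
  simp only [hL, hR] at hmom
  rw [intervalIntegral_integral_eq hT (f := fun q : ℝ × Space n =>
      u q.1 q.2 i * pd (1, 0) (lap κ) q - pd (0, u q.1 q.2) (pd (1, 0) (pd (sdir i) κ)) q)
      (hIa.sub hIb),
    intervalIntegral_integral_eq hT (f := fun q : ℝ × Space n =>
      u q.1 q.2 i * pd (0, u q.1 q.2) (lap κ) q
        - ∑ l, ∑ k, u q.1 q.2 l * u q.1 q.2 k * pd (sdir l) (pd (sdir k) (pd (sdir i) κ)) q)
      (hIc.sub (integrable_finsetSum _ fun l _ => integrable_finsetSum _ fun k _ => hId l k)),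
    integral_sub hIa hIb,
    integral_sub hIc (integrable_finsetSum _ fun l _ => integrable_finsetSum _ fun k _ => hId l k),
    integral_finsetSum _ (fun l _ => integrable_finsetSum _ fun k _ => hId l k)] at hmom
  simp only [fun l => integral_finsetSum Finset.univ (fun k _ => hId l k)] at hmom
  -- The gradient part of ψ contributes u · ∇(∂_t ∂ᵢκ) to the time derivative term, which integrates
  -- to zero at each time because u is divergence free. Its contribution to the convective term
  -- survives as the double sum.
  have hdf : ∫ q : ℝ × Space n, pd (0, u q.1 q.2) (pd (1, 0) (pd (sdir i) κ)) q ∂μ = 0 := by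
    rw [integral_prod _ hIb]
    refine integral_eq_zero_of_ae ?_
    filter_upwards [ae_restrict_mem measurableSet_Icc] with t ht
    have h1 := contDiff_pd ((1 : ℝ), (0 : Space n)) (contDiff_pd (sdir i) hκ)
    have h := hu.divergenceFree t ht (fun x => pd (1, 0) (pd (sdir i) κ) (t, x))
      (contDiff_slice h1 t) (hasCompactSupport_slice
        (hasCompactSupport_pd _ (hasCompactSupport_pd _ hc)) t)
    simpa only [fderiv_slice h1, Pi.zero_apply] using h
  rw [hdf] at hmom
  linarith

/-- The momentum equation with pressure, tested with Laplacians of functions supported in the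
region where the pressure is a function. -/
theorem IsWeakSolution.momentum_laplacian (hu : IsWeakSolution T u u₀) (hT : 0 ≤ T)
    {p : ℝ → Space n → ℝ} {W : Set (ℝ × Space n)} (hp : IsPressureOn T u p W)
    (hW : W ⊆ Ioo 0 T ×ˢ univ)
    {κ : ℝ × Space n → ℝ} (hκ : ContDiff ℝ ∞ κ) (hc : HasCompactSupport κ)
    (hsupp : tsupport κ ⊆ W) (i : Fin n) :
    (∫ q : ℝ × Space n, u q.1 q.2 i * pd (1, 0) (lap κ) q
        ∂((volume.restrict (Icc 0 T)).prod volume))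
      + (∫ q : ℝ × Space n, u q.1 q.2 i * pd (0, u q.1 q.2) (lap κ) q
        ∂((volume.restrict (Icc 0 T)).prod volume))
      + (∫ q : ℝ × Space n, p q.1 q.2 * pd (sdir i) (lap κ) q) = 0 := by
  have h1 := hu.momentum_curl hT hκ hc (hsupp.trans hW) i
  have hχ := contDiff_pd (sdir i) hκ
  have hχc := hasCompactSupport_pd (sdir i) hc
  -- With χ = ∂ᵢκ, the pressure tested with Δ∂ᵢκ is exactly minus the double sum of `momentum_curl`.
  have h2 := hu.pressurePairing_laplacian hT hχ hχc
  rw [hp.pairing _ (contDiff_lap hχ) (hasCompactSupport_lap hχc)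
    ((tsupport_lap_subset _).trans ((tsupport_pd_subset _ _).trans hsupp))] at h2
  rw [pd_lap (sdir i) hκ, h2]
  linarith

end LocalMomentum

/-! ### An explicit radial potential and its averaging kernel. -/

section Kernel

variable {n : ℕ}

/-- A radial potential supported in the ball of radius `δ`. -/
noncomputable def radialPotential (δ : ℝ) (z : Space n) : ℝ := (max (δ ^ 2 - ‖z‖ ^ 2) 0) ^ 2

/-- The radial averaging kernel `ρ` with `∇(radialPotential) = - ρ(z) z`. -/
noncomputable def radialKernel (δ : ℝ) (z : Space n) : ℝ := 4 * max (δ ^ 2 - ‖z‖ ^ 2) 0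

theorem continuous_radialKernel (δ : ℝ) : Continuous (radialKernel (n := n) δ) := by
  unfold radialKernel; fun_prop

theorem continuous_radialPotential (δ : ℝ) : Continuous (radialPotential (n := n) δ) := by
  unfold radialPotential; fun_prop

theorem radialKernel_nonneg (δ : ℝ) (z : Space n) : 0 ≤ radialKernel δ z := by
  unfold radialKernel; positivity

theorem radialPotential_nonneg (δ : ℝ) (z : Space n) : 0 ≤ radialPotential δ z := by
  unfold radialPotential; positivity

theorem max_sub_sq_eq_zero {δ : ℝ} (hδ : 0 < δ) {z : Space n} (hz : δ ≤ ‖z‖) :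
    max (δ ^ 2 - ‖z‖ ^ 2) 0 = 0 := by
  refine max_eq_right ?_
  nlinarith

theorem radialKernel_eq_zero {δ : ℝ} (hδ : 0 < δ) {z : Space n} (hz : δ ≤ ‖z‖) :
    radialKernel δ z = 0 := by
  simp [radialKernel, max_sub_sq_eq_zero hδ hz]

theorem radialPotential_eq_zero {δ : ℝ} (hδ : 0 < δ) {z : Space n} (hz : δ ≤ ‖z‖) :
    radialPotential δ z = 0 := by
  simp [radialPotential, max_sub_sq_eq_zero hδ hz]

theorem hasCompactSupport_radialKernel {δ : ℝ} (hδ : 0 < δ) :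
    HasCompactSupport (radialKernel (n := n) δ) :=
  HasCompactSupport.intro (isCompact_closedBall 0 δ) fun z hz => by
    refine radialKernel_eq_zero hδ ?_
    simp only [Metric.mem_closedBall, dist_zero_right, not_le] at hz
    exact hz.le

theorem hasCompactSupport_radialPotential {δ : ℝ} (hδ : 0 < δ) :
    HasCompactSupport (radialPotential (n := n) δ) :=
  HasCompactSupport.intro (isCompact_closedBall 0 δ) fun z hz => by
    refine radialPotential_eq_zero hδ ?_
    simp only [Metric.mem_closedBall, dist_zero_right, not_le] at hz
    exact hz.le

theorem integrable_radialKernel {δ : ℝ} (hδ : 0 < δ) :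
    Integrable (radialKernel (n := n) δ) volume :=
  (continuous_radialKernel δ).integrable_of_hasCompactSupport (hasCompactSupport_radialKernel hδ)

theorem integral_radialKernel_pos {δ : ℝ} (hδ : 0 < δ) :
    0 < ∫ z, radialKernel (n := n) δ z := by
  refine (continuous_radialKernel δ).integral_pos_of_hasCompactSupport_nonneg_nonzero
    (hasCompactSupport_radialKernel hδ) (radialKernel_nonneg δ) (x := 0) ?_
  simp [radialKernel, hδ.ne']

/-- Squaring removes the corner of the positive part, since at 0 the function is O(x²). This makes
`radialPotential` differentiable across its boundary sphere, which is all that one integration by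
parts needs. -/
theorem hasDerivAt_max_zero_sq (x : ℝ) :
    HasDerivAt (fun x : ℝ => (max x 0) ^ 2) (2 * max x 0) x := by
  rcases lt_trichotomy x 0 with h | h | h
  · rw [max_eq_right h.le, mul_zero]
    refine (hasDerivAt_const x (0 : ℝ)).congr_of_eventuallyEq ?_
    filter_upwards [gt_mem_nhds h] with y hy
    simp [max_eq_right hy.le]
  · subst h
    rw [max_self, mul_zero]
    refine HasDerivAt.of_isLittleO ?_
    simp only [max_self, ne_eq, OfNat.ofNat_ne_zero, not_false_eq_true, zero_pow, sub_zero,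
      smul_zero]
    refine Asymptotics.IsBigO.trans_isLittleO (g := fun x : ℝ => x ^ 2) ?_
      (Asymptotics.isLittleO_pow_id one_lt_two)
    refine Asymptotics.IsBigO.of_bound 1 (Eventually.of_forall fun y => ?_)
    rw [one_mul, norm_pow, norm_pow]
    refine pow_le_pow_left₀ (norm_nonneg _) ?_ 2
    rw [Real.norm_eq_abs, abs_of_nonneg (le_max_right _ _)]
    exact max_le (le_abs_self y) (abs_nonneg y)
  · rw [max_eq_left h.le]
    have h2 : HasDerivAt (fun x : ℝ => x ^ 2) (2 * x) x := by simpa using hasDerivAt_pow 2 x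
    refine h2.congr_of_eventuallyEq ?_
    filter_upwards [lt_mem_nhds h] with y hy
    simp [max_eq_left hy.le]

theorem hasFDerivAt_radialPotential (δ : ℝ) (z : Space n) :
    HasFDerivAt (radialPotential δ) (-(radialKernel δ z) • innerSL ℝ z) z := by
  have h1 : HasFDerivAt (fun z : Space n => δ ^ 2 - ‖z‖ ^ 2) (-(2 • innerSL ℝ z)) z :=
    (hasStrictFDerivAt_norm_sq z).hasFDerivAt.const_sub _
  have h2 := (hasDerivAt_max_zero_sq (δ ^ 2 - ‖z‖ ^ 2)).comp_hasFDerivAt z h1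
  refine h2.congr_fderiv ?_
  ext v
  simp [radialKernel]
  ring

/-- Integrated form of `Δ(potential) = ρ - (∫ ρ) δ₀`. -/
theorem integral_radialPotential_laplacian {δ : ℝ} (hδ : 0 < δ) {g : Space n → ℝ}
    (hg : ContDiff ℝ ∞ g) :
    ∫ ε in Icc (0 : ℝ) 1, ∫ z, ε * radialPotential δ z *
        (∑ i, pd (EuclideanSpace.single i 1) (pd (EuclideanSpace.single i 1) g) (ε • z))
      = (∫ z, radialKernel δ z * g z) - (∫ z, radialKernel (n := n) δ z) * g 0 := by
  -- The factor ε is produced by the chain rule for z ↦ ∂ᵢg(εz). One integration by parts moves a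
  -- derivative to the potential, whose gradient is -ρ(z) z, and the Laplacian turns into the radial
  -- derivative z·∇g(εz) weighted by ρ.
  have hinner : ∀ ε : ℝ, ∫ z, ε * radialPotential δ z *
        (∑ i, pd (EuclideanSpace.single i 1) (pd (EuclideanSpace.single i 1) g) (ε • z))
      = ∫ z, radialKernel δ z * pd z g (ε • z) := by
    intro ε
    let e : Fin n → Space n := fun i => EuclideanSpace.single i 1
    have hG : ∀ i, ContDiff ℝ ∞ (fun z : Space n => pd (e i) g (ε • z)) := fun i =>
      (contDiff_pd _ hg).comp (contDiff_const_smul ε)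
    have hGd : ∀ i z v, fderiv ℝ (fun z : Space n => pd (e i) g (ε • z)) z v
        = ε * pd v (pd (e i) g) (ε • z) := by
      intro i z v
      have h1 : HasFDerivAt (fun z : Space n => ε • z) (ε • ContinuousLinearMap.id ℝ _) z :=
        (hasFDerivAt_id z).const_smul ε
      have h2 := ((contDiff_pd (e i) hg).differentiable (by simp) (ε • z)).hasFDerivAt.comp z h1
      have h3 : (pd (e i) g ∘ fun z : Space n => ε • z) = fun z => pd (e i) g (ε • z) := rfl
      rw [h3] at h2
      rw [h2.fderiv]
      simp [pd]
    have hkd : ∀ z v : Space n, fderiv ℝ (radialPotential δ) z v = -(radialKernel δ z * inner ℝ z v) := by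
      intro z v
      rw [(hasFDerivAt_radialPotential δ z).fderiv]
      simp
    have hIBP : ∀ i, ∫ z, radialPotential δ z * (ε * pd (e i) (pd (e i) g) (ε • z))
        = ∫ z, radialKernel δ z * z i * pd (e i) g (ε • z) := by
      intro i
      have hcont1 : Continuous fun z : Space n => pd (e i) g (ε • z) := (hG i).continuous
      have hcont2 : Continuous fun z : Space n => ε * pd (e i) (pd (e i) g) (ε • z) :=
        continuous_const.mul ((contDiff_pd _ (contDiff_pd _ hg)).continuous.comp
          (continuous_const_smul ε))
      have h := integral_mul_fderiv_eq_neg_fderiv_mul_of_integrable (μ := volume)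
        (f := radialPotential δ) (g := fun z : Space n => pd (e i) g (ε • z)) (v := e i)
        ?_ ?_ ?_ ?_ ?_
      · simp only [hGd, hkd] at h
        rw [h, ← integral_neg]
        refine integral_congr_ae (ae_of_all _ fun z => ?_)
        simp [e, EuclideanSpace.inner_single_right]
      · simp only [hkd]
        have hc : Continuous fun z : Space n =>
            -(radialKernel δ z * inner ℝ z (e i)) * pd (e i) g (ε • z) :=
          ((continuous_radialKernel δ).mul (continuous_id.inner continuous_const)).neg.mul hcont1
        refine hc.integrable_of_hasCompactSupport ?_
        simp only [← mul_neg, mul_assoc]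
        exact (hasCompactSupport_radialKernel hδ).mul_right
      · simp only [hGd]
        exact ((continuous_radialPotential δ).mul hcont2).integrable_of_hasCompactSupport
          (hasCompactSupport_radialPotential hδ).mul_right
      · exact ((continuous_radialPotential δ).mul hcont1).integrable_of_hasCompactSupport
          (hasCompactSupport_radialPotential hδ).mul_right
      · exact fun z _ => (hasFDerivAt_radialPotential δ z).differentiableAt
      · exact fun z _ => (hG i).differentiable (by simp) z
    have hint1 : ∀ i, Integrable (fun z => radialPotential δ z *
        (ε * pd (e i) (pd (e i) g) (ε • z))) volume := fun i =>
      ((continuous_radialPotential δ).mul (continuous_const.mul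
        ((contDiff_pd _ (contDiff_pd _ hg)).continuous.comp
          (continuous_const_smul ε)))).integrable_of_hasCompactSupport
            (hasCompactSupport_radialPotential hδ).mul_right
    have hint2 : ∀ i, Integrable (fun z => radialKernel δ z * z i * pd (e i) g (ε • z)) volume :=
      fun i => (((continuous_radialKernel δ).mul (EuclideanSpace.proj (𝕜 := ℝ) i).continuous).mul
        (hG i).continuous).integrable_of_hasCompactSupport
          (hasCompactSupport_radialKernel hδ).mul_right.mul_right
    calc ∫ z, ε * radialPotential δ z * (∑ i, pd (e i) (pd (e i) g) (ε • z))
        = ∫ z, ∑ i, radialPotential δ z * (ε * pd (e i) (pd (e i) g) (ε • z)) := by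
          refine integral_congr_ae (ae_of_all _ fun z => ?_)
          simp only [Finset.mul_sum]
          exact Finset.sum_congr rfl fun i _ => by ring
      _ = ∑ i, ∫ z, radialKernel δ z * z i * pd (e i) g (ε • z) := by
          rw [integral_finsetSum _ fun i _ => hint1 i]
          exact Finset.sum_congr rfl fun i _ => hIBP i
      _ = ∫ z, radialKernel δ z * pd z g (ε • z) := by
          rw [← integral_finsetSum _ fun i _ => hint2 i]
          refine integral_congr_ae (ae_of_all _ fun z => ?_)
          simp only [mul_assoc, ← Finset.mul_sum]
          congr 1
          have := (EuclideanSpace.basisFun (Fin n) ℝ).sum_repr z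
          simp only [EuclideanSpace.basisFun_repr, EuclideanSpace.basisFun_apply] at this
          unfold pd
          conv_rhs => rw [← this]
          rw [map_sum]
          simp only [map_smul, smul_eq_mul, this, e]
  simp only [hinner]
  have hcF : Continuous fun r : ℝ × Space n => radialKernel δ r.2 * pd r.2 g (r.1 • r.2) := by
    refine ((continuous_radialKernel δ).comp continuous_snd).mul ?_
    unfold pd
    exact ((hg.continuous_fderiv (by simp)).comp (continuous_fst.smul continuous_snd)).clm_apply
      continuous_snd
  have hF : Integrable (fun r : ℝ × Space n => radialKernel δ r.2 * pd r.2 g (r.1 • r.2))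
      ((volume.restrict (Icc 0 1)).prod volume) := by
    rw [restrict_Icc_prod_volume]
    have h1 : IntegrableOn (fun r : ℝ × Space n => radialKernel δ r.2 * pd r.2 g (r.1 • r.2))
      (Icc 0 1 ×ˢ Metric.closedBall 0 δ) volume :=
      hcF.continuousOn.integrableOn_compact (isCompact_Icc.prod (isCompact_closedBall 0 δ))
    refine h1.of_forall_sdiff_eq_zero (measurableSet_Icc.prod MeasurableSet.univ) ?_
    rintro ⟨t, z⟩ ⟨h2, h3⟩
    have h4 : δ ≤ ‖z‖ := by
      by_contra h
      exact h3 ⟨h2.1, by simpa using (not_le.1 h).le⟩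
    simp [radialKernel_eq_zero hδ h4]
  rw [integral_integral_swap hF]
  -- The radial derivative is d/dε of g(εz); integration over ε compares g(z) with g(0), and this is
  -- the source of the point mass.
  have hFTC : ∀ z, ∫ ε in Icc (0 : ℝ) 1, radialKernel δ z * pd z g (ε • z)
      = radialKernel δ z * g z - radialKernel δ z * g 0 := by
    intro z
    rw [integral_const_mul, integral_Icc_eq_integral_Ioc,
      ← intervalIntegral.integral_of_le zero_le_one]
    have h := intervalIntegral.integral_eq_sub_of_hasDerivAt (a := 0) (b := 1)
      (f := fun ε : ℝ => g (ε • z)) (f' := fun ε => pd z g (ε • z)) (fun ε _ => by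
        have h1 : HasDerivAt (fun ε : ℝ => ε • z) ((1 : ℝ) • z) ε := (hasDerivAt_id ε).smul_const z
        rw [one_smul] at h1
        exact HasFDerivAt.comp_hasDerivAt (f := fun ε : ℝ => ε • z) ε
          (hg.differentiable (by simp) _).hasFDerivAt h1)
      (by
        refine Continuous.intervalIntegrable ?_ _ _
        unfold pd
        exact ((hg.continuous_fderiv (by simp)).comp (continuous_id.smul continuous_const)).clm_apply
          continuous_const)
    rw [h]
    simp [mul_sub]
  simp only [hFTC]
  rw [integral_sub, integral_mul_const]
  · exact ((continuous_radialKernel δ).mul hg.continuous).integrable_of_hasCompactSupport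
      (hasCompactSupport_radialKernel hδ).mul_right
  · exact (integrable_radialKernel hδ).mul_const _

end Kernel

/-! ### Convolution with a compactly supported parametrix of the Laplacian. -/

section Smoothing

variable {n : ℕ}

/-- The finite measure `m` on purely spatial space-time displacements with
`Δ m = ρ - (∫ ρ) δ₀`. -/
noncomputable def potentialMeasure (n : ℕ) (δ : ℝ) : Measure (ℝ × Space n) :=
  ((((volume.restrict (Icc (0 : ℝ) 1)).prod (volume : Measure (Space n))).withDensity
    fun r => ENNReal.ofReal (r.1 * radialPotential δ r.2)).map fun r => ((0 : ℝ), r.1 • r.2))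

theorem integrable_mul_radialPotential {δ : ℝ} (hδ : 0 < δ) :
    Integrable (fun r : ℝ × Space n => r.1 * radialPotential δ r.2)
      ((volume.restrict (Icc (0 : ℝ) 1)).prod volume) := by
  have h1 : Integrable (fun r : ℝ => r) (volume.restrict (Icc (0 : ℝ) 1)) :=
    continuous_id.continuousOn.integrableOn_compact isCompact_Icc
  exact h1.mul_prod ((continuous_radialPotential δ).integrable_of_hasCompactSupport
    (hasCompactSupport_radialPotential hδ))

theorem isFiniteMeasure_potentialMeasure {δ : ℝ} (hδ : 0 < δ) :
    IsFiniteMeasure (potentialMeasure n δ) := by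
  have : IsFiniteMeasure (((volume.restrict (Icc (0 : ℝ) 1)).prod
      (volume : Measure (Space n))).withDensity
      fun r => ENNReal.ofReal (r.1 * radialPotential δ r.2)) :=
    isFiniteMeasure_withDensity_ofReal (integrable_mul_radialPotential hδ).2
  unfold potentialMeasure
  infer_instance

theorem continuous_displacement :
    Continuous fun r : ℝ × Space n => ((0 : ℝ), r.1 • r.2) := by fun_prop

/-- The parametrix is a superposition of dilates of `radialPotential` over ε ∈ [0,1], carried as a
finite measure and not as a function. No singular Newtonian kernel appears, and all dimensions are
treated alike. -/
theorem integral_potentialMeasure (δ : ℝ) {G : ℝ × Space n → ℝ} (hG : Continuous G) :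
    ∫ w, G w ∂(potentialMeasure n δ)
      = ∫ r : ℝ × Space n, r.1 * radialPotential δ r.2 * G (0, r.1 • r.2)
        ∂((volume.restrict (Icc (0 : ℝ) 1)).prod volume) := by
  unfold potentialMeasure
  rw [integral_map continuous_displacement.aemeasurable hG.aestronglyMeasurable,
    integral_withDensity_eq_integral_toReal_smul]
  · refine integral_congr_ae ?_
    rw [restrict_Icc_prod_volume]
    filter_upwards [ae_restrict_mem (measurableSet_Icc.prod MeasurableSet.univ)] with r hr
    rw [ENNReal.toReal_ofReal (mul_nonneg hr.1.1 (radialPotential_nonneg _ _)), smul_eq_mul]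
  · exact ENNReal.measurable_ofReal.comp
      (measurable_fst.mul ((continuous_radialPotential δ).measurable.comp measurable_snd))
  · exact ae_of_all _ fun _ => ENNReal.ofReal_lt_top

/-- Convolution in space with the finite measure `potentialMeasure`. -/
noncomputable def potential (δ : ℝ) (φ : ℝ × Space n → ℝ) (q : ℝ × Space n) : ℝ :=
  ∫ w, φ (q - w) ∂(potentialMeasure n δ)

theorem hasFDerivAt_potential {δ : ℝ} (hδ : 0 < δ) {φ : ℝ × Space n → ℝ} (hφ : ContDiff ℝ ∞ φ)
    (hc : HasCompactSupport φ) (q : ℝ × Space n) :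
    HasFDerivAt (potential δ φ) (∫ w, fderiv ℝ φ (q - w) ∂(potentialMeasure n δ)) q := by
  have := isFiniteMeasure_potentialMeasure (n := n) hδ
  have hcd := hφ.continuous_fderiv (by simp)
  obtain ⟨C, hC⟩ := (hc.fderiv ℝ).exists_bound_of_continuous hcd
  obtain ⟨C', hC'⟩ := hc.exists_bound_of_continuous hφ.continuous
  refine hasFDerivAt_integral_of_dominated_of_fderiv_le (s := univ) (bound := fun _ => C)
    (F' := fun x w => fderiv ℝ φ (x - w)) univ_mem ?_ ?_ ?_ ?_
    (integrable_const (μ := potentialMeasure n δ) C) ?_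
  · exact Eventually.of_forall fun x =>
      (hφ.continuous.comp (continuous_const.sub continuous_id)).aestronglyMeasurable
  · exact Integrable.of_bound
      (hφ.continuous.comp (continuous_const.sub continuous_id)).aestronglyMeasurable C'
      (ae_of_all _ fun w => hC' _)
  · exact (hcd.comp (continuous_const.sub continuous_id)).aestronglyMeasurable
  · exact ae_of_all _ fun w x _ => hC _
  · refine ae_of_all _ fun w x _ => ?_
    exact (hφ.differentiable (by simp) (x - w)).hasFDerivAt.comp x
      ((hasFDerivAt_id x).sub_const w)

theorem pd_potential {δ : ℝ} (hδ : 0 < δ) {φ : ℝ × Space n → ℝ} (hφ : ContDiff ℝ ∞ φ)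
    (hc : HasCompactSupport φ) (v : ℝ × Space n) :
    pd v (potential δ φ) = potential δ (pd v φ) := by
  have := isFiniteMeasure_potentialMeasure (n := n) hδ
  ext q
  have hcd := hφ.continuous_fderiv (by simp)
  obtain ⟨C, hC⟩ := (hc.fderiv ℝ).exists_bound_of_continuous hcd
  have hint : Integrable (fun w => fderiv ℝ φ (q - w)) (potentialMeasure n δ) :=
    Integrable.of_bound (hcd.comp (continuous_const.sub continuous_id)).aestronglyMeasurable C
      (ae_of_all _ fun w => hC _)
  unfold pd potential
  have h := (hasFDerivAt_potential hδ hφ hc q).fderiv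
  unfold potential at h
  rw [h, ContinuousLinearMap.integral_apply hint]

/-- The measure is finite, so differentiation passes to φ, and the directional derivatives of φ are
again admissible. This drives the induction on the order of smoothness. -/
theorem contDiff_potential {δ : ℝ} (hδ : 0 < δ) {φ : ℝ × Space n → ℝ} (hφ : ContDiff ℝ ∞ φ)
    (hc : HasCompactSupport φ) : ContDiff ℝ ∞ (potential δ φ) := by
  rw [contDiff_infty]
  intro m
  induction m generalizing φ with
  | zero => exact contDiff_zero.2 (Differentiable.continuous (𝕜 := ℝ) fun q =>
      (hasFDerivAt_potential hδ hφ hc q).differentiableAt)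
  | succ m ih =>
    rw [Nat.cast_succ, contDiff_succ_iff_fderiv]
    refine ⟨fun q => (hasFDerivAt_potential hδ hφ hc q).differentiableAt,
      by simp, ?_⟩
    refine contDiff_clm_apply_iff.2 fun v => ?_
    have := ih (contDiff_pd v hφ) (hasCompactSupport_pd v hc)
    rwa [← pd_potential hδ hφ hc] at this

/-- This is `integral_radialPotential_laplacian` for y ↦ φ(q - (0, y)); the reflection changes the
sign of each of the two derivatives and so leaves the Laplacian alone. Up to an average, φ is a
multiple of the Laplacian of a compactly supported function. -/
theorem lap_potential_eq {δ : ℝ} (hδ : 0 < δ) {φ : ℝ × Space n → ℝ} (hφ : ContDiff ℝ ∞ φ)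
    (hc : HasCompactSupport φ) (q : ℝ × Space n) :
    lap (potential δ φ) q = (∫ z, radialKernel δ z * φ (q - (0, z)))
      - (∫ z, radialKernel (n := n) δ z) * φ q := by
  have := isFiniteMeasure_potentialMeasure (n := n) hδ
  have h1 : lap (potential δ φ) q = ∫ w, lap φ (q - w) ∂(potentialMeasure n δ) := by
    have hint : ∀ i : Fin n, Integrable (fun w => pd (sdir i) (pd (sdir i) φ) (q - w))
        (potentialMeasure n δ) := by
      intro i
      have hcc := hasCompactSupport_pd (sdir i) (hasCompactSupport_pd (sdir i) hc)
      have hco := (contDiff_pd (sdir i) (contDiff_pd (sdir i) hφ)).continuous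
      obtain ⟨C, hC⟩ := hcc.exists_bound_of_continuous hco
      exact Integrable.of_bound (hco.comp (continuous_const.sub continuous_id)).aestronglyMeasurable
        C (ae_of_all _ fun w => hC _)
    unfold lap
    rw [integral_finsetSum _ fun i _ => hint i]
    refine Finset.sum_congr rfl fun i _ => ?_
    rw [pd_potential hδ hφ hc, pd_potential hδ (contDiff_pd _ hφ) (hasCompactSupport_pd _ hc)]
    simp [potential]
  have hcl : Continuous fun w => lap φ (q - w) :=
    (contDiff_lap hφ).continuous.comp (continuous_const.sub continuous_id)
  rw [h1, integral_potentialMeasure δ hcl]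
  let g : Space n → ℝ := fun y => φ (q - (0, y))
  have hg : ContDiff ℝ ∞ g := hφ.comp (contDiff_const.sub (contDiff_prodMk_right 0))
  have hpdg : ∀ (f : ℝ × Space n → ℝ), ContDiff ℝ ∞ f → ∀ i,
      pd (EuclideanSpace.single i 1) (fun y => f (q - (0, y)))
        = fun y => - pd (sdir i) f (q - (0, y)) := by
    intro f hf i
    ext y
    unfold pd
    have h2 : HasFDerivAt (fun y : Space n => q - ((0 : ℝ), y))
        (-(ContinuousLinearMap.inr ℝ ℝ (Space n))) y :=
      (hasFDerivAt_prodMk_right (0 : ℝ) y).const_sub q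
    have h3 := (hf.differentiable (by simp) (q - (0, y))).hasFDerivAt.comp y h2
    have h4 : (f ∘ fun y : Space n => q - ((0 : ℝ), y)) = fun y => f (q - (0, y)) := rfl
    rw [h4] at h3
    rw [h3.fderiv]
    simp [sdir]
  have hlapg : ∀ y, lap φ (q - (0, y)) = ∑ i, pd (EuclideanSpace.single i 1)
      (pd (EuclideanSpace.single i 1) g) y := by
    intro y
    unfold lap
    refine Finset.sum_congr rfl fun i _ => ?_
    rw [hpdg φ hφ i]
    have h5 := hpdg _ (contDiff_pd (sdir i) hφ) i
    have h6 : (fun y => - pd (sdir i) φ (q - (0, y))) = -(fun y => pd (sdir i) φ (q - (0, y))) := rfl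
    rw [h6]
    unfold pd at h5 ⊢
    rw [fderiv_neg, _root_.neg_apply, congrFun h5 y, neg_neg]
  have hfin := integral_radialPotential_laplacian hδ hg
  have hint : Integrable (fun r : ℝ × Space n => r.1 * radialPotential δ r.2 *
      lap φ (q - (0, r.1 • r.2))) ((volume.restrict (Icc (0 : ℝ) 1)).prod volume) := by
    obtain ⟨C, hC⟩ := (hasCompactSupport_lap hc).exists_bound_of_continuous
      (contDiff_lap hφ).continuous
    exact (integrable_mul_radialPotential hδ).mul_bdd
      (hcl.comp continuous_displacement).aestronglyMeasurable (ae_of_all _ fun r => hC _)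
  rw [integral_prod _ hint]
  simp only [hlapg]
  rw [hfin]
  simp only [g, Prod.mk_zero_zero, sub_zero]

/-- The displacements εz satisfy ε ≤ 1 and |z| ≤ δ and do not involve time. A small δ therefore
keeps the potential inside the region where the pressure is a function. -/
theorem support_potential_subset {δ : ℝ} (hδ : 0 < δ) {φ : ℝ × Space n → ℝ}
    (hφ : Continuous φ) (hc : HasCompactSupport φ) :
    tsupport (potential δ φ) ⊆ tsupport φ + ({0} : Set ℝ) ×ˢ Metric.closedBall (0 : Space n) δ := by
  have hK : IsCompact (({0} : Set ℝ) ×ˢ Metric.closedBall (0 : Space n) δ) :=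
    isCompact_singleton.prod (isCompact_closedBall 0 δ)
  refine closure_minimal (fun q hq => ?_) (hc.isCompact.add hK).isClosed
  by_contra h
  refine hq ?_
  have h1 : potential δ φ q = ∫ w, φ (q - w) ∂(potentialMeasure n δ) := rfl
  rw [h1, integral_potentialMeasure δ (G := fun w => φ (q - w))
    (hφ.comp (continuous_const.sub continuous_id))]
  refine integral_eq_zero_of_ae ?_
  rw [restrict_Icc_prod_volume]
  filter_upwards [ae_restrict_mem (measurableSet_Icc.prod MeasurableSet.univ)] with r hr
  by_cases hz : δ ≤ ‖r.2‖
  · simp [radialPotential_eq_zero hδ hz]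
  · have h2 : φ (q - (0, r.1 • r.2)) = 0 := by
      refine image_eq_zero_of_notMem_tsupport fun h' => h ?_
      refine ⟨_, h', (0, r.1 • r.2), ⟨rfl, ?_⟩, by simp⟩
      simp only [Metric.mem_closedBall, dist_zero_right, norm_smul, Real.norm_eq_abs]
      rw [abs_of_nonneg hr.1.1]
      calc r.1 * ‖r.2‖ ≤ 1 * δ := by
            gcongr
            · exact hr.1.2
            · exact (not_le.1 hz).le
        _ = δ := one_mul δ
    simp only [h2, mul_zero, Pi.zero_apply]

theorem hasCompactSupport_potential {δ : ℝ} (hδ : 0 < δ) {φ : ℝ × Space n → ℝ}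
    (hφ : Continuous φ) (hc : HasCompactSupport φ) : HasCompactSupport (potential δ φ) :=
  (hc.isCompact.add (isCompact_singleton.prod (isCompact_closedBall 0 δ))).of_isClosed_subset
    (isClosed_tsupport _) (support_potential_subset hδ hφ hc)

theorem pd_lap_potential {δ : ℝ} (hδ : 0 < δ) {φ : ℝ × Space n → ℝ} (hφ : ContDiff ℝ ∞ φ)
    (hc : HasCompactSupport φ) (v q : ℝ × Space n) :
    pd v (lap (potential δ φ)) q = (∫ z, radialKernel δ z * pd v φ (q - (0, z)))
      - (∫ z, radialKernel (n := n) δ z) * pd v φ q := by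
  rw [pd_lap v (contDiff_potential hδ hφ hc), pd_potential hδ hφ hc,
    lap_potential_eq hδ (contDiff_pd v hφ) (hasCompactSupport_pd v hc)]

end Smoothing

/-! ### Spatial averages of integrable fields. -/

section Smear

variable {n : ℕ} {G : Type*} [NormedAddCommGroup G] [NormedSpace ℝ G]

/-- The spatial average of `f` with weight `radialKernel δ`. -/
noncomputable def smear (δ : ℝ) (f : ℝ × Space n → G) (q : ℝ × Space n) : G :=
  ∫ z, radialKernel δ z • f (q + (0, z))

instance : (volume : Measure (ℝ × Space n)).IsAddHaarMeasure :=
  inferInstanceAs ((volume : Measure ℝ).prod (volume : Measure (Space n))).IsAddHaarMeasure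

theorem measurePreserving_spaceShift :
    MeasurePreserving (fun r : Space n × (ℝ × Space n) => (r.1, r.2 + (0, r.1)))
      ((volume : Measure (Space n)).prod volume) ((volume : Measure (Space n)).prod volume) := by
  refine (MeasurePreserving.id _).skew_product (g := fun z q => q + ((0 : ℝ), z)) ?_ ?_
  · exact (by fun_prop : Continuous fun r : Space n × (ℝ × Space n) => r.2 + (0, r.1)).measurable
  · exact ae_of_all _ fun z => map_add_right_eq_self _ _

theorem integrable_smear_prod {δ : ℝ} (hδ : 0 < δ) {f : ℝ × Space n → G}
    (hf : Integrable f volume) :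
    Integrable (fun r : Space n × (ℝ × Space n) => radialKernel δ r.1 • f (r.2 + (0, r.1)))
      ((volume : Measure (Space n)).prod volume) := by
  have h : Integrable (fun r : Space n × (ℝ × Space n) => radialKernel δ r.1 • f r.2)
      ((volume : Measure (Space n)).prod volume) := (integrable_radialKernel hδ).smul_prod hf
  exact measurePreserving_spaceShift.integrable_comp_of_integrable h

theorem integrable_smear {δ : ℝ} (hδ : 0 < δ) {f : ℝ × Space n → G}
    (hf : Integrable f volume) : Integrable (smear δ f) volume :=
  (integrable_smear_prod hδ hf).integral_prod_right

/-- Averaging is moved from the test functional onto the field. -/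
theorem integral_smear_dual [CompleteSpace G] {δ : ℝ} (hδ : 0 < δ) {f : ℝ × Space n → G}
    (hf : Integrable f volume) {D : ℝ × Space n → G →L[ℝ] ℝ} (hD : Continuous D)
    (hc : HasCompactSupport D) :
    ∫ q, ∫ z, radialKernel δ z * D (q - (0, z)) (f q) = ∫ q, D q (smear δ f q) := by
  obtain ⟨C, hC⟩ := hc.exists_bound_of_continuous hD
  have h1 : Integrable (fun r : Space n × (ℝ × Space n) =>
      radialKernel δ r.1 * D (r.2 - (0, r.1)) (f r.2))
      ((volume : Measure (Space n)).prod volume) := by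
    refine Integrable.mono' (((integrable_radialKernel hδ).mul_prod (hf.norm)).mul_const C)
      (((continuous_radialKernel δ).comp continuous_fst).aestronglyMeasurable.mul ?_)
      (ae_of_all _ fun r => ?_)
    · have h2 : AEStronglyMeasurable (fun r : Space n × (ℝ × Space n) => D (r.2 - (0, r.1)))
          ((volume : Measure (Space n)).prod volume) :=
        (hD.comp (by fun_prop)).aestronglyMeasurable
      have h3 : AEStronglyMeasurable (fun r : Space n × (ℝ × Space n) => f r.2)
          ((volume : Measure (Space n)).prod volume) := hf.aestronglyMeasurable.comp_snd
      exact (ContinuousLinearMap.id ℝ (G →L[ℝ] ℝ)).aestronglyMeasurable_comp₂ h2 h3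
    · rw [norm_mul, Real.norm_eq_abs, abs_of_nonneg (radialKernel_nonneg _ _), mul_assoc,
        mul_comm (‖f r.2‖)]
      refine mul_le_mul_of_nonneg_left ?_ (radialKernel_nonneg _ _)
      exact (ContinuousLinearMap.le_opNorm _ _).trans (by gcongr; exact hC _)
  have h2 := measurePreserving_spaceShift.integrable_comp_of_integrable h1
  have h3 : ∀ z : Space n, ∫ q, radialKernel δ z * D (q - (0, z)) (f q)
      = ∫ q, radialKernel δ z * D q (f (q + (0, z))) := by
    intro z
    rw [← integral_add_right_eq_self _ ((0 : ℝ), z)]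
    simp
  have h4 : Integrable (fun r : Space n × (ℝ × Space n) =>
      radialKernel δ r.1 * D r.2 (f (r.2 + (0, r.1))))
      ((volume : Measure (Space n)).prod volume) := by
    refine h2.congr (ae_of_all _ fun r => ?_)
    simp
  rw [integral_integral_swap (f := fun q z => radialKernel δ z * D (q - (0, z)) (f q)) h1.swap]
  simp only [h3]
  rw [integral_integral_swap (f := fun z q => radialKernel δ z * D q (f (q + (0, z)))) h4]
  refine integral_congr_ae ?_
  have h5 := (integrable_smear_prod hδ hf).prod_left_ae
  filter_upwards [h5] with q hq
  unfold smear
  rw [← ContinuousLinearMap.integral_comp_comm _ hq]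
  simp

theorem smear_eq (δ : ℝ) (f : ℝ × Space n → G) (t : ℝ) (x : Space n) :
    smear δ f (t, x) = ∫ y, radialKernel δ (y - x) • f (t, y) := by
  unfold smear
  rw [← integral_add_right_eq_self (fun y => radialKernel δ (y - x) • f (t, y)) x]
  simp [add_comm]

theorem radialKernel_le (δ : ℝ) (z : Space n) : ‖radialKernel δ z‖ ≤ 4 * δ ^ 2 := by
  rw [Real.norm_eq_abs, abs_of_nonneg (radialKernel_nonneg _ _)]
  unfold radialKernel
  gcongr
  exact max_le (by nlinarith [sq_nonneg ‖z‖]) (sq_nonneg δ)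

/-- After the substitution of `smear_eq` the point x enters only through the bounded continuous
kernel, and f(t,·) dominates. There is no claim of continuity in t, and none is needed, because the
normal segments lie in time slices. -/
theorem continuous_smear_slice (δ : ℝ) {f : ℝ × Space n → G} {t : ℝ}
    (hf : Integrable (fun x => f (t, x)) volume) : Continuous fun x => smear δ f (t, x) := by
  simp only [smear_eq]
  refine continuous_of_dominated (bound := fun y => 4 * δ ^ 2 * ‖f (t, y)‖) ?_ ?_ ?_ ?_
  · intro x
    exact ((continuous_radialKernel δ).comp (continuous_id.sub continuous_const)
      ).aestronglyMeasurable.smul hf.aestronglyMeasurable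
  · intro x
    refine ae_of_all _ fun y => ?_
    rw [norm_smul]
    gcongr
    exact radialKernel_le _ _
  · exact hf.norm.const_mul _
  · refine ae_of_all _ fun y => ?_
    exact ((continuous_radialKernel δ).comp (continuous_const.sub continuous_id)).smul
      continuous_const

/-- The bound does not depend on x, so for integrable f it supplies an integrable majorant of the
average along all normal segments at once. -/
theorem enorm_smear_le (δ : ℝ) (f : ℝ × Space n → G) (t : ℝ) (x : Space n) :
    ‖smear δ f (t, x)‖ₑ ≤ ENNReal.ofReal (4 * δ ^ 2) * ∫⁻ y, ‖f (t, y)‖ₑ := by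
  rw [smear_eq, ← lintegral_const_mul' _ _ ENNReal.ofReal_ne_top]
  refine (enorm_integral_le_lintegral_enorm _).trans (lintegral_mono fun y => ?_)
  rw [enorm_smul]
  gcongr
  rw [← ofReal_norm]
  exact ENNReal.ofReal_le_ofReal (radialKernel_le _ _)

end Smear

/-! ### Distributional divergence tested with C¹ functions. -/

section Mollification

variable {V : Type*} [NormedAddCommGroup V] [NormedSpace ℝ V] [FiniteDimensional ℝ V]
  [MeasurableSpace V] [BorelSpace V] {μ : Measure V} [μ.IsAddHaarMeasure]

/-- The field `M` is divergence free in `W` in the sense of distributions. -/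
def IsDivFreeOn (μ : Measure V) (M : V → V) (W : Set V) : Prop :=
  ∀ φ : V → ℝ, ContDiff ℝ ∞ φ → HasCompactSupport φ → tsupport φ ⊆ W →
    ∫ q, fderiv ℝ φ q (M q) ∂μ = 0

/-- A field that is divergence free in the sense of distributions can be tested with `C¹` functions
of compact support. -/
theorem IsDivFreeOn.integral_fderiv_eq_zero {M : V → V} {W : Set V} (hM : IsDivFreeOn μ M W)
    (hint : Integrable M μ) (hW : IsOpen W) {φ : V → ℝ} (hφ : ContDiff ℝ 1 φ)
    (hc : HasCompactSupport φ) (hs : tsupport φ ⊆ W) : ∫ q, fderiv ℝ φ q (M q) ∂μ = 0 := by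
  have : ProperSpace V := FiniteDimensional.proper_rclike ℝ V
  obtain ⟨r, hr, hrW⟩ := hc.isCompact.exists_cthickening_subset_open hW hs
  -- The outer radius r/(k+1) never exceeds r, so the mollified functions are supported in the
  -- r-thickening of the support of φ, which lies in W.
  let η : ℕ → ContDiffBump (0 : V) := fun k =>
    ⟨r / (k + 1) / 2, r / (k + 1), by positivity, half_lt_self (by positivity)⟩
  have hη : Tendsto (fun k => (η k).rOut) atTop (𝓝 0) :=
    tendsto_const_nhds.div_atTop (tendsto_atTop_add_const_right _ _ tendsto_natCast_atTop_atTop)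
  let L := ContinuousLinearMap.lsmul ℝ ℝ (E := ℝ)
  let Φ : ℕ → V → ℝ := fun k => convolution ((η k).normed μ) φ L μ
  have hcd := hφ.continuous_fderiv one_ne_zero
  obtain ⟨C, hC⟩ := (hc.fderiv ℝ).exists_bound_of_continuous hcd
  have hηint : ∀ k, LocallyIntegrable ((η k).normed μ) μ := fun k =>
    (η k).integrable_normed.locallyIntegrable
  have hΦ : ∀ k, ContDiff ℝ ∞ (Φ k) := fun k =>
    (η k).hasCompactSupport_normed.contDiff_convolution_left (n := ⊤) L (η k).contDiff_normed
      (hφ.continuous.locallyIntegrable)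
  have hsupp : ∀ k, tsupport (Φ k) ⊆ Metric.cthickening r (tsupport φ) := by
    intro k
    refine closure_minimal ?_ Metric.isClosed_cthickening
    refine (support_convolution_subset L).trans ?_
    rintro _ ⟨a, ha, b, hb, rfl⟩
    rw [(η k).support_normed_eq, mem_ball_zero_iff] at ha
    refine Metric.mem_cthickening_of_dist_le _ b _ _ (subset_closure hb) ?_
    simp only [dist_eq_norm, add_sub_cancel_right]
    refine ha.le.trans (div_le_self hr.le ?_)
    simp
  have hder : ∀ k q, fderiv ℝ (Φ k) q
      = convolution ((η k).normed μ) (fderiv ℝ φ) (ContinuousLinearMap.lsmul ℝ ℝ) μ q := by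
    intro k q
    rw [(hc.hasFDerivAt_convolution_right L (hηint k) hφ q).fderiv]
    refine integral_congr_ae (ae_of_all _ fun w => ?_)
    refine ContinuousLinearMap.ext fun v => ?_
    simp [L, ContinuousLinearMap.precompR_apply]
  have hzero : ∀ k, ∫ q, fderiv ℝ (Φ k) q (M q) ∂μ = 0 := fun k => by
    refine hM (Φ k) (hΦ k) ?_ ((hsupp k).trans hrW)
    exact (hc.isCompact.cthickening).of_isClosed_subset (isClosed_tsupport _) (hsupp k)
  -- Mollification averages the derivative of φ. The derivatives therefore keep the bound C and
  -- converge pointwise, and C‖M‖ dominates.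
  have hlim : Tendsto (fun k => ∫ q, fderiv ℝ (Φ k) q (M q) ∂μ) atTop
      (𝓝 (∫ q, fderiv ℝ φ q (M q) ∂μ)) := by
    refine tendsto_integral_of_dominated_convergence (fun q => C * ‖M q‖) ?_ (hint.norm.const_mul C)
      ?_ ?_
    · intro k
      have h1 : Continuous (fderiv ℝ (Φ k)) := (hΦ k).continuous_fderiv (by simp)
      exact (ContinuousLinearMap.id ℝ (V →L[ℝ] ℝ)).aestronglyMeasurable_comp₂
        h1.aestronglyMeasurable hint.aestronglyMeasurable
    · intro k
      refine ae_of_all _ fun q => ?_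
      refine (ContinuousLinearMap.le_opNorm _ _).trans ?_
      gcongr
      rw [hder]
      unfold convolution
      have h2 : Integrable (fun w => (η k).normed μ w * C) μ := (η k).integrable_normed.mul_const C
      calc ‖∫ w, (ContinuousLinearMap.lsmul ℝ ℝ) ((η k).normed μ w) (fderiv ℝ φ (q - w)) ∂μ‖
          ≤ ∫ w, (η k).normed μ w * C ∂μ := by
            refine norm_integral_le_of_norm_le h2 (ae_of_all _ fun w => ?_)
            rw [ContinuousLinearMap.lsmul_apply, norm_smul, Real.norm_eq_abs,
              abs_of_nonneg ((η k).nonneg_normed w)]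
            exact mul_le_mul_of_nonneg_left (hC _) ((η k).nonneg_normed w)
        _ = C := by rw [integral_mul_const, (η k).integral_normed, one_mul]
    · refine ae_of_all _ fun q => ?_
      have h3 := ContDiffBump.convolution_tendsto_right_of_continuous (μ := μ) hη hcd q
      simp only [← hder] at h3
      exact (ContinuousLinearMap.apply ℝ ℝ (M q)).continuous.continuousAt.tendsto.comp h3
  simp only [hzero] at hlim
  exact tendsto_nhds_unique hlim tendsto_const_nhds

end Mollification

/-! ### Divergence free fields in space-time near the slit. -/

section ConservationLaw

variable {n : ℕ} {T : ℝ} {u : ℝ → Space n → Space n} {u₀ : Space n → Space n}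
  {p : ℝ → Space n → ℝ}

/-- The space-time flux `(uᵢ, uᵢ u + p eᵢ)` of the `i`-th component of momentum. -/
noncomputable def momentumFlux (u : ℝ → Space n → Space n) (p : ℝ → Space n → ℝ) (i : Fin n)
    (q : ℝ × Space n) : ℝ × Space n :=
  (u q.1 q.2 i, u q.1 q.2 i • u q.1 q.2 + p q.1 q.2 • EuclideanSpace.single i 1)

theorem IsWeakSolution.aestronglyMeasurable_of_subset (hu : IsWeakSolution T u u₀)
    {K : Set (ℝ × Space n)} (hK : K ⊆ Icc 0 T ×ˢ univ) :
    AEStronglyMeasurable (fun q : ℝ × Space n => u q.1 q.2) (volume.restrict K) := by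
  have h := hu.measurable
  rw [restrict_Icc_prod_volume] at h
  exact h.mono_measure (Measure.restrict_mono hK le_rfl)

theorem IsWeakSolution.integrableOn_sq (hu : IsWeakSolution T u u₀)
    {K : Set (ℝ × Space n)} (hK : K ⊆ Icc 0 T ×ˢ univ) :
    IntegrableOn (fun q : ℝ × Space n => ‖u q.1 q.2‖ ^ 2) K volume := by
  have h := hu.integrable_sq
  rw [restrict_Icc_prod_volume] at h
  exact IntegrableOn.mono_set h hK

theorem IsWeakSolution.integrableOn_of_isCompact (hu : IsWeakSolution T u u₀)
    {K : Set (ℝ × Space n)} (hK : K ⊆ Icc 0 T ×ˢ univ) (hc : IsCompact K) :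
    IntegrableOn (fun q : ℝ × Space n => u q.1 q.2) K volume := by
  have h1 : IntegrableOn (fun q : ℝ × Space n => ‖u q.1 q.2‖ ^ 2 + 1) K volume :=
    (hu.integrableOn_sq hK).add (integrableOn_const (hs := hc.measure_lt_top.ne))
  refine Integrable.mono' h1 (hu.aestronglyMeasurable_of_subset hK) (ae_of_all _ fun q => ?_)
  nlinarith [sq_nonneg (‖u q.1 q.2‖ - 1)]

theorem IsWeakSolution.integrableOn_momentumFlux (hu : IsWeakSolution T u u₀)
    {K : Set (ℝ × Space n)} (hK : K ⊆ Icc 0 T ×ˢ univ) (hc : IsCompact K)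
    (hp : IntegrableOn (fun q : ℝ × Space n => p q.1 q.2) K volume) (i : Fin n) :
    IntegrableOn (momentumFlux u p i) K volume := by
  have hm := hu.aestronglyMeasurable_of_subset hK
  have hmi : AEStronglyMeasurable (fun q : ℝ × Space n => u q.1 q.2 i) (volume.restrict K) :=
    (EuclideanSpace.proj (𝕜 := ℝ) i).continuous.comp_aestronglyMeasurable hm
  have h1 : IntegrableOn (fun q : ℝ × Space n => u q.1 q.2 i) K volume :=
    (EuclideanSpace.proj (𝕜 := ℝ) i).integrable_comp (hu.integrableOn_of_isCompact hK hc)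
  have h2 : IntegrableOn (fun q : ℝ × Space n => u q.1 q.2 i • u q.1 q.2) K volume := by
    refine Integrable.mono' (hu.integrableOn_sq hK) (hmi.smul hm) (ae_of_all _ fun q => ?_)
    rw [norm_smul, sq]
    gcongr
    exact PiLp.norm_apply_le _ _
  have h3 : IntegrableOn (fun q : ℝ × Space n =>
      p q.1 q.2 • (EuclideanSpace.single i 1 : Space n)) K volume := hp.smul_const _
  exact h1.prodMk (h2.add h3)

theorem fderiv_momentumFlux (φ : ℝ × Space n → ℝ) (i : Fin n) (q : ℝ × Space n) :
    fderiv ℝ φ q (momentumFlux u p i q) = u q.1 q.2 i * pd (1, 0) φ q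
      + u q.1 q.2 i * pd (0, u q.1 q.2) φ q + p q.1 q.2 * pd (sdir i) φ q := by
  have h : momentumFlux u p i q = u q.1 q.2 i • ((1 : ℝ), (0 : Space n))
      + u q.1 q.2 i • ((0 : ℝ), u q.1 q.2) + p q.1 q.2 • sdir i := by
    ext <;> simp [momentumFlux, sdir]
  rw [h, map_add, map_add, map_smul, map_smul, map_smul]
  rfl

/-- The difference of the momentum flux and its spatial average is divergence free near the
surface. -/
theorem IsWeakSolution.isDivFreeOn_sub_smear (hu : IsWeakSolution T u u₀) (hT : 0 ≤ T)
    {W : Set (ℝ × Space n)} (hp : IsPressureOn T u p W) (hW : W ⊆ Ioo 0 T ×ˢ univ)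
    {K W' : Set (ℝ × Space n)} (hKc : IsCompact K) (hKW : K ⊆ W) {δ : ℝ} (hδ : 0 < δ)
    (hW' : W' + ({0} : Set ℝ) ×ˢ Metric.closedBall (0 : Space n) δ ⊆ K) (i : Fin n) :
    IsDivFreeOn volume (fun q => (∫ z, radialKernel (n := n) δ z) •
      K.indicator (momentumFlux u p i) q - smear δ (K.indicator (momentumFlux u p i)) q) W' := by
  intro φ hφ hc hs
  have hKT : K ⊆ Icc 0 T ×ˢ univ := (hKW.trans hW).trans (prod_mono Ioo_subset_Icc_self subset_rfl)
  have hpK : IntegrableOn (fun q : ℝ × Space n => p q.1 q.2) K volume :=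
    hp.locallyIntegrable.integrableOn_compact_subset hKW hKc
  have hFK := hu.integrableOn_momentumFlux hKT hKc hpK i
  have hF : Integrable (K.indicator (momentumFlux u p i)) volume :=
    hFK.integrable_indicator hKc.measurableSet
  set F := K.indicator (momentumFlux u p i) with hFdef
  set c := ∫ z, radialKernel (n := n) δ z with hcdef
  -- The potential of φ plays the role of κ; its support grows by at most δ and so stays in K.
  have hκ := contDiff_potential hδ hφ hc
  have hκc := hasCompactSupport_potential hδ hφ.continuous hc
  have hκK : tsupport (potential δ φ) ⊆ K :=
    (support_potential_subset hδ hφ.continuous hc).trans ((Set.add_subset_add_right hs).trans hW')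
  have hmom := hu.momentum_laplacian hT hp hW hκ hκc (hκK.trans hKW) i
  set Φ := lap (potential δ φ) with hΦdef
  have hΦ : ContDiff ℝ ∞ Φ := contDiff_lap hκ
  have hΦc : HasCompactSupport Φ := hasCompactSupport_lap hκc
  have hΦK : tsupport Φ ⊆ K := (tsupport_lap_subset _).trans hκK
  have hpd0 : ∀ v q, q ∉ K → pd v Φ q = 0 := fun v q hq =>
    image_eq_zero_of_notMem_tsupport fun h => hq (hΦK (tsupport_pd_subset _ _ h))
  rw [restrict_Icc_prod_volume] at hmom
  have e1 : ∫ q in Icc 0 T ×ˢ univ, u q.1 q.2 i * pd (1, 0) Φ q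
      = ∫ q in K, u q.1 q.2 i * pd (1, 0) Φ q :=
    (setIntegral_eq_of_subset_of_forall_sdiff_eq_zero
      (measurableSet_Icc.prod MeasurableSet.univ) hKT fun q hq => by
        rw [hpd0 _ _ hq.2, mul_zero])
  have e2 : ∫ q in Icc 0 T ×ˢ univ, u q.1 q.2 i * pd (0, u q.1 q.2) Φ q
      = ∫ q in K, u q.1 q.2 i * pd (0, u q.1 q.2) Φ q :=
    (setIntegral_eq_of_subset_of_forall_sdiff_eq_zero
      (measurableSet_Icc.prod MeasurableSet.univ) hKT fun q hq => by
        rw [hpd0 _ _ hq.2, mul_zero])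
  have e3 : ∫ q : ℝ × Space n, p q.1 q.2 * pd (sdir i) Φ q
      = ∫ q in K, p q.1 q.2 * pd (sdir i) Φ q :=
    (setIntegral_eq_integral_of_forall_compl_eq_zero fun q hq => by
      rw [hpd0 _ _ hq, mul_zero]).symm
  have i1 : IntegrableOn (fun q : ℝ × Space n => u q.1 q.2 i * pd (1, 0) Φ q) K volume := by
    have h := hu.integrable_mul i (contDiff_pd ((1 : ℝ), (0 : Space n)) hΦ).continuous
      (hasCompactSupport_pd _ hΦc)
    rw [restrict_Icc_prod_volume] at h
    exact IntegrableOn.mono_set h hKT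
  have i2 : IntegrableOn (fun q : ℝ × Space n => u q.1 q.2 i * pd (0, u q.1 q.2) Φ q) K volume := by
    simp only [fderiv_eq_sum_pd, Finset.mul_sum, ← mul_assoc]
    refine integrable_finsetSum _ fun k _ => ?_
    have h := hu.integrable_mul_mul i k (contDiff_pd (sdir k) hΦ).continuous
      (hasCompactSupport_pd _ hΦc)
    rw [restrict_Icc_prod_volume] at h
    exact IntegrableOn.mono_set h hKT
  have i3 : IntegrableOn (fun q : ℝ × Space n => p q.1 q.2 * pd (sdir i) Φ q) K volume := by
    have hcont := (contDiff_pd (sdir i) hΦ).continuous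
    obtain ⟨C, hC⟩ := (hasCompactSupport_pd (sdir i) hΦc).exists_bound_of_continuous hcont
    exact hpK.mul_bdd hcont.aestronglyMeasurable (ae_of_all _ hC)
  have i12 : IntegrableOn (fun q : ℝ × Space n => u q.1 q.2 i * pd (1, 0) Φ q
      + u q.1 q.2 i * pd (0, u q.1 q.2) Φ q) K volume := i1.add i2
  rw [e1, e2, e3, ← integral_add i1 i2, ← integral_add i12 i3] at hmom
  have hsum : ∫ q, fderiv ℝ Φ q (F q) = 0 := by
    rw [← hmom, ← integral_indicator hKc.measurableSet]
    refine integral_congr_ae (ae_of_all _ fun q => ?_)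
    by_cases hq : q ∈ K
    · simp only [hFdef, indicator_of_mem hq, fderiv_momentumFlux]
    · simp [hFdef, indicator_of_notMem hq]
  have hcd : Continuous (fderiv ℝ φ) := hφ.continuous_fderiv (by simp)
  have hdual := integral_smear_dual hδ hF hcd (hc.fderiv ℝ)
  obtain ⟨C, hC⟩ := (hc.fderiv ℝ).exists_bound_of_continuous hcd
  have hint : ∀ {f : ℝ × Space n → ℝ × Space n}, Integrable f volume →
      Integrable (fun q => fderiv ℝ φ q (f q)) volume := by
    intro f hf
    refine Integrable.mono' (hf.norm.const_mul C)
      ((ContinuousLinearMap.id ℝ (ℝ × Space n →L[ℝ] ℝ)).aestronglyMeasurable_comp₂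
        hcd.aestronglyMeasurable hf.aestronglyMeasurable) (ae_of_all _ fun q => ?_)
    exact (ContinuousLinearMap.le_opNorm _ _).trans (by gcongr; exact hC q)
  -- The parametrix identity for the derivative of φ in the direction F q, which is a fixed vector
  -- once q is fixed. Integrated over q, its first term is moved onto the averaged field by
  -- `integral_smear_dual`.
  have hpt : ∀ q, fderiv ℝ Φ q (F q) = (∫ z, radialKernel δ z * fderiv ℝ φ (q - (0, z)) (F q))
      - c * fderiv ℝ φ q (F q) := fun q => pd_lap_potential hδ hφ hc (F q) q
  have hpt' : ∀ q, ∫ z, radialKernel δ z * fderiv ℝ φ (q - (0, z)) (F q)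
      = fderiv ℝ Φ q (F q) + c * fderiv ℝ φ q (F q) := fun q => by rw [hpt]; ring
  have hΦint : Integrable (fun q => fderiv ℝ Φ q (F q)) volume := by
    have hcdΦ : Continuous (fderiv ℝ Φ) := hΦ.continuous_fderiv (by simp)
    obtain ⟨C, hC⟩ := (hΦc.fderiv ℝ).exists_bound_of_continuous hcdΦ
    refine Integrable.mono' (hF.norm.const_mul C)
      ((ContinuousLinearMap.id ℝ (ℝ × Space n →L[ℝ] ℝ)).aestronglyMeasurable_comp₂
        hcdΦ.aestronglyMeasurable hF.aestronglyMeasurable) (ae_of_all _ fun q => ?_)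
    exact (ContinuousLinearMap.le_opNorm _ _).trans (by gcongr; exact hC q)
  simp only [hpt'] at hdual
  rw [integral_add hΦint ((hint hF).const_mul c), hsum, zero_add] at hdual
  simp only [map_sub, map_smul, smul_eq_mul]
  rw [integral_sub ((hint hF).const_mul c) (hint (integrable_smear hδ hF)), hdual, sub_self]

/-- The velocity, as a purely spatial space-time field, is divergence free. -/
theorem IsWeakSolution.isDivFreeOn_velocity (hu : IsWeakSolution T u u₀)
    {K W' : Set (ℝ × Space n)} (hKc : IsCompact K) (hKT : K ⊆ Icc 0 T ×ˢ univ) (hW' : W' ⊆ K) :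
    IsDivFreeOn volume (K.indicator fun q => ((0 : ℝ), u q.1 q.2)) W' := by
  intro φ hφ hc hs
  have hint : Integrable (fun q : ℝ × Space n => pd (0, u q.1 q.2) φ q)
      ((volume.restrict (Icc 0 T)).prod volume) := by
    simp only [fderiv_eq_sum_pd]
    exact integrable_finsetSum _ fun k _ => hu.integrable_mul k (contDiff_pd _ hφ).continuous
      (hasCompactSupport_pd _ hc)
  have hpd0 : ∀ v q, q ∉ K → pd v φ q = 0 := fun v q hq =>
    image_eq_zero_of_notMem_tsupport fun h => hq (hW' (hs (tsupport_pd_subset _ _ h)))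
  have h1 : ∫ q, fderiv ℝ φ q (K.indicator (fun q => ((0 : ℝ), u q.1 q.2)) q)
      = ∫ q : ℝ × Space n, pd (0, u q.1 q.2) φ q ∂((volume.restrict (Icc 0 T)).prod volume) := by
    rw [restrict_Icc_prod_volume, setIntegral_eq_of_subset_of_forall_sdiff_eq_zero
      (measurableSet_Icc.prod MeasurableSet.univ) hKT fun q hq => hpd0 _ _ hq.2,
      ← integral_indicator hKc.measurableSet]
    refine integral_congr_ae (ae_of_all _ fun q => ?_)
    by_cases hq : q ∈ K
    · simp [indicator_of_mem hq, pd]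
    · simp [indicator_of_notMem hq]
  rw [h1, integral_prod _ hint]
  refine integral_eq_zero_of_ae ?_
  filter_upwards [ae_restrict_mem measurableSet_Icc] with t ht
  have h := hu.divergenceFree t ht (fun x => φ (t, x)) (contDiff_slice hφ t)
    (hasCompactSupport_slice hc t)
  simpa only [fderiv_slice hφ, Pi.zero_apply] using h

end ConservationLaw

/-! ### One-dimensional concentration on a zero of a function. -/

section Concentration

variable {θ : ℝ → ℝ}

/-- By the fundamental theorem the right half line contributes -θ(0)/a and, in
`integral_Iic_deriv_comp_mul`, the left one +θ(0)/a. A function with two one-sided limits is thus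
seen only through its jump. -/
theorem integral_Ioi_deriv_comp_mul (hθ : ContDiff ℝ 1 θ) (hc : HasCompactSupport θ) {a : ℝ}
    (ha : 0 < a) : ∫ σ in Ioi (0 : ℝ), deriv θ (a * σ) = - θ 0 / a := by
  have hd : ∀ σ, HasDerivAt (fun σ => θ (a * σ) / a) (deriv θ (a * σ)) σ := by
    intro σ
    have h1 := (hθ.differentiable one_ne_zero (a * σ)).hasDerivAt.comp σ
      ((hasDerivAt_id σ).const_mul a)
    have h2 := h1.div_const a
    simp only [mul_one] at h2
    rw [mul_div_cancel_right₀ _ ha.ne'] at h2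
    exact h2
  have hcc : HasCompactSupport fun σ => deriv θ (a * σ) :=
    hc.deriv.comp_homeomorph (Homeomorph.mulLeft₀ a ha.ne')
  have hco : Continuous fun σ => deriv θ (a * σ) :=
    (hθ.continuous_deriv le_rfl).comp (continuous_const.mul continuous_id)
  have hlim : Tendsto (fun σ => θ (a * σ) / a) atTop (𝓝 0) := by
    have h1 : HasCompactSupport fun σ => θ (a * σ) :=
      hc.comp_homeomorph (Homeomorph.mulLeft₀ a ha.ne')
    have h2 := h1.is_zero_at_infty.mono_left atTop_le_cocompact
    simpa using h2.div_const a
  rw [integral_Ioi_of_hasDerivAt_of_tendsto' (fun σ _ => hd σ)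
    (hco.integrable_of_hasCompactSupport hcc).integrableOn hlim]
  simp [neg_div]

theorem integral_Iic_deriv_comp_mul (hθ : ContDiff ℝ 1 θ) (hc : HasCompactSupport θ) {a : ℝ}
    (ha : 0 < a) : ∫ σ in Iic (0 : ℝ), deriv θ (a * σ) = θ 0 / a := by
  have hd : ∀ σ, HasDerivAt (fun σ => θ (a * σ) / a) (deriv θ (a * σ)) σ := by
    intro σ
    have h1 := (hθ.differentiable one_ne_zero (a * σ)).hasDerivAt.comp σ
      ((hasDerivAt_id σ).const_mul a)
    have h2 := h1.div_const a
    simp only [mul_one] at h2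
    rw [mul_div_cancel_right₀ _ ha.ne'] at h2
    exact h2
  have hcc : HasCompactSupport fun σ => deriv θ (a * σ) :=
    hc.deriv.comp_homeomorph (Homeomorph.mulLeft₀ a ha.ne')
  have hco : Continuous fun σ => deriv θ (a * σ) :=
    (hθ.continuous_deriv le_rfl).comp (continuous_const.mul continuous_id)
  have hlim : Tendsto (fun σ => θ (a * σ) / a) atBot (𝓝 0) := by
    have h1 : HasCompactSupport fun σ => θ (a * σ) :=
      hc.comp_homeomorph (Homeomorph.mulLeft₀ a ha.ne')
    have h2 := h1.is_zero_at_infty.mono_left atBot_le_cocompact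
    simpa using h2.div_const a
  rw [integral_Iic_of_hasDerivAt_of_tendsto' (fun σ _ => hd σ)
    (hco.integrable_of_hasCompactSupport hcc).integrableOn hlim]
  simp

theorem quasiMeasurePreserving_mul_left {c : ℝ} (hc : c ≠ 0) :
    Measure.QuasiMeasurePreserving (fun x : ℝ => c * x) volume volume := by
  refine ⟨measurable_const_mul c, ?_⟩
  rw [Real.map_volume_mul_left hc]
  exact Measure.smul_absolutelyContinuous

variable {ε c Θ G : ℝ} {f h : ℝ → ℝ}

/-- The linear lower bound on h confines the support of s ↦ θ'((k+1) h(s)) to |s| ≤ 1/(c(k+1)). -/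
theorem deriv_comp_eq_zero (hs : ∀ x, 1 ≤ |x| → deriv θ x = 0) (hc : 0 < c)
    (hlow : ∀ s ∈ Ioo (-ε) ε, c * |s| ≤ |h s|) {k : ℕ} {s : ℝ} (hsI : s ∈ Ioo (-ε) ε)
    (hk : 1 / c ≤ |(k + 1 : ℝ) * s|) : deriv θ ((k + 1) * h s) = 0 := by
  refine hs _ ?_
  have hk0 : (0 : ℝ) < k + 1 := by positivity
  rw [abs_mul, abs_of_pos hk0] at hk ⊢
  rw [div_le_iff₀ hc] at hk
  calc (1 : ℝ) ≤ (k + 1) * |s| * c := hk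
    _ = (k + 1) * (c * |s|) := by ring
    _ ≤ (k + 1) * |h s| := by gcongr; exact hlow s hsI

/-- A family concentrating at `0` with odd profile detects the jump of a function. -/
theorem tendsto_integral_concentrate (hθ : ContDiff ℝ 1 θ) (hθc : HasCompactSupport θ)
    (hs : ∀ x, 1 ≤ |x| → deriv θ x = 0) (hε : 0 < ε) (hc : 0 < c)
    (hlow : ∀ s ∈ Ioo (-ε) ε, c * |s| ≤ |h s|) (hcont : ContinuousOn h (Ioo (-ε) ε))
    (hf : AEStronglyMeasurable f (volume.restrict (Ioo (-ε) ε)))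
    (hG : ∀ s ∈ Ioo (-ε) ε, ‖f s‖ ≤ G) {a fp fm : ℝ} (ha : 0 < a) (h0 : h 0 = 0)
    (hda : HasDerivAt h a 0) (hp : Tendsto f (𝓝[>] 0) (𝓝 fp)) (hm : Tendsto f (𝓝[<] 0) (𝓝 fm)) :
    Tendsto (fun k : ℕ => ∫ s in Ioo (-ε) ε, ((k + 1 : ℝ) * deriv θ ((k + 1) * h s)) * f s) atTop
      (𝓝 (-(θ 0 / a) * (fp - fm))) := by
  have hcd : Continuous (deriv θ) := hθ.continuous_deriv le_rfl
  obtain ⟨Θ, hΘ⟩ := hθc.deriv.exists_bound_of_continuous hcd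
  let F : ℕ → ℝ → ℝ := fun k => (Ioo (-ε) ε).indicator fun s => deriv θ ((k + 1) * h s) * f s
  have hFm : ∀ k, AEStronglyMeasurable (F k) volume := by
    intro k
    rw [aestronglyMeasurable_indicator_iff measurableSet_Ioo]
    refine AEStronglyMeasurable.mul ?_ hf
    exact (hcd.comp_continuousOn (continuousOn_const.mul hcont)).aestronglyMeasurable
      measurableSet_Ioo
  -- The substitution s = σ/(k+1) absorbs the large factor and fixes the scale.
  have hres : ∀ k : ℕ, ∫ s in Ioo (-ε) ε, ((k + 1 : ℝ) * deriv θ ((k + 1) * h s)) * f s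
      = ∫ σ, F k ((k + 1 : ℝ)⁻¹ * σ) := by
    intro k
    rw [Measure.integral_comp_mul_left, inv_inv, abs_of_pos (by positivity : (0 : ℝ) < k + 1),
      ← integral_indicator measurableSet_Ioo, smul_eq_mul, ← integral_const_mul]
    refine integral_congr_ae (ae_of_all _ fun s => ?_)
    by_cases hsI : s ∈ Ioo (-ε) ε
    · simp only [F, indicator_of_mem hsI]; ring
    · simp only [F, indicator_of_notMem hsI, mul_zero]
  simp only [hres]
  have hG0 : 0 ≤ G := (norm_nonneg _).trans (hG 0 (by simp [hε]))
  have hΘ0 : 0 ≤ Θ := (norm_nonneg _).trans (hΘ 0)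
  have hlimval : ∫ σ, deriv θ (a * σ) * (if 0 < σ then fp else fm) = -(θ 0 / a) * (fp - fm) := by
    have hcc : HasCompactSupport fun σ => deriv θ (a * σ) :=
      hθc.deriv.comp_homeomorph (Homeomorph.mulLeft₀ a ha.ne')
    have hco : Continuous fun σ => deriv θ (a * σ) :=
      hcd.comp (continuous_const.mul continuous_id)
    have hi := hco.integrable_of_hasCompactSupport (μ := volume) hcc
    have hi2 : Integrable (fun σ => deriv θ (a * σ) * (if 0 < σ then fp else fm)) volume := by
      refine hi.mul_bdd (c := max |fp| |fm|) ?_ (ae_of_all _ fun σ => ?_)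
      · exact (Measurable.ite measurableSet_Ioi measurable_const
          measurable_const).aestronglyMeasurable
      · split_ifs
        · exact le_max_left _ _
        · exact le_max_right _ _
    rw [← integral_add_compl (measurableSet_Ioi (a := (0 : ℝ))) hi2, compl_Ioi,
      setIntegral_congr_fun (g := fun σ => deriv θ (a * σ) * fp) measurableSet_Ioi (fun σ hσ => by
        simp only [mem_Ioi] at hσ; simp [hσ]),
      setIntegral_congr_fun (g := fun σ => deriv θ (a * σ) * fm) measurableSet_Iic (fun σ hσ => by
        simp only [mem_Iic] at hσ; simp [not_lt.2 hσ]),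
      integral_mul_const, integral_mul_const, integral_Ioi_deriv_comp_mul hθ hθc ha,
      integral_Iic_deriv_comp_mul hθ hθc ha]
    ring
  rw [← hlimval]
  have hinv : ∀ σ : ℝ, Tendsto (fun k : ℕ => ((k : ℝ) + 1)⁻¹ * σ) atTop (𝓝 0) := by
    intro σ
    have h1 : Tendsto (fun k : ℕ => ((k : ℝ) + 1)⁻¹) atTop (𝓝 0) :=
      tendsto_inv_atTop_zero.comp
        (tendsto_atTop_add_const_right _ _ tendsto_natCast_atTop_atTop)
    simpa using h1.mul_const σ
  -- Only h(0) = 0 and differentiability at 0 enter here; the profile becomes θ'(aσ) in the limit.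
  have hscale : ∀ σ : ℝ, σ ≠ 0 →
      Tendsto (fun k : ℕ => ((k : ℝ) + 1) * h (((k : ℝ) + 1)⁻¹ * σ)) atTop (𝓝 (a * σ)) := by
    intro σ hσ
    have h1 := hasDerivAt_iff_tendsto_slope.1 hda
    have h2 : Tendsto (fun k : ℕ => ((k : ℝ) + 1)⁻¹ * σ) atTop (𝓝[≠] 0) := by
      refine tendsto_nhdsWithin_iff.2 ⟨hinv σ, Eventually.of_forall fun k => ?_⟩
      exact mul_ne_zero (by positivity) hσ
    have h3 := (h1.comp h2).mul_const σ
    refine h3.congr fun k => ?_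
    simp only [Function.comp_apply, slope_def_field, h0, sub_zero]
    have : (k : ℝ) + 1 ≠ 0 := by positivity
    field_simp
  refine tendsto_integral_of_dominated_convergence
    (fun σ => (Icc (-(1 / c)) (1 / c)).indicator (fun _ => Θ * G) σ) ?_ ?_ ?_ ?_
  · intro k
    exact (hFm k).comp_quasiMeasurePreserving (quasiMeasurePreserving_mul_left (by positivity))
  · rw [integrable_indicator_iff measurableSet_Icc]
    exact integrableOn_const (hs := by simp)
  · intro k
    refine ae_of_all _ fun σ => ?_
    by_cases hσ : σ ∈ Icc (-(1 / c)) (1 / c)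
    · rw [indicator_of_mem hσ]
      by_cases hsI : ((k : ℝ) + 1)⁻¹ * σ ∈ Ioo (-ε) ε
      · simp only [F, indicator_of_mem hsI, norm_mul]
        gcongr
        · exact hΘ _
        · exact hG _ hsI
      · simp only [F, indicator_of_notMem hsI, norm_zero]
        positivity
    · rw [indicator_of_notMem hσ]
      refine (norm_eq_zero.2 ?_).le
      by_cases hsI : ((k : ℝ) + 1)⁻¹ * σ ∈ Ioo (-ε) ε
      · simp only [F, indicator_of_mem hsI]
        rw [deriv_comp_eq_zero hs hc hlow hsI, zero_mul]
        have : (k : ℝ) + 1 ≠ 0 := by positivity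
        rw [← mul_assoc, mul_inv_cancel₀ this, one_mul]
        by_contra hlt
        exact hσ (abs_le.1 (not_le.1 hlt).le)
      · simp only [F, indicator_of_notMem hsI]
  · have hne : ∀ᵐ σ : ℝ, σ ≠ 0 := by simp [ae_iff]
    filter_upwards [hne] with σ hσ
    have hmem : ∀ᶠ k : ℕ in atTop, ((k : ℝ) + 1)⁻¹ * σ ∈ Ioo (-ε) ε :=
      (hinv σ).eventually (Ioo_mem_nhds (by linarith) hε)
    have hmain : Tendsto (fun k : ℕ => deriv θ (((k : ℝ) + 1) * h (((k : ℝ) + 1)⁻¹ * σ))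
        * f (((k : ℝ) + 1)⁻¹ * σ)) atTop (𝓝 (deriv θ (a * σ) * (if 0 < σ then fp else fm))) := by
      refine ((hcd.tendsto _).comp (hscale σ hσ)).mul ?_
      rcases lt_or_gt_of_ne hσ with hneg | hpos
      · rw [if_neg (not_lt.2 hneg.le)]
        refine hm.comp (tendsto_nhdsWithin_iff.2 ⟨hinv σ, Eventually.of_forall fun k => ?_⟩)
        exact mul_neg_of_pos_of_neg (by positivity) hneg
      · rw [if_pos hpos]
        refine hp.comp (tendsto_nhdsWithin_iff.2 ⟨hinv σ, Eventually.of_forall fun k => ?_⟩)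
        exact mul_pos (by positivity) hpos
    refine hmain.congr' ?_
    filter_upwards [hmem] with k hk
    simp only [F, indicator_of_mem hk]

/-- The weight has size at most (k+1)Θ and is supported on an interval of length 2/(c(k+1)). The
resulting bound is independent of k, as dominated convergence in the surface parameters requires. -/
theorem norm_integral_concentrate_le (hs : ∀ x, 1 ≤ |x| → deriv θ x = 0)
    (hΘ : ∀ x, ‖deriv θ x‖ ≤ Θ) (hc : 0 < c)
    (hlow : ∀ s ∈ Ioo (-ε) ε, c * |s| ≤ |h s|) (hG0 : 0 ≤ G)
    (hG : ∀ s ∈ Ioo (-ε) ε, ‖f s‖ ≤ G) (k : ℕ) :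
    ‖∫ s in Ioo (-ε) ε, ((k + 1 : ℝ) * deriv θ ((k + 1) * h s)) * f s‖ ≤ 2 * Θ / c * G := by
  have hk0 : (0 : ℝ) < k + 1 := by positivity
  have hΘ0 : 0 ≤ Θ := (norm_nonneg _).trans (hΘ 0)
  set R : ℝ := 1 / (c * (k + 1)) with hR
  have hR0 : 0 < R := by positivity
  rw [← integral_indicator measurableSet_Ioo]
  have hint : Integrable ((Icc (-R) R).indicator fun _ => (k + 1) * Θ * G) (volume : Measure ℝ) := by
    rw [integrable_indicator_iff measurableSet_Icc]
    exact integrableOn_const (hs := by simp)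
  refine (norm_integral_le_of_norm_le hint (ae_of_all _ fun s => ?_)).trans ?_
  · by_cases hsI : s ∈ Ioo (-ε) ε
    · rw [indicator_of_mem hsI]
      by_cases hsR : s ∈ Icc (-R) R
      · rw [indicator_of_mem hsR, norm_mul, norm_mul, Real.norm_of_nonneg hk0.le]
        gcongr
        · exact hΘ _
        · exact hG _ hsI
      · rw [indicator_of_notMem hsR]
        refine (norm_eq_zero.2 ?_).le
        rw [deriv_comp_eq_zero hs hc hlow hsI, mul_zero, zero_mul]
        have h1 : R < |s| := by
          by_contra hlt
          exact hsR (abs_le.1 (not_lt.1 hlt))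
        rw [abs_mul, abs_of_pos hk0]
        calc 1 / c = (k + 1) * R := by rw [hR]; field_simp
          _ ≤ (k + 1) * |s| := by gcongr
    · rw [indicator_of_notMem hsI, norm_zero]
      exact indicator_nonneg (fun _ _ => by positivity) _
  · rw [integral_indicator measurableSet_Icc, setIntegral_const]
    have : volume.real (Icc (-R) R) = 2 * R := by
      rw [Real.volume_real_Icc_of_le (by linarith)]; ring
    rw [this, hR, smul_eq_mul]
    refine le_of_eq ?_
    field_simp

end Concentration

/-! ### Iterated almost everywhere statements and joint measurability. -/

section IteratedNullSets

variable {α β : Type*} [MeasurableSpace α] [MeasurableSpace β] {μ : Measure α} {ν : Measure β}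
  [SFinite ν]

/-- Null slices imply a null set in the product only for measurable sets, so P is replaced by a
measurable set that agrees with it almost everywhere. -/
theorem ae_prod_of_ae_ae_of_nullMeasurable {P : α × β → Prop}
    (hP : NullMeasurableSet {x | P x} (μ.prod ν)) (h : ∀ᵐ a ∂μ, ∀ᵐ b ∂ν, P (a, b)) :
    ∀ᵐ x ∂μ.prod ν, P x := by
  obtain ⟨t, ht, hPt⟩ := hP.exists_measurable_superset_ae_eq.imp fun t ht => ht.2
  have h1 : ∀ᵐ x ∂μ.prod ν, x ∈ t ↔ P x := hPt.mem_iff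
  have h2 : ∀ᵐ x ∂μ.prod ν, x ∈ t := by
    refine (Measure.ae_prod_iff_ae_ae ht).2 ?_
    filter_upwards [h, Measure.ae_ae_of_ae_prod h1] with a ha hb
    filter_upwards [ha, hb] with b hb1 hb2
    exact hb2.2 hb1
  filter_upwards [h1, h2] with x hx hx2
  exact hx.1 hx2

theorem ae_eq_of_ae_ae {f g : α × β → ℝ} (hf : AEStronglyMeasurable f (μ.prod ν))
    (hg : AEStronglyMeasurable g (μ.prod ν)) (h : ∀ᵐ a ∂μ, ∀ᵐ b ∂ν, f (a, b) = g (a, b)) :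
    f =ᵐ[μ.prod ν] g :=
  ae_prod_of_ae_ae_of_nullMeasurable
    (nullMeasurableSet_eq_fun hf.aemeasurable hg.aemeasurable) h

/-- The set of convergence of a sequence of measurable functions is measurable, so convergence in
the iterated sense upgrades to joint convergence. This yields a measurable limit even though the
limit given slice by slice need not be one. -/
theorem exists_measurable_limit_of_ae_ae {f : ℕ → α × β → ℝ}
    (hf : ∀ k, AEStronglyMeasurable (f k) (μ.prod ν))
    (h : ∀ᵐ a ∂μ, ∀ᵐ b ∂ν, ∃ l, Tendsto (fun k => f k (a, b)) atTop (𝓝 l)) :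
    ∃ F : α × β → ℝ, StronglyMeasurable F ∧
      ∀ᵐ x ∂μ.prod ν, Tendsto (fun k => f k x) atTop (𝓝 (F x)) := by
  refine exists_stronglyMeasurable_limit_of_tendsto_ae hf ?_
  refine ae_prod_of_ae_ae_of_nullMeasurable ?_ h
  have h1 : MeasurableSet {x | ∃ l, Tendsto (fun k => (hf k).mk _ x) atTop (𝓝 l)} :=
    measurableSet_exists_tendsto fun k => (hf k).stronglyMeasurable_mk.measurable
  refine h1.nullMeasurableSet.congr ?_
  have h2 : ∀ᵐ x ∂μ.prod ν, ∀ k, f k x = (hf k).mk _ x := ae_all_iff.2 fun k => (hf k).ae_eq_mk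
  filter_upwards [h2] with x hx
  refine propext ?_
  change (∃ l, Tendsto (fun k => (hf k).mk _ x) atTop (𝓝 l)) ↔
    ∃ l, Tendsto (fun k => f k x) atTop (𝓝 l)
  simp only [hx]

end IteratedNullSets

/-! ### Testing with functions pulled back from the ambient space. -/

section PushForward

/-- A function on a parameter domain vanishes if it is orthogonal to all test functions pulled back
by an injective parametrization. -/
theorem ae_eq_zero_of_integral_comp_smul_eq_zero {X E : Type*} [TopologicalSpace X] [PolishSpace X]
    [MeasurableSpace X] [BorelSpace X] [NormedAddCommGroup E] [NormedSpace ℝ E]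
    [FiniteDimensional ℝ E] [MeasurableSpace E] [BorelSpace E] {μ : Measure X} {A : Set X}
    (hA : MeasurableSet A) {R : X → E} (hR : ContinuousOn R A) (hinj : InjOn R A) {Ω : Set E}
    (hΩ : IsOpen Ω) {f : X → ℝ} (hf : IntegrableOn f A μ)
    (h : ∀ ψ : E → ℝ, ContDiff ℝ ∞ ψ → HasCompactSupport ψ → tsupport ψ ⊆ Ω →
      ∫ x in A, ψ (R x) * f x ∂μ = 0) :
    ∀ᵐ x ∂μ.restrict A, R x ∈ Ω → f x = 0 := by
  -- By the Lusin-Souslin theorem an injective continuous map on a measurable subset of a Polish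
  -- space is a measurable embedding. Hence f becomes a function on the ambient space, and the
  -- fundamental lemma applies to the pushed forward measure.
  have hemb : MeasurableEmbedding (A.domRestrict R) := hR.measurableEmbedding hA hinj
  let m : Measure A := Measure.comap ((↑) : A → X) μ
  let F : E → ℝ := Function.extend (A.domRestrict R) (fun x : A => f x) 0
  have hF : ∀ x : A, F (A.domRestrict R x) = f x := fun x =>
    hemb.injective.extend_apply _ _ x
  have hfm : Integrable (fun x : A => f x) m := (integrableOn_iff_comap_subtypeVal hA).1 hf
  have hFi : Integrable F (m.map (A.domRestrict R)) := by
    rw [hemb.integrable_map_iff]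
    exact hfm.congr (ae_of_all _ fun x => (hF x).symm)
  have hae := hΩ.ae_eq_zero_of_integral_contDiff_smul_eq_zero (μ := m.map (A.domRestrict R))
    (f := F) (hFi.locallyIntegrable.locallyIntegrableOn Ω) (fun ψ hψ hc hs => by
      rw [hemb.integral_map]
      simp only [hF, smul_eq_mul]
      have h2 := h ψ hψ hc hs
      rw [← integral_subtype_comap hA] at h2
      exact h2)
  rw [hemb.ae_map_iff] at hae
  rw [ae_restrict_iff_subtype hA]
  filter_upwards [hae] with x hx hxΩ
  rw [← hF x]
  exact hx hxΩ

end PushForward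

/-! ### The jump relation for distributionally divergence free fields. -/

section Jump

variable {d : ℕ} {V : Type*} [NormedAddCommGroup V] [NormedSpace ℝ V] [MeasurableSpace V]

/-- Coordinates `((t, y), s)` near a hypersurface `{s = 0} = {H = 0}`: `N` is injective with
Jacobian `J`, and `a` is the derivative of `H` along the coordinate `s` on the surface. -/
structure IsTransversalChart (μ : Measure V) (I : Set ℝ) (B : Set (Space d)) (ε : ℝ)
    (N : (ℝ × Space d) × ℝ → V) (J : (ℝ × Space d) × ℝ → ℝ) (H : V → ℝ) (a : ℝ × Space d → ℝ)
    (Ω O : Set V) : Prop where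
  measurableSet_time : MeasurableSet I
  measurableSet_base : MeasurableSet B
  pos : 0 < ε
  continuousOn : ContinuousOn N ((I ×ˢ B) ×ˢ Ioo (-ε) ε)
  injOn : InjOn N ((I ×ˢ B) ×ˢ Ioo (-ε) ε)
  continuousOn_jacobian : ContinuousOn J ((I ×ˢ B) ×ˢ Ioo (-ε) ε)
  jacobian_pos : ∀ r ∈ (I ×ˢ B) ×ˢ Ioo (-ε) ε, 0 < J r
  jacobian_le : ∃ C, ∀ r ∈ (I ×ˢ B) ×ˢ Ioo (-ε) ε, J r ≤ C
  map_eq : (((volume.restrict (I ×ˢ B)).prod (volume.restrict (Ioo (-ε) ε))).withDensity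
    fun r => ENNReal.ofReal (J r)).map N = μ.restrict (N '' ((I ×ˢ B) ×ˢ Ioo (-ε) ε))
  isOpen_inner : IsOpen Ω
  inner_subset : Ω ⊆ N '' ((I ×ˢ B) ×ˢ Ioo (-ε) ε)
  isOpen_outer : IsOpen O
  subset_outer : N '' ((I ×ˢ B) ×ˢ Ioo (-ε) ε) ⊆ O
  contDiffOn : ContDiffOn ℝ 1 H O
  fderiv_le : ∃ C, ∀ q ∈ N '' ((I ×ˢ B) ×ˢ Ioo (-ε) ε), ‖fderiv ℝ H q‖ ≤ C
  abs_le : ∃ c, 0 < c ∧ ∀ x ∈ I ×ˢ B, ∀ s ∈ Ioo (-ε) ε, c * |s| ≤ |H (N (x, s))|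
  eq_zero : ∀ x ∈ I ×ˢ B, H (N (x, 0)) = 0
  hasDerivAt : ∀ x ∈ I ×ˢ B, HasDerivAt (fun s => H (N (x, s))) (a x) 0
  deriv_pos : ∀ x ∈ I ×ˢ B, 0 < a x

variable {μ : Measure V} {I : Set ℝ} {B : Set (Space d)} {ε : ℝ}
  {N : (ℝ × Space d) × ℝ → V} {J : (ℝ × Space d) × ℝ → ℝ} {H : V → ℝ} {a : ℝ × Space d → ℝ}
  {Ω O : Set V}

namespace IsTransversalChart

theorem measurableSet_box (hN : IsTransversalChart μ I B ε N J H a Ω O) :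
    MeasurableSet ((I ×ˢ B) ×ˢ Ioo (-ε) ε) :=
  (hN.measurableSet_time.prod hN.measurableSet_base).prod measurableSet_Ioo

/-- Outside O the function θ is uncontrolled, but there ψ vanishes in a neighbourhood, its closed
support being contained in O. -/
theorem contDiff_mul (hN : IsTransversalChart μ I B ε N J H a Ω O) {ψ θ : V → ℝ}
    (hψ : ContDiff ℝ ∞ ψ) (hψs : tsupport ψ ⊆ Ω) (hθ : ContDiffOn ℝ 1 θ O) :
    ContDiff ℝ 1 fun q => ψ q * θ q := by
  rw [contDiff_iff_contDiffAt]
  intro q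
  by_cases hq : q ∈ O
  · exact (hψ.contDiffAt.of_le (by simp)).mul (hθ.contDiffAt (hN.isOpen_outer.mem_nhds hq))
  · have hq2 : q ∉ tsupport ψ := fun h => hq (hN.subset_outer (hN.inner_subset (hψs h)))
    refine (contDiffAt_const (c := (0 : ℝ))).congr_of_eventuallyEq ?_
    filter_upwards [(isClosed_tsupport ψ).isOpen_compl.mem_nhds hq2] with z hz
    rw [image_eq_zero_of_notMem_tsupport hz, zero_mul]

theorem prod_restrict_eq (I : Set ℝ) (B : Set (Space d)) (ε : ℝ) :
    ((volume : Measure (ℝ × Space d)).restrict (I ×ˢ B)).prod (volume.restrict (Ioo (-ε) ε))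
      = (volume : Measure ((ℝ × Space d) × ℝ)).restrict ((I ×ˢ B) ×ˢ Ioo (-ε) ε) := by
  rw [Measure.prod_restrict]; rfl

theorem ae_mem_box (hN : IsTransversalChart μ I B ε N J H a Ω O) :
    ∀ᵐ r ∂((volume : Measure (ℝ × Space d)).restrict (I ×ˢ B)).prod (volume.restrict (Ioo (-ε) ε)),
      r ∈ (I ×ˢ B) ×ˢ Ioo (-ε) ε := by
  rw [prod_restrict_eq]
  exact ae_restrict_mem hN.measurableSet_box

theorem aemeasurable_jacobian (hN : IsTransversalChart μ I B ε N J H a Ω O) :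
    AEMeasurable J (((volume : Measure (ℝ × Space d)).restrict (I ×ˢ B)).prod
      (volume.restrict (Ioo (-ε) ε))) := by
  rw [prod_restrict_eq]
  exact hN.continuousOn_jacobian.aemeasurable hN.measurableSet_box

variable [BorelSpace V]

theorem measurableSet_image (hN : IsTransversalChart μ I B ε N J H a Ω O) :
    MeasurableSet (N '' ((I ×ˢ B) ×ˢ Ioo (-ε) ε)) :=
  hN.measurableSet_box.image_of_continuousOn_injOn hN.continuousOn hN.injOn

theorem aemeasurable (hN : IsTransversalChart μ I B ε N J H a Ω O) :
    AEMeasurable N (((volume : Measure (ℝ × Space d)).restrict (I ×ˢ B)).prod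
      (volume.restrict (Ioo (-ε) ε))) := by
  rw [prod_restrict_eq]
  exact hN.continuousOn.aemeasurable hN.measurableSet_box

/-- Change of variables. -/
theorem setIntegral_eq (hN : IsTransversalChart μ I B ε N J H a Ω O) {f : V → ℝ}
    (hf : IntegrableOn f (N '' ((I ×ˢ B) ×ˢ Ioo (-ε) ε)) μ) :
    Integrable (fun r => J r * f (N r)) (((volume : Measure (ℝ × Space d)).restrict (I ×ˢ B)).prod
      (volume.restrict (Ioo (-ε) ε))) ∧
    ∫ q in N '' ((I ×ˢ B) ×ˢ Ioo (-ε) ε), f q ∂μ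
      = ∫ r, J r * f (N r) ∂(((volume : Measure (ℝ × Space d)).restrict (I ×ˢ B)).prod
        (volume.restrict (Ioo (-ε) ε))) := by
  set m := ((volume : Measure (ℝ × Space d)).restrict (I ×ˢ B)).prod
      (volume.restrict (Ioo (-ε) ε)) with hm
  have hJ : AEMeasurable (fun r => ENNReal.ofReal (J r)) m :=
    ENNReal.measurable_ofReal.comp_aemeasurable hN.aemeasurable_jacobian
  have hNa : AEMeasurable N (m.withDensity fun r => ENNReal.ofReal (J r)) :=
    hN.aemeasurable.mono_ac (withDensity_absolutelyContinuous _ _)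
  have hfm : AEStronglyMeasurable f ((m.withDensity fun r => ENNReal.ofReal (J r)).map N) := by
    rw [hN.map_eq]; exact hf.aestronglyMeasurable
  have hJpos : ∀ᵐ r ∂m, 0 ≤ J r := hN.ae_mem_box.mono fun r hr => (hN.jacobian_pos r hr).le
  have htop : ∀ᵐ r ∂m, ENNReal.ofReal (J r) < ⊤ := ae_of_all _ fun _ => ENNReal.ofReal_lt_top
  have hcongr : (fun r => (ENNReal.ofReal (J r)).toReal • f (N r)) =ᵐ[m] fun r => J r * f (N r) := by
    filter_upwards [hJpos] with r hr
    rw [ENNReal.toReal_ofReal hr, smul_eq_mul]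
  constructor
  · have h1 : Integrable f ((m.withDensity fun r => ENNReal.ofReal (J r)).map N) := by
      rw [hN.map_eq]; exact hf
    rw [integrable_map_measure hfm hNa, integrable_withDensity_iff_integrable_smul₀' hJ htop] at h1
    exact h1.congr hcongr
  · rw [← hN.map_eq, integral_map hNa hfm, integral_withDensity_eq_integral_toReal_smul₀ hJ htop]
    exact integral_congr_ae hcongr

variable [FiniteDimensional ℝ V]

/-- The one-sided limits of a distributionally divergence free field satisfy the jump relation
across the surface. -/
theorem jump_eq_zero [μ.IsAddHaarMeasure] (hN : IsTransversalChart μ I B ε N J H a Ω O)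
    {M : V → V} (hM : Integrable M μ) (hdiv : IsDivFreeOn μ M Ω) {Mp Mm : ℝ → Space d → V}
    (hlim : ∀ᵐ t ∂(volume.restrict I), ∀ᵐ y ∂(volume.restrict B),
      Tendsto (fun s => M (N ((t, y), s))) (𝓝[>] 0) (𝓝 (Mp t y)) ∧
      Tendsto (fun s => M (N ((t, y), s))) (𝓝[<] 0) (𝓝 (Mm t y)))
    {g : ℝ × Space d → ℝ≥0∞} (hg : Measurable g) (hgi : ∫⁻ x in I ×ˢ B, g x < ⊤)
    (hdom : ∀ᵐ t ∂(volume.restrict I), ∀ᵐ y ∂(volume.restrict B), ∀ s ∈ Ioo (-ε) ε,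
      ‖M (N ((t, y), s))‖ₑ ≤ g (t, y)) :
    ∀ᵐ t ∂(volume.restrict I), ∀ᵐ y ∂(volume.restrict B), N ((t, y), 0) ∈ Ω →
      fderiv ℝ H (N ((t, y), 0)) (Mp t y - Mm t y) = 0 := by
  have h0 : (0 : ℝ) ∈ Ioo (-ε) ε := ⟨neg_lt_zero.2 hN.pos, hN.pos⟩
  set Q := (I ×ˢ B) ×ˢ Ioo (-ε) ε with hQ
  set m := ((volume : Measure (ℝ × Space d)).restrict (I ×ˢ B)).prod
      (volume.restrict (Ioo (-ε) ε)) with hm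
  have hIB : (volume : Measure (ℝ × Space d)).restrict (I ×ˢ B)
      = (volume.restrict I).prod (volume.restrict B) := by
    rw [Measure.prod_restrict]; rfl
  obtain ⟨CJ, hCJ⟩ := hN.jacobian_le
  obtain ⟨CH, hCH⟩ := hN.fderiv_le
  obtain ⟨c, hc, hlow⟩ := hN.abs_le
  obtain ⟨θ, hθsm, hθc, hθ0, hθz, hθ1⟩ : ∃ θ : ℝ → ℝ, ContDiff ℝ ∞ θ ∧ HasCompactSupport θ ∧
      θ 0 = 1 ∧ (∀ x, 1 ≤ |x| → θ x = 0) ∧ ∀ x, |θ x| ≤ 1 := by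
    let b : ContDiffBump (0 : ℝ) := ⟨1 / 2, 1, by norm_num, by norm_num⟩
    refine ⟨b, b.contDiff, b.hasCompactSupport, b.one_of_mem_closedBall (by simp [b]), ?_, ?_⟩
    · intro x hx
      refine b.zero_of_le_dist ?_
      simpa [b, Real.dist_eq] using hx
    · intro x
      rw [abs_of_nonneg b.nonneg]
      exact b.le_one
  have hθ : ContDiff ℝ 1 θ := hθsm.of_le (by simp)
  -- Locality gives this for |x| > 1 only; the boundary points ±1 follow from continuity of the
  -- derivative.
  have hθ'z : ∀ x, 1 ≤ |x| → deriv θ x = 0 := by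
    have hzero : ∀ x, 1 < |x| → deriv θ x = 0 := by
      intro x hx
      have h1 : θ =ᶠ[𝓝 x] fun _ => 0 := by
        filter_upwards [continuous_abs.continuousAt.eventually (lt_mem_nhds hx)] with z hz
        exact hθz z (le_of_lt hz)
      rw [h1.deriv_eq, deriv_const]
    intro x hx
    have hcl : x ∈ closure {x : ℝ | 1 < |x|} := by
      rcases le_abs.1 hx with h | h
      · have h2 : Ioi (1 : ℝ) ⊆ {x : ℝ | 1 < |x|} := fun z hz => lt_of_lt_of_le hz (le_abs_self z)
        refine closure_mono h2 ?_
        rw [closure_Ioi]; exact h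
      · have h2 : Iio (-1 : ℝ) ⊆ {x : ℝ | 1 < |x|} := fun z hz => by
          have h3 : z < -1 := hz
          exact lt_of_lt_of_le (by linarith) (neg_le_abs z)
        refine closure_mono h2 ?_
        rw [closure_Iio]; exact (by linarith : x ≤ -1)
    exact closure_minimal (fun z hz => hzero z hz)
      (isClosed_eq (hθ.continuous_deriv le_rfl) continuous_const) hcl
  obtain ⟨Θ, hΘ⟩ := hθc.deriv.exists_bound_of_continuous (hθ.continuous_deriv le_rfl)
  have hHd : ∀ q ∈ O, HasFDerivAt H (fderiv ℝ H q) q := fun q hq =>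
    ((hN.contDiffOn.contDiffAt (hN.isOpen_outer.mem_nhds hq)).differentiableAt
      one_ne_zero).hasFDerivAt
  have hHc : ContinuousOn (fderiv ℝ H) O :=
    hN.contDiffOn.continuousOn_fderiv_of_isOpen hN.isOpen_outer le_rfl
  -- the flux through the level sets of `H`
  have hDHint : IntegrableOn (fun q => fderiv ℝ H q (M q)) (N '' Q) μ := by
    refine Integrable.mono' (hM.integrableOn.norm.const_mul CH)
      ((ContinuousLinearMap.id ℝ (V →L[ℝ] ℝ)).aestronglyMeasurable_comp₂
        ((hHc.mono hN.subset_outer).aestronglyMeasurable hN.measurableSet_image)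
        hM.aestronglyMeasurable.restrict) ?_
    filter_upwards [ae_restrict_mem hN.measurableSet_image] with q hq
    exact (ContinuousLinearMap.le_opNorm _ _).trans (by gcongr; exact hCH q hq)
  let F : (ℝ × Space d) × ℝ → ℝ := fun r => J r * fderiv ℝ H (N r) (M (N r))
  have hF : Integrable F m := (hN.setIntegral_eq hDHint).1
  let w : ℕ → (ℝ × Space d) × ℝ → ℝ := fun k r => (k + 1 : ℝ) * deriv θ ((k + 1) * H (N r))
  have hHN : ContinuousOn (fun r => H (N r)) Q :=
    hN.contDiffOn.continuousOn.comp hN.continuousOn fun r hr => hN.subset_outer ⟨r, hr, rfl⟩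
  have hw : ∀ k, AEStronglyMeasurable (w k) m := by
    intro k
    rw [hm, prod_restrict_eq]
    refine ContinuousOn.aestronglyMeasurable ?_ hN.measurableSet_box
    exact continuousOn_const.mul ((hθ.continuous_deriv le_rfl).comp_continuousOn
      (continuousOn_const.mul hHN))
  have hΘ0 : 0 ≤ Θ := (norm_nonneg _).trans (hΘ 0)
  have hwb : ∀ k r, ‖w k r‖ ≤ (k + 1) * Θ := by
    intro k r
    simp only [w, norm_mul]
    rw [Real.norm_of_nonneg (by positivity : (0 : ℝ) ≤ k + 1)]
    gcongr
    exact hΘ _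
  -- pointwise facts at almost every parameter
  have hψN : ∀ ψ : V → ℝ, Continuous ψ → AEStronglyMeasurable (fun r => ψ (N r)) m :=
    fun ψ hψ => hψ.comp_aestronglyMeasurable hN.aemeasurable.aestronglyMeasurable
  have hψF : ∀ ψ : V → ℝ, Continuous ψ → (∃ C, ∀ q, ‖ψ q‖ ≤ C) →
      Integrable (fun r => ψ (N r) * F r) m := by
    rintro ψ hψ ⟨C, hC⟩
    exact hF.bdd_mul (hψN ψ hψ) (ae_of_all _ fun r => hC _)
  have hwψF : ∀ ψ : V → ℝ, Continuous ψ → (∃ C, ∀ q, ‖ψ q‖ ≤ C) → ∀ k,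
      Integrable (fun r => w k r * (ψ (N r) * F r)) m := fun ψ hψ hb k =>
    (hψF ψ hψ hb).bdd_mul (hw k) (ae_of_all _ fun r => hwb k r)
  have hgfin : ∀ᵐ t ∂(volume.restrict I), ∀ᵐ y ∂(volume.restrict B), g (t, y) < ⊤ := by
    refine Measure.ae_ae_of_ae_prod (p := fun x : ℝ × Space d => g x < ⊤) ?_
    rw [← hIB]
    exact ae_lt_top hg hgi.ne
  have hCJ0 : ∀ r ∈ Q, 0 ≤ CJ := fun r hr => (hN.jacobian_pos r hr).le.trans (hCJ r hr)
  have hFb : ∀ᵐ t ∂(volume.restrict I), ∀ᵐ y ∂(volume.restrict B), ∀ s ∈ Ioo (-ε) ε,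
      ‖F ((t, y), s)‖ ≤ CJ * CH * (g (t, y)).toReal := by
    filter_upwards [hdom, hgfin, ae_restrict_mem hN.measurableSet_time] with t ht hgt htI
    filter_upwards [ht, hgt, ae_restrict_mem hN.measurableSet_base] with y hy hgy hyB s hs
    have hr : ((t, y), s) ∈ Q := ⟨⟨htI, hyB⟩, hs⟩
    have h1 : ‖M (N ((t, y), s))‖ ≤ (g (t, y)).toReal := by
      have h2 := ENNReal.toReal_mono hgy.ne (hy s hs)
      rwa [toReal_enorm] at h2
    have hJ0 := (hN.jacobian_pos _ hr).le
    have hCH0 := (norm_nonneg _).trans (hCH _ ⟨_, hr, rfl⟩)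
    have := hCJ0 _ hr
    simp only [F, norm_mul]
    rw [mul_assoc, Real.norm_of_nonneg hJ0]
    gcongr
    · exact hCJ _ hr
    · exact (ContinuousLinearMap.le_opNorm _ _).trans (by gcongr; exact hCH _ ⟨_, hr, rfl⟩)
  have hFm : ∀ ψ : V → ℝ, Continuous ψ → (∃ C, ∀ q, ‖ψ q‖ ≤ C) →
      ∀ᵐ t ∂(volume.restrict I), ∀ᵐ y ∂(volume.restrict B),
      AEStronglyMeasurable (fun s => ψ (N ((t, y), s)) * F ((t, y), s))
        (volume.restrict (Ioo (-ε) ε)) := by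
    intro ψ hψ hb
    have h1 := (hψF ψ hψ hb).aestronglyMeasurable.prodMk_left
    rw [hIB] at h1
    exact Measure.ae_ae_of_ae_prod h1
  have hNcont : ∀ x ∈ I ×ˢ B, ContinuousAt (fun s => N (x, s)) 0 := by
    intro x hx
    have h1 : ContinuousOn (fun s => N (x, s)) (Ioo (-ε) ε) :=
      hN.continuousOn.comp (by fun_prop) fun s hs => ⟨hx, hs⟩
    exact h1.continuousAt (Ioo_mem_nhds h0.1 h0.2)
  have hFlim : ∀ (x : ℝ × Space d), x ∈ I ×ˢ B → ∀ (l : Filter ℝ), l ≤ 𝓝 0 → ∀ v : V,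
      Tendsto (fun s => M (N (x, s))) l (𝓝 v) →
      Tendsto (fun s => F (x, s)) l (𝓝 (J (x, 0) * fderiv ℝ H (N (x, 0)) v)) := by
    intro x hx l hl v hv
    have hJc : ContinuousAt (fun s => J (x, s)) 0 := by
      have h1 : ContinuousOn (fun s => J (x, s)) (Ioo (-ε) ε) :=
        hN.continuousOn_jacobian.comp (by fun_prop) fun s hs => ⟨hx, hs⟩
      exact h1.continuousAt (Ioo_mem_nhds h0.1 h0.2)
    have hDc : ContinuousAt (fun s => fderiv ℝ H (N (x, s))) 0 := by
      have h2 : ContinuousAt (fderiv ℝ H) (N (x, 0)) :=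
        hHc.continuousAt (hN.isOpen_outer.mem_nhds (hN.subset_outer ⟨(x, 0), ⟨hx, h0⟩, rfl⟩))
      exact ContinuousAt.comp (f := fun s => N (x, s)) h2 (hNcont x hx)
    have hD : Tendsto (fun s => fderiv ℝ H (N (x, s))) l (𝓝 (fderiv ℝ H (N (x, 0)))) :=
      hDc.tendsto.mono_left hl
    have hap : Continuous fun z : (V →L[ℝ] ℝ) × V => z.1 z.2 :=
      isBoundedBilinearMap_apply.continuous
    exact (hJc.tendsto.mono_left hl).mul ((hap.tendsto (_, v)).comp (hD.prodMk_nhds hv))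
  -- The pointwise limit for ψ = 1, built from the given one-sided limits and therefore not known to
  -- be jointly measurable.
  let I0 : ℝ → Space d → ℝ := fun t y => -(1 / a (t, y)) *
    (J ((t, y), 0) * fderiv ℝ H (N ((t, y), 0)) (Mp t y)
      - J ((t, y), 0) * fderiv ℝ H (N ((t, y), 0)) (Mm t y))
  let P : (V → ℝ) → ℕ → ℝ × Space d → ℝ := fun ψ k x =>
    ∫ s in Ioo (-ε) ε, w k (x, s) * (ψ (N (x, s)) * F (x, s))
  have hP1 : ∀ ψ : V → ℝ, Continuous ψ → (∃ C, ∀ q, ‖ψ q‖ ≤ C) →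
      ∀ᵐ t ∂(volume.restrict I), ∀ᵐ y ∂(volume.restrict B),
      Tendsto (fun k => P ψ k (t, y)) atTop (𝓝 (ψ (N ((t, y), 0)) * I0 t y)) := by
    rintro ψ hψ ⟨C, hC⟩
    filter_upwards [hlim, hFb, hFm ψ hψ ⟨C, hC⟩, ae_restrict_mem hN.measurableSet_time]
      with t hl hb hmeas htI
    filter_upwards [hl, hb, hmeas, ae_restrict_mem hN.measurableSet_base] with y hly hby hmy hyB
    have hx : (t, y) ∈ I ×ˢ B := ⟨htI, hyB⟩
    have hψc : Tendsto (fun s => ψ (N ((t, y), s))) (𝓝 0) (𝓝 (ψ (N ((t, y), 0)))) :=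
      (hψ.tendsto _).comp (hNcont _ hx)
    have hcl : ContinuousOn (fun s => H (N ((t, y), s))) (Ioo (-ε) ε) :=
      hHN.comp (by fun_prop) fun s hs => ⟨hx, hs⟩
    have h1 := tendsto_integral_concentrate (G := C * (CJ * CH * (g (t, y)).toReal))
      hθ hθc hθ'z hN.pos hc (hlow _ hx) hcl hmy
      (fun s hs => by
        rw [norm_mul]
        have := (norm_nonneg _).trans (hC (N ((t, y), s)))
        gcongr
        · exact hC _
        · exact hby s hs) (hN.deriv_pos _ hx) (hN.eq_zero _ hx) (hN.hasDerivAt _ hx)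
      ((hψc.mono_left nhdsWithin_le_nhds).mul (hFlim _ hx _ nhdsWithin_le_nhds _ hly.1))
      ((hψc.mono_left nhdsWithin_le_nhds).mul (hFlim _ hx _ nhdsWithin_le_nhds _ hly.2))
    refine h1.trans (le_of_eq ?_)
    congr 1
    simp only [I0, hθ0]
    ring
  have hPm : ∀ ψ : V → ℝ, Continuous ψ → (∃ C, ∀ q, ‖ψ q‖ ≤ C) → ∀ k,
      Integrable (P ψ k) (volume.restrict (I ×ˢ B)) := fun ψ hψ hb k =>
    (hwψF ψ hψ hb k).integral_prod_left
  have hPb : ∀ ψ : V → ℝ, Continuous ψ → ∀ C, (∀ q, ‖ψ q‖ ≤ C) → ∀ k,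
      ∀ᵐ x ∂((volume : Measure (ℝ × Space d)).restrict (I ×ˢ B)),
        ‖P ψ k x‖ ≤ 2 * Θ / c * (C * (CJ * CH * (g x).toReal)) := by
    intro ψ hψ C hC k
    have hmeas := (hPm ψ hψ ⟨C, hC⟩ k).aestronglyMeasurable
    rw [hIB] at hmeas ⊢
    refine ae_prod_of_ae_ae_of_nullMeasurable (nullMeasurableSet_le hmeas.norm.aemeasurable
      (((hg.ennreal_toReal.const_mul _).const_mul _).const_mul _).aemeasurable) ?_
    filter_upwards [hFb, ae_restrict_mem hN.measurableSet_time] with t hb htI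
    filter_upwards [hb, ae_restrict_mem hN.measurableSet_base] with y hby hyB
    have h3 : ∀ s ∈ Ioo (-ε) ε, ‖ψ (N ((t, y), s)) * F ((t, y), s)‖
        ≤ C * (CJ * CH * (g (t, y)).toReal) := by
      intro s hs
      rw [norm_mul]
      have := (norm_nonneg _).trans (hC (N ((t, y), s)))
      gcongr
      · exact hC _
      · exact hby s hs
    exact norm_integral_concentrate_le hθ'z hΘ hc (hlow _ ⟨htI, hyB⟩)
      ((norm_nonneg _).trans (h3 0 h0)) h3 k
  have hgint : Integrable (fun x => (g x).toReal)
      ((volume : Measure (ℝ × Space d)).restrict (I ×ˢ B)) :=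
    integrable_toReal_of_lintegral_ne_top hg.aemeasurable hgi.ne
  -- a jointly measurable version of the limit
  obtain ⟨L, hLm, hL⟩ : ∃ L : ℝ × Space d → ℝ, StronglyMeasurable L ∧
      ∀ᵐ x ∂(volume.restrict I).prod (volume.restrict B),
        Tendsto (fun k => P (fun _ => 1) k x) atTop (𝓝 (L x)) := by
    refine exists_measurable_limit_of_ae_ae (fun k => ?_) ?_
    · rw [← hIB]
      exact (hPm (fun _ => (1 : ℝ)) continuous_const ⟨1, fun _ => by simp⟩ k).aestronglyMeasurable
    · filter_upwards [hP1 (fun _ => (1 : ℝ)) continuous_const ⟨1, fun _ => by simp⟩] with t ht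
      filter_upwards [ht] with y hy using ⟨_, hy⟩
  have hLI : ∀ᵐ t ∂(volume.restrict I), ∀ᵐ y ∂(volume.restrict B), L (t, y) = I0 t y := by
    filter_upwards [Measure.ae_ae_of_ae_prod hL, hP1 (fun _ => (1 : ℝ)) continuous_const ⟨1, fun _ => by simp⟩]
      with t h1 h2
    filter_upwards [h1, h2] with y h3 h4
    rw [one_mul] at h4
    exact tendsto_nhds_unique h3 h4
  have hLint : Integrable L ((volume : Measure (ℝ × Space d)).restrict (I ×ˢ B)) := by
    refine Integrable.mono' (g := fun x => 2 * Θ / c * (1 * (CJ * CH * (g x).toReal)))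
      (((hgint.const_mul _).const_mul _).const_mul _) hLm.aestronglyMeasurable ?_
    have h1 : ∀ᵐ x ∂((volume : Measure (ℝ × Space d)).restrict (I ×ˢ B)), ∀ k,
        ‖P (fun _ => 1) k x‖ ≤ 2 * Θ / c * (1 * (CJ * CH * (g x).toReal)) :=
      ae_all_iff.2 fun k => hPb (fun _ => (1 : ℝ)) continuous_const 1 (fun _ => by simp) k
    rw [hIB] at h1 ⊢
    filter_upwards [h1, hL] with x h2 h3
    exact le_of_tendsto h3.norm (Eventually.of_forall h2)
  have hRcont : ContinuousOn (fun x : ℝ × Space d => N (x, 0)) (I ×ˢ B) :=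
    hN.continuousOn.comp (by fun_prop) fun x hx => ⟨hx, h0⟩
  have hA : MeasurableSet (I ×ˢ B) := hN.measurableSet_time.prod hN.measurableSet_base
  have hRinj : InjOn (fun x : ℝ × Space d => N (x, 0)) (I ×ˢ B) := fun x hx y hy hxy =>
    (Prod.ext_iff.1 (hN.injOn (show (x, (0 : ℝ)) ∈ (I ×ˢ B) ×ˢ Ioo (-ε) ε from ⟨hx, h0⟩)
      (show (y, (0 : ℝ)) ∈ (I ×ˢ B) ×ˢ Ioo (-ε) ε from ⟨hy, h0⟩) hxy)).1
  have hmain : ∀ ψ : V → ℝ, ContDiff ℝ ∞ ψ → HasCompactSupport ψ → tsupport ψ ⊆ Ω →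
      ∫ x in I ×ˢ B, ψ (N (x, 0)) * L x = 0 := by
    intro ψ hψ hψc hψs
    obtain ⟨C, hC⟩ := hψc.exists_bound_of_continuous hψ.continuous
    have hψQ : ∀ q, q ∉ N '' Q → ψ q = 0 := fun q hq =>
      image_eq_zero_of_notMem_tsupport fun h => hq (hN.inner_subset (hψs h))
    have hdψQ : ∀ q, q ∉ N '' Q → fderiv ℝ ψ q = 0 := fun q hq =>
      image_eq_zero_of_notMem_tsupport fun h =>
        hq (hN.inner_subset (hψs (tsupport_fderiv_subset ℝ h)))
    have hDψint : IntegrableOn (fun q => fderiv ℝ ψ q (M q)) (N '' Q) μ := by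
      have hcd := hψ.continuous_fderiv (by simp)
      obtain ⟨C', hC'⟩ := (hψc.fderiv ℝ).exists_bound_of_continuous hcd
      refine Integrable.integrableOn ?_
      refine Integrable.mono' (hM.norm.const_mul C')
        ((ContinuousLinearMap.id ℝ (V →L[ℝ] ℝ)).aestronglyMeasurable_comp₂
          hcd.aestronglyMeasurable hM.aestronglyMeasurable) (ae_of_all _ fun q => ?_)
      exact (ContinuousLinearMap.le_opNorm _ _).trans (by gcongr; exact hC' q)
    let b : (ℝ × Space d) × ℝ → ℝ := fun r => J r * fderiv ℝ ψ (N r) (M (N r))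
    have hb : Integrable b m := (hN.setIntegral_eq hDψint).1
    have hθb : ∀ k : ℕ, Integrable (fun r => θ ((k + 1) * H (N r)) * b r) m := by
      intro k
      refine hb.bdd_mul (c := 1) ?_ (ae_of_all _ fun r => hθ1 _)
      rw [hm, prod_restrict_eq]
      exact (hθ.continuous.comp_continuousOn (continuousOn_const.mul hHN)).aestronglyMeasurable
        hN.measurableSet_box
    have heq : ∀ k : ℕ, (∫ r, θ ((k + 1) * H (N r)) * b r ∂m)
        + ∫ r, w k r * (ψ (N r) * F r) ∂m = 0 := by
      intro k
      -- As H is only C¹, so is this test function, which is why `integral_fderiv_eq_zero` is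
      -- needed. Its derivative splits into a term with the derivative of ψ and a term of size k+1
      -- concentrated near the surface.
      let Φ : V → ℝ := fun q => ψ q * θ ((k + 1) * H q)
      have hΦ : ContDiff ℝ 1 Φ := hN.contDiff_mul hψ hψs
        (hθ.comp_contDiffOn (contDiffOn_const.mul hN.contDiffOn))
      have hΦs : tsupport Φ ⊆ tsupport ψ := closure_mono (Function.support_mul_subset_left _ _)
      have hΦc : HasCompactSupport Φ := hψc.of_isClosed_subset (isClosed_tsupport _) hΦs
      have hz := hdiv.integral_fderiv_eq_zero hM hN.isOpen_inner hΦ hΦc (hΦs.trans hψs)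
      have hΦd : ∀ q ∈ N '' Q, fderiv ℝ Φ q (M q) = θ ((k + 1) * H q) * fderiv ℝ ψ q (M q)
          + (k + 1) * deriv θ ((k + 1) * H q) * (ψ q * fderiv ℝ H q (M q)) := by
        intro q hq
        have h1 := (hθ.differentiable one_ne_zero ((k + 1) * H q)).hasDerivAt.comp_hasFDerivAt q
          ((hHd q (hN.subset_outer hq)).const_mul (k + 1 : ℝ))
        have h2 := (hψ.differentiable (by simp) q).hasFDerivAt.mul h1
        have h3 : fderiv ℝ Φ q = _ := h2.fderiv
        rw [h3]
        simp
        ring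
      have hz0 : ∀ q, q ∉ N '' Q → fderiv ℝ Φ q (M q) = 0 := by
        intro q hq
        have : fderiv ℝ Φ q = 0 := image_eq_zero_of_notMem_tsupport fun h =>
          hq (hN.inner_subset (hψs (hΦs (tsupport_fderiv_subset ℝ h))))
        simp [this]
      rw [← setIntegral_eq_integral_of_forall_compl_eq_zero (s := N '' Q) hz0] at hz
      have hint : IntegrableOn (fun q => fderiv ℝ Φ q (M q)) (N '' Q) μ := by
        have hcd := hΦ.continuous_fderiv one_ne_zero
        obtain ⟨C', hC'⟩ := (hΦc.fderiv ℝ).exists_bound_of_continuous hcd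
        refine Integrable.integrableOn ?_
        refine Integrable.mono' (hM.norm.const_mul C')
          ((ContinuousLinearMap.id ℝ (V →L[ℝ] ℝ)).aestronglyMeasurable_comp₂
            hcd.aestronglyMeasurable hM.aestronglyMeasurable) (ae_of_all _ fun q => ?_)
        exact (ContinuousLinearMap.le_opNorm _ _).trans (by gcongr; exact hC' q)
      rw [(hN.setIntegral_eq hint).2] at hz
      rw [← integral_add (hθb k) (hwψF ψ hψ.continuous ⟨C, hC⟩ k), ← hz]
      refine integral_congr_ae ?_
      filter_upwards [hN.ae_mem_box] with r hr
      rw [hΦd _ ⟨r, hr, rfl⟩]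
      simp only [b, w, F]
      ring
    -- Off the null set s = 0 the lower bound on |H| makes the cutoff vanish for large k.
    have hlim1 : Tendsto (fun k : ℕ => ∫ r, θ ((k + 1) * H (N r)) * b r ∂m) atTop (𝓝 0) := by
      rw [← integral_zero ((ℝ × Space d) × ℝ) ℝ (μ := m)]
      refine tendsto_integral_of_dominated_convergence (fun r => ‖b r‖)
        (fun k => (hθb k).aestronglyMeasurable) hb.norm ?_ ?_
      · intro k
        refine ae_of_all _ fun r => ?_
        rw [norm_mul]
        exact mul_le_of_le_one_left (norm_nonneg _) (hθ1 _)
      · have hne : ∀ᵐ r ∂m, r.2 ≠ 0 := by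
          have h1 : ∀ᵐ s ∂((volume : Measure ℝ).restrict (Ioo (-ε) ε)), s ≠ 0 :=
            ae_restrict_of_ae (by simp [ae_iff])
          exact Measure.quasiMeasurePreserving_snd.ae h1
        filter_upwards [hne, hN.ae_mem_box] with r hr0 hrQ
        refine tendsto_const_nhds.congr' ?_
        have h2 : 0 < |H (N r)| := lt_of_lt_of_le (mul_pos hc (abs_pos.2 hr0)) (hlow r.1 hrQ.1 r.2 hrQ.2)
        obtain ⟨k0, hk0⟩ := exists_nat_gt (1 / |H (N r)|)
        filter_upwards [eventually_ge_atTop k0] with k hk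
        rw [hθz, zero_mul]
        rw [abs_mul, abs_of_pos (by positivity : (0 : ℝ) < k + 1)]
        rw [div_lt_iff₀ h2] at hk0
        have : (k0 : ℝ) ≤ k := by exact_mod_cast hk
        nlinarith
    have hlim2 : Tendsto (fun k : ℕ => ∫ r, w k r * (ψ (N r) * F r) ∂m) atTop
        (𝓝 (∫ x in I ×ˢ B, ψ (N (x, 0)) * L x)) := by
      have h1 : ∀ k, ∫ r, w k r * (ψ (N r) * F r) ∂m = ∫ x in I ×ˢ B, P ψ k x := fun k =>
        integral_prod _ (hwψF ψ hψ.continuous ⟨C, hC⟩ k)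
      simp only [h1]
      refine tendsto_integral_of_dominated_convergence
        (fun x => 2 * Θ / c * (C * (CJ * CH * (g x).toReal)))
        (fun k => (hPm ψ hψ.continuous ⟨C, hC⟩ k).aestronglyMeasurable)
        (((hgint.const_mul _).const_mul _).const_mul _)
        (fun k => hPb ψ hψ.continuous C hC k) ?_
      have hPaesm := fun k => (hPm ψ hψ.continuous ⟨C, hC⟩ k).aestronglyMeasurable
      have hprodm : AEStronglyMeasurable (fun x => ψ (N (x, 0)) * L x)
          (volume.restrict (I ×ˢ B)) :=
        ((hψ.continuous.comp_continuousOn hRcont).aestronglyMeasurable hA).mul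
          hLm.aestronglyMeasurable
      rw [hIB] at hprodm ⊢
      simp only [hIB] at hPaesm
      -- The limit is identified with ψ L only slice by slice; since both functions are measurable,
      -- the identity holds jointly.
      obtain ⟨L', hL'm, hL'⟩ := exists_measurable_limit_of_ae_ae hPaesm (by
        filter_upwards [hP1 ψ hψ.continuous ⟨C, hC⟩] with t ht
        filter_upwards [ht] with y hy using ⟨_, hy⟩)
      have hLL' : L' =ᵐ[(volume.restrict I).prod (volume.restrict B)]
          fun x => ψ (N (x, 0)) * L x := by
        refine ae_eq_of_ae_ae hL'm.aestronglyMeasurable hprodm ?_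
        filter_upwards [Measure.ae_ae_of_ae_prod hL', hP1 ψ hψ.continuous ⟨C, hC⟩, hLI]
          with t h2 h3 h4
        filter_upwards [h2, h3, h4] with y h5 h6 h7
        rw [h7]
        exact tendsto_nhds_unique h5 h6
      filter_upwards [hL', hLL'] with x h2 h3
      rw [← h3]
      exact h2
    have hsum := hlim1.add hlim2
    simp only [heq, zero_add] at hsum
    exact tendsto_nhds_unique hsum tendsto_const_nhds
  have hzero := ae_eq_zero_of_integral_comp_smul_eq_zero hA hRcont hRinj hN.isOpen_inner hLint hmain
  rw [hIB] at hzero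
  filter_upwards [Measure.ae_ae_of_ae_prod hzero, hLI, ae_restrict_mem hN.measurableSet_time]
    with t h1 h2 htI
  filter_upwards [h1, h2, ae_restrict_mem hN.measurableSet_base] with y h3 h4 hyB hΩ
  have hx : (t, y) ∈ I ×ˢ B := ⟨htI, hyB⟩
  have h5 := h3 hΩ
  rw [h4] at h5
  simp only [I0] at h5
  have hJ := (hN.jacobian_pos ((t, y), 0) ⟨hx, h0⟩).ne'
  have ha := (hN.deriv_pos _ hx).ne'
  rw [← mul_sub] at h5
  rw [map_sub]
  have h6 : -(1 / a (t, y)) ≠ 0 := by simpa using ha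
  exact (mul_eq_zero.1 ((mul_eq_zero.1 h5).resolve_left h6)).resolve_left hJ

end IsTransversalChart

end Jump

/-! ### Linear algebra of tangent hyperplanes and their normals. -/

section TangentSpaces

variable {d : ℕ}

/-- The range of A has codimension one, so its orthogonal complement is the line spanned by n. -/
theorem eq_inner_smul_of_orthogonal {A : Space d →L[ℝ] Space (d + 1)} (hA : Function.Injective A)
    {n w : Space (d + 1)} (hn1 : ‖n‖ = 1) (hn : ∀ v, inner ℝ (A v) n = 0)
    (hw : ∀ v, inner ℝ (A v) w = 0) : w = inner ℝ n w • n := by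
  let K := LinearMap.range (A : Space d →ₗ[ℝ] Space (d + 1))
  have hK : Module.finrank ℝ K = d := by
    have := LinearMap.finrank_range_of_inj (f := (A : Space d →ₗ[ℝ] Space (d + 1))) hA
    simpa using this
  have hK' : Module.finrank ℝ Kᗮ = 1 := by
    have := Submodule.finrank_add_finrank_orthogonal K
    rw [hK] at this
    simp at this
    omega
  have hmem : ∀ z : Space (d + 1), (∀ v, inner ℝ (A v) z = 0) → z ∈ Kᗮ := by
    intro z hz
    rw [Submodule.mem_orthogonal]
    rintro _ ⟨v, rfl⟩
    exact hz v
  have hn0 : (⟨n, hmem n hn⟩ : Kᗮ) ≠ 0 := by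
    intro h
    have : n = 0 := congrArg Subtype.val h
    simp [this] at hn1
  obtain ⟨c, hc⟩ := (finrank_eq_one_iff_of_nonzero' _ hn0).1 hK' ⟨w, hmem w hw⟩
  have hc' : c • n = w := congrArg Subtype.val hc
  rw [← hc', inner_smul_right, real_inner_self_eq_norm_sq, hn1]
  simp

theorem exists_coordEquiv {A : Space d →L[ℝ] Space (d + 1)} (hA : Function.Injective A)
    {n : Space (d + 1)} (hn1 : ‖n‖ = 1) (hn : ∀ v, inner ℝ (A v) n = 0) :
    ∃ L : (Space d × ℝ) ≃L[ℝ] Space (d + 1),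
      (L : Space d × ℝ →L[ℝ] Space (d + 1)) = A.coprod (ContinuousLinearMap.toSpanSingleton ℝ n) := by
  let f : Space d × ℝ →L[ℝ] Space (d + 1) := A.coprod (ContinuousLinearMap.toSpanSingleton ℝ n)
  have hf : Function.Injective (f : Space d × ℝ →ₗ[ℝ] Space (d + 1)) := by
    rw [injective_iff_map_eq_zero]
    rintro ⟨v, s⟩ h
    have h1 : A v + s • n = 0 := by simpa [f] using h
    have h2 : s = 0 := by
      have := congrArg (fun z => inner ℝ z n) h1
      simpa [inner_add_left, hn v, inner_smul_left, real_inner_self_eq_norm_sq, hn1] using this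
    have h3 : v = 0 := hA (by simpa [h2] using h1)
    simp [h2, h3]
  refine ⟨(LinearMap.linearEquivOfInjective (f : Space d × ℝ →ₗ[ℝ] Space (d + 1)) hf
    (by simp)).toContinuousLinearEquiv, ?_⟩
  ext z <;> rfl

/-- This is the linearization of ((t, y), s) ↦ (t, r t y + s n), with w in the place of ∂_t r. The
map is triangular in time, so its kernel reduces to that of the fixed time map. -/
theorem exists_spacetimeCoordEquiv {A : Space d →L[ℝ] Space (d + 1)} (hA : Function.Injective A)
    {n : Space (d + 1)} (hn1 : ‖n‖ = 1) (hn : ∀ v, inner ℝ (A v) n = 0) (w : Space (d + 1)) :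
    ∃ L : ((ℝ × Space d) × ℝ) ≃L[ℝ] ℝ × Space (d + 1),
      ∀ z, L z = (z.1.1, z.1.1 • w + A z.1.2 + z.2 • n) := by
  let f : (ℝ × Space d) × ℝ →ₗ[ℝ] ℝ × Space (d + 1) :=
    { toFun := fun z => (z.1.1, z.1.1 • w + A z.1.2 + z.2 • n)
      map_add' := fun x y => by
        ext1
        · simp
        · simp only [Prod.fst_add, Prod.snd_add, map_add]; module
      map_smul' := fun c x => by
        ext1
        · simp
        · simp only [Prod.smul_fst, Prod.smul_snd, map_smul, RingHom.id_apply, smul_eq_mul]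
          module }
  have hf : Function.Injective f := by
    rw [injective_iff_map_eq_zero]
    rintro ⟨⟨τ, v⟩, s⟩ h
    obtain ⟨h0, h1⟩ := Prod.ext_iff.1 h
    have h0 : τ = 0 := h0
    have h1 : τ • w + A v + s • n = 0 := h1
    rw [h0, zero_smul, zero_add] at h1
    have h2 : s = 0 := by
      have := congrArg (fun z => inner ℝ z n) h1
      simpa [inner_add_left, hn v, inner_smul_left, real_inner_self_eq_norm_sq, hn1] using this
    have h3 : v = 0 := hA (by simpa [h2] using h1)
    simp [h0, h2, h3]
  exact ⟨(LinearMap.linearEquivOfInjective f hf (by simp; ring)).toContinuousLinearEquiv,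
    fun z => rfl⟩

/-- The adjoint, as a linear map over the reals. -/
noncomputable def adjointL (d : ℕ) :
    (Space d →L[ℝ] Space (d + 1)) →L[ℝ] (Space (d + 1) →L[ℝ] Space d) :=
  LinearMap.toContinuousLinearMap
    { toFun := fun A => ContinuousLinearMap.adjoint A
      map_add' := fun A B => by simp
      map_smul' := fun c A => by simp }

theorem adjointL_apply (A : Space d →L[ℝ] Space (d + 1)) :
    adjointL d A = ContinuousLinearMap.adjoint A := rfl

/-- The component of `e` orthogonal to the range of an injective map `A`. -/
noncomputable def normalPart (e : Space (d + 1)) (A : Space d →L[ℝ] Space (d + 1)) :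
    Space (d + 1) :=
  e - A ((adjointL d A ∘L A).inverse (adjointL d A e))

/-- If A*A v = 0 then |Av|² = 0, so the Gram operator is injective and hence invertible. Then
A(A*A)⁻¹A* is the orthogonal projection onto the range, a formula that is visibly smooth in A. -/
theorem exists_gramEquiv {A : Space d →L[ℝ] Space (d + 1)} (hA : Function.Injective A) :
    ∃ L : Space d ≃L[ℝ] Space d, (L : Space d →L[ℝ] Space d) = adjointL d A ∘L A := by
  have hf : Function.Injective ((adjointL d A ∘L A : Space d →L[ℝ] Space d) :
      Space d →ₗ[ℝ] Space d) := by
    rw [injective_iff_map_eq_zero]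
    intro v h
    have h1 : ContinuousLinearMap.adjoint A (A v) = 0 := h
    have h2 : inner ℝ (A v) (A v) = 0 := by
      rw [← ContinuousLinearMap.adjoint_inner_left, h1, inner_zero_left]
    exact hA (by simpa using inner_self_eq_zero.1 h2)
  exact ⟨(LinearMap.linearEquivOfInjective _ hf rfl).toContinuousLinearEquiv, by ext; rfl⟩

theorem inner_normalPart {A : Space d →L[ℝ] Space (d + 1)} (hA : Function.Injective A)
    (e : Space (d + 1)) (v : Space d) : inner ℝ (A v) (normalPart e A) = 0 := by
  obtain ⟨L, hL⟩ := exists_gramEquiv hA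
  have h1 : adjointL d A (A ((adjointL d A ∘L A).inverse (adjointL d A e))) = adjointL d A e := by
    change (adjointL d A ∘L A) _ = _
    rw [← hL, ContinuousLinearMap.inverse_equiv]
    exact L.apply_symm_apply _
  rw [← ContinuousLinearMap.adjoint_inner_right, normalPart, map_sub, ← adjointL_apply, h1,
    sub_self, inner_zero_right]

theorem contDiffAt_normalPart {A : Space d →L[ℝ] Space (d + 1)} (hA : Function.Injective A)
    (e : Space (d + 1)) : ContDiffAt ℝ 2 (normalPart e) A := by
  obtain ⟨L, hL⟩ := exists_gramEquiv hA
  have h1 : ContDiffAt ℝ 2 (fun B : Space d →L[ℝ] Space (d + 1) => adjointL d B ∘L B) A :=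
    (adjointL d).contDiff.contDiffAt.clm_comp contDiffAt_id
  have h2 : ContDiffAt ℝ 2 (fun B : Space d →L[ℝ] Space (d + 1) => (adjointL d B ∘L B).inverse) A := by
    have := contDiffAt_map_inverse (𝕜 := ℝ) (n := 2) L
    rw [hL] at this
    exact ContDiffAt.comp (f := fun B : Space d →L[ℝ] Space (d + 1) => adjointL d B ∘L B) A this h1
  exact contDiffAt_const.sub (contDiffAt_id.clm_apply
    (h2.clm_apply ((adjointL d).contDiff.contDiffAt.clm_apply contDiffAt_const)))

/-- The condition `he` fixes the orientation. The formula writes the unit normal as a C¹ function of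
the tangent map, so that ν inherits a derivative in y from the second derivative of r. -/
theorem eq_smul_normalPart {A : Space d →L[ℝ] Space (d + 1)} (hA : Function.Injective A)
    {n e : Space (d + 1)} (hn1 : ‖n‖ = 1) (hn : ∀ v, inner ℝ (A v) n = 0)
    (he : 0 < inner ℝ n e) : n = ‖normalPart e A‖⁻¹ • normalPart e A := by
  have h1 := eq_inner_smul_of_orthogonal hA hn1 hn (inner_normalPart hA e)
  have h2 : inner ℝ n (normalPart e A) = inner ℝ n e := by
    rw [normalPart, inner_sub_right, real_inner_comm, real_inner_comm (A _) n, hn, sub_zero]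
  rw [h2] at h1
  have h3 : ‖normalPart e A‖ = inner ℝ n e := by
    rw [h1, norm_smul, hn1, mul_one, Real.norm_of_nonneg he.le]
  rw [h3, h1, smul_smul, inv_mul_cancel₀ he.ne', one_smul]

theorem contDiffAt_normalized_normalPart {A : Space d →L[ℝ] Space (d + 1)}
    (hA : Function.Injective A) {e : Space (d + 1)} (h0 : normalPart e A ≠ 0) :
    ContDiffAt ℝ 1 (fun B => ‖normalPart e B‖⁻¹ • normalPart e B) A := by
  have h := (contDiffAt_normalPart hA e).of_le (m := 1) (by norm_num)
  exact ((h.norm ℝ h0).inv (by simpa using h0)).smul h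

end TangentSpaces

/-! ### Regularity of the parametrizations and tangential derivatives. -/

section Parametrizations

variable {d : ℕ} {S : ℝ → Set (Space (d + 1))} {ν : ℝ → Space (d + 1) → Space (d + 1)}
  {U : Set (Space (d + 1))} {I I₁ : Set ℝ} {r : ℝ → Space d → Space (d + 1)}

namespace IsParametrization

theorem hasFDerivAt_space (hr : IsParametrization S ν U I r) {t : ℝ} (ht : t ∈ I) {y : Space d}
    (hy : y ∈ Metric.ball (0 : Space d) 1) : HasFDerivAt (r t) (fderiv ℝ (r t) y) y :=
  (((hr.contDiffOn t ht).differentiableOn (by norm_num)).differentiableAt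
    (Metric.isOpen_ball.mem_nhds hy)).hasFDerivAt

theorem hasFDerivAt_fderiv (hr : IsParametrization S ν U I r) {t : ℝ} (ht : t ∈ I) {y : Space d}
    (hy : y ∈ Metric.ball (0 : Space d) 1) :
    HasFDerivAt (fderiv ℝ (r t)) (fderiv ℝ (fderiv ℝ (r t)) y) y :=
  ((((hr.contDiffOn t ht).fderiv_of_isOpen (m := 1) Metric.isOpen_ball (by norm_num)).differentiableOn
    (by norm_num)).differentiableAt (Metric.isOpen_ball.mem_nhds hy)).hasFDerivAt

theorem hasDerivAt_time (hr : IsParametrization S ν U I r) (hI₁ : IsOpen I₁) (h₁ : I₁ ⊆ I)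
    {t : ℝ} (ht : t ∈ I₁) {y : Space d} (hy : y ∈ Metric.ball (0 : Space d) 1) :
    HasDerivAt (fun τ => r τ y) (derivWithin (fun τ => r τ y) I t) t :=
  (hr.differentiable_time y hy t (h₁ ht)).hasDerivWithinAt.hasDerivAt
    (mem_of_superset (hI₁.mem_nhds ht) h₁)

/-- Continuous partial derivatives in t and y give joint differentiability. The open subset I₁ is
needed because I is only relatively open in [0,T], and at an endpoint the time derivative is
one-sided. -/
theorem hasFDerivAt_uncurry (hr : IsParametrization S ν U I r) (hI₁ : IsOpen I₁) (h₁ : I₁ ⊆ I)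
    {q : ℝ × Space d} (hq : q ∈ I₁ ×ˢ Metric.ball (0 : Space d) 1) :
    HasFDerivAt (fun q : ℝ × Space d => r q.1 q.2)
      ((ContinuousLinearMap.toSpanSingleton ℝ (derivWithin (fun τ => r τ q.2) I q.1)).coprod
        (fderiv ℝ (r q.1) q.2)) q := by
  have hopen : IsOpen (I₁ ×ˢ Metric.ball (0 : Space d) 1) := hI₁.prod Metric.isOpen_ball
  have hnhds := hopen.mem_nhds hq
  refine (hasStrictFDerivAt_uncurry_coprod (f := r)
    (f₁ := fun t y => ContinuousLinearMap.toSpanSingleton ℝ (derivWithin (fun τ => r τ y) I t))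
    (f₂ := fun t y => fderiv ℝ (r t) y) ?_ ?_ ?_ ?_).hasFDerivAt
  · filter_upwards [hnhds] with v hv
    exact (hr.hasDerivAt_time hI₁ h₁ hv.1 hv.2).hasFDerivAt
  · filter_upwards [hnhds] with v hv
    exact hr.hasFDerivAt_space (h₁ hv.1) hv.2
  · have h2 := (hr.continuous_time.mono (prod_mono h₁ subset_rfl)).continuousAt hnhds
    exact ((ContinuousLinearMap.toSpanSingletonCLE (𝕜 := ℝ)
      (E := Space (d + 1))).continuous.tendsto _).comp h2
  · exact (hr.continuous_fderiv.mono (prod_mono h₁ subset_rfl)).continuousAt hnhds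

theorem continuousOn_fderiv_uncurry (hr : IsParametrization S ν U I r) (h₁ : I₁ ⊆ I) :
    ContinuousOn (fun q : ℝ × Space d => (ContinuousLinearMap.toSpanSingleton ℝ
      (derivWithin (fun τ => r τ q.2) I q.1)).coprod (fderiv ℝ (r q.1) q.2))
      (I₁ ×ˢ Metric.ball (0 : Space d) 1) := by
  have h2 := hr.continuous_time.mono (prod_mono h₁ (subset_refl (Metric.ball (0 : Space d) 1)))
  have h3 := hr.continuous_fderiv.mono (prod_mono h₁ (subset_refl (Metric.ball (0 : Space d) 1)))
  have h4 : ContinuousOn (fun q : ℝ × Space d => ContinuousLinearMap.toSpanSingleton ℝ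
      (derivWithin (fun τ => r τ q.2) I q.1)) (I₁ ×ˢ Metric.ball (0 : Space d) 1) :=
    (ContinuousLinearMap.toSpanSingletonCLE (𝕜 := ℝ)
      (E := Space (d + 1))).continuous.comp_continuousOn h2
  have h5 := (h4.clm_comp (continuousOn_const (c := ContinuousLinearMap.fst ℝ ℝ (Space d)))).add
    (h3.clm_comp (continuousOn_const (c := ContinuousLinearMap.snd ℝ ℝ (Space d))))
  refine h5.congr fun q _ => ContinuousLinearMap.ext fun z => ?_
  simp

theorem contDiffOn_uncurry (hr : IsParametrization S ν U I r) (hI₁ : IsOpen I₁) (h₁ : I₁ ⊆ I) :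
    ContDiffOn ℝ 1 (fun q : ℝ × Space d => r q.1 q.2) (I₁ ×ˢ Metric.ball (0 : Space d) 1) := by
  have hopen : IsOpen (I₁ ×ˢ Metric.ball (0 : Space d) 1) := hI₁.prod Metric.isOpen_ball
  have h := (contDiffOn_succ_iff_hasFDerivWithinAt_of_uniqueDiffOn (𝕜 := ℝ) (n := 0)
    (f := fun q : ℝ × Space d => r q.1 q.2) hopen.uniqueDiffOn).2
    ⟨by simp, _, contDiffOn_zero.2 (hr.continuousOn_fderiv_uncurry h₁),
      fun q hq => (hr.hasFDerivAt_uncurry hI₁ h₁ hq).hasFDerivWithinAt⟩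
  rwa [zero_add] at h

theorem mem_surface (hr : IsParametrization S ν U I r) {t : ℝ} (ht : t ∈ I) {y : Space d}
    (hy : y ∈ Metric.ball (0 : Space d) 1) : r t y ∈ S t ∧ r t y ∈ U := by
  have : r t y ∈ r t '' Metric.ball 0 1 := ⟨y, hy, rfl⟩
  rwa [hr.image t ht] at this

/-- The inverse of the parametrization is continuous. -/
theorem exists_nhds_of_mem_nhds (hr : IsParametrization S ν U I r) {t₀ : ℝ} (ht₀ : t₀ ∈ I)
    {y₀ : Space d} (hy₀ : y₀ ∈ Metric.ball (0 : Space d) 1) {N : Set (ℝ × Space d)}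
    (hN : N ∈ 𝓝 (t₀, y₀)) : ∃ O ∈ 𝓝 (t₀, r t₀ y₀), ∀ t ∈ I, ∀ y ∈ Metric.ball (0 : Space d) 1,
      (t, r t y) ∈ O → (t, y) ∈ N := by
  have h := hr.embedding.isInducing.nhds_eq_comap ⟨(t₀, y₀), ⟨ht₀, hy₀⟩⟩
  have h1 : Subtype.val ⁻¹' N ∈ 𝓝 (⟨(t₀, y₀), ⟨ht₀, hy₀⟩⟩ : ↥(I ×ˢ Metric.ball (0 : Space d) 1)) :=
    continuous_subtype_val.continuousAt hN
  rw [h, mem_comap] at h1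
  obtain ⟨O, hO, hOs⟩ := h1
  exact ⟨O, hO, fun t ht y hy hm => hOs (show (⟨(t, y), ⟨ht, hy⟩⟩ :
    ↥(I ×ˢ Metric.ball (0 : Space d) 1)) ∈ _ from hm)⟩

/-- A function vanishing on the space-time surface has derivative zero in tangential directions. -/
theorem fderiv_tangent_eq_zero (hr : IsParametrization S ν U I r) (hI₁ : IsOpen I₁) (h₁ : I₁ ⊆ I)
    {q : ℝ × Space d} (hq : q ∈ I₁ ×ˢ Metric.ball (0 : Space d) 1)
    {H : ℝ × Space (d + 1) → ℝ} (hH : DifferentiableAt ℝ H (q.1, r q.1 q.2))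
    (hz : ∀ᶠ z in 𝓝 (q.1, r q.1 q.2), z.1 ∈ I₁ → z.2 ∈ S z.1 → H z = 0) (τ : ℝ) (v : Space d) :
    fderiv ℝ H (q.1, r q.1 q.2)
      (τ, τ • derivWithin (fun τ => r τ q.2) I q.1 + fderiv ℝ (r q.1) q.2 v) = 0 := by
  have h1 := hr.hasFDerivAt_uncurry hI₁ h₁ hq
  have h2 := hasFDerivAt_fst (𝕜 := ℝ) (E := ℝ) (F := Space d) (p := q)
  have h3 := HasFDerivAt.comp q hH.hasFDerivAt (h2.prodMk h1)
  have h4 : (fun z : ℝ × Space d => H (z.1, r z.1 z.2)) =ᶠ[𝓝 q] fun _ => 0 := by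
    have hc : ContinuousAt (fun z : ℝ × Space d => (z.1, r z.1 z.2)) q :=
      (h2.prodMk h1).continuousAt
    filter_upwards [hc.eventually hz, (hI₁.prod Metric.isOpen_ball).mem_nhds hq] with z hz hzI
    exact hz hzI.1 (hr.mem_surface (h₁ hzI.1) hzI.2).1
  have h5 := h3.unique ((hasFDerivAt_const (0 : ℝ) q).congr_of_eventuallyEq h4)
  have h6 := congrArg (fun L : (ℝ × Space d) →L[ℝ] ℝ => L (τ, v)) h5
  simpa using h6

/-- The derivative of a local defining function on the surface, in terms of `∂_t H / |∇_x H|`. -/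
theorem fderiv_eq_of_gradient (hr : IsParametrization S ν U I r) (hI₁ : IsOpen I₁) (h₁ : I₁ ⊆ I)
    {q : ℝ × Space d} (hq : q ∈ I₁ ×ˢ Metric.ball (0 : Space d) 1)
    {H : ℝ × Space (d + 1) → ℝ} (hH : DifferentiableAt ℝ H (q.1, r q.1 q.2))
    (hz : ∀ᶠ z in 𝓝 (q.1, r q.1 q.2), z.1 ∈ I₁ → z.2 ∈ S z.1 → H z = 0)
    (hν : ‖ν q.1 (r q.1 q.2)‖ = 1) (τ : ℝ) (w : Space (d + 1)) :
    fderiv ℝ H (q.1, r q.1 q.2) (τ, w)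
      = fderiv ℝ H (q.1, r q.1 q.2) (0, ν q.1 (r q.1 q.2)) * (
        -inner ℝ (ν q.1 (r q.1 q.2)) (derivWithin (fun τ => r τ q.2) I q.1) * τ
        + inner ℝ (ν q.1 (r q.1 q.2)) w) := by
  set x := r q.1 q.2 with hx
  set n := ν q.1 x with hn
  set D := fderiv ℝ H (q.1, x) with hD
  set b := derivWithin (fun τ => r τ q.2) I q.1 with hb
  have htan := hr.fderiv_tangent_eq_zero hI₁ h₁ hq hH hz
  let ℓ : Space (d + 1) →L[ℝ] ℝ := D ∘L ContinuousLinearMap.inr ℝ ℝ (Space (d + 1))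
  have hℓ : ∀ w, ℓ w = D (0, w) := fun w => rfl
  let g : Space (d + 1) := (InnerProductSpace.toDual ℝ (Space (d + 1))).symm ℓ
  have hg : ∀ w, inner ℝ g w = D (0, w) := fun w =>
    InnerProductSpace.toDual_symm_apply
  -- Purely spatial tangent vectors force the spatial gradient of H to be a multiple of the normal.
  have hg1 := eq_inner_smul_of_orthogonal (hr.immersion q.1 (h₁ hq.1) q.2 hq.2) hν
    (hr.normal q.1 (h₁ hq.1) q.2 hq.2) (w := g) (fun v => by
      rw [real_inner_comm, hg]
      simpa using htan 0 v)
  have hspace : ∀ w, D (0, w) = D (0, n) * inner ℝ n w := by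
    intro w
    rw [← hg w, hg1, inner_smul_left, ← hg n, real_inner_comm n g]
    simp
  -- The curve t ↦ r(y,t) stays on the surface, so the time derivative of H is minus its derivative
  -- along ∂_t r; this is where the normal velocity enters.
  have htime : D (1, b) = 0 := by simpa using htan 1 0
  have h1 : (τ, w) = τ • ((1 : ℝ), b) + (0, w - τ • b) := by ext <;> simp
  rw [h1, map_add, map_smul, htime, hspace, inner_sub_right, inner_smul_right,
    smul_zero, zero_add]
  ring

end IsParametrization

end Parametrizations

/-! ### Defining functions, the density of μ_t and the unit normal field. -/

section DefiningFunctions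

variable {d : ℕ} {T : ℝ} {S : ℝ → Set (Space (d + 1))} {ν : ℝ → Space (d + 1) → Space (d + 1)}
  {U : Set (Space (d + 1))} {I I₁ : Set ℝ} {r : ℝ → Space d → Space (d + 1)}

namespace IsParametrization

/-- A local defining function of the space-time surface, from the inverse function theorem. -/
theorem exists_definingFunction (hr : IsParametrization S ν U I r) (hU : IsOpen U)
    (hI₁ : IsOpen I₁) (h₁ : I₁ ⊆ I) {t₀ : ℝ} (ht₀ : t₀ ∈ I₁) {y₀ : Space d}
    (hy₀ : y₀ ∈ Metric.ball (0 : Space d) 1) {e : Space (d + 1)} (he1 : ‖e‖ = 1)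
    (he : ∀ v, inner ℝ (fderiv ℝ (r t₀) y₀ v) e = 0) :
    ∃ (O : Set (ℝ × Space (d + 1))) (H : ℝ × Space (d + 1) → ℝ), IsOpen O ∧
      (t₀, r t₀ y₀) ∈ O ∧ ContDiffOn ℝ 1 H O ∧ fderiv ℝ H (t₀, r t₀ y₀) (0, e) = 1 ∧
      ∀ q ∈ O, q.1 ∈ I₁ ∧ q.2 ∈ U ∧ (H q = 0 ↔ q.2 ∈ S q.1) := by
  -- The transversal direction is frozen at e. With the true normal this map might fail to be C¹,
  -- because ν is only continuous in time.
  let G : (ℝ × Space d) × ℝ → ℝ × Space (d + 1) := fun z => (z.1.1, r z.1.1 z.1.2 + z.2 • e)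
  have hq₀ : ((t₀, y₀) : ℝ × Space d) ∈ I₁ ×ˢ Metric.ball (0 : Space d) 1 := ⟨ht₀, hy₀⟩
  have hopen : IsOpen (I₁ ×ˢ Metric.ball (0 : Space d) 1) := hI₁.prod Metric.isOpen_ball
  set p₀ : (ℝ × Space d) × ℝ := ((t₀, y₀), 0) with hp₀
  have hGp₀ : G p₀ = (t₀, r t₀ y₀) := by simp [G, hp₀]
  have hGc : ContDiffAt ℝ 1 G p₀ := by
    have h1 : ContDiffAt ℝ 1 (fun q : ℝ × Space d => r q.1 q.2) p₀.1 :=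
      (hr.contDiffOn_uncurry hI₁ h₁).contDiffAt (hopen.mem_nhds hq₀)
    have h2 : ContDiffAt ℝ 1 (fun z : (ℝ × Space d) × ℝ => r z.1.1 z.1.2) p₀ :=
      ContDiffAt.comp (f := Prod.fst) p₀ h1 contDiffAt_fst
    exact (contDiffAt_fst.fst).prodMk (h2.add (contDiffAt_snd.smul contDiffAt_const))
  obtain ⟨L, hL⟩ := exists_spacetimeCoordEquiv (hr.immersion t₀ (h₁ ht₀) y₀ hy₀) he1 he
    (derivWithin (fun τ => r τ y₀) I t₀)
  have hGd : HasFDerivAt G (L : (ℝ × Space d) × ℝ →L[ℝ] ℝ × Space (d + 1)) p₀ := by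
    have h1 : HasFDerivAt (fun q : ℝ × Space d => r q.1 q.2) _ p₀.1 :=
      hr.hasFDerivAt_uncurry hI₁ h₁ hq₀
    have h2 := HasFDerivAt.comp p₀ h1 (hasFDerivAt_fst (𝕜 := ℝ) (p := p₀))
    have h3 := (hasFDerivAt_snd (𝕜 := ℝ) (p := p₀)).smul_const e
    have h4 := (hasFDerivAt_fst (𝕜 := ℝ) (p := p₀)).fst.prodMk (h2.add h3)
    refine h4.congr_fderiv (ContinuousLinearMap.ext fun z => ?_)
    rw [ContinuousLinearEquiv.coe_coe, hL]
    simp [p₀]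
  let Φ := hGc.toOpenPartialHomeomorph G hGd one_ne_zero
  have hΦ : ∀ z, Φ z = G z := fun z => rfl
  have hsrc : p₀ ∈ Φ.source := hGc.mem_toOpenPartialHomeomorph_source hGd one_ne_zero
  have htgt : (t₀, r t₀ y₀) ∈ Φ.target := by
    rw [← hGp₀]; exact hGc.image_mem_toOpenPartialHomeomorph_target hGd one_ne_zero
  have hΓ : ContDiffAt ℝ 1 Φ.symm (t₀, r t₀ y₀) := by
    rw [← hGp₀]; exact hGc.to_localInverse hGd one_ne_zero
  have hΓ0 : Φ.symm (t₀, r t₀ y₀) = p₀ := by rw [← hGp₀, ← hΦ, Φ.left_inv hsrc]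
  let H : ℝ × Space (d + 1) → ℝ := fun q => (Φ.symm q).2
  have hN : {q : ℝ × Space d | (q, (0 : ℝ)) ∈ Φ.source} ∈ 𝓝 (t₀, y₀) :=
    (show Continuous fun q : ℝ × Space d => (q, (0 : ℝ)) by fun_prop).continuousAt
      (Φ.open_source.mem_nhds hsrc)
  -- The homeomorphism property is used here: surface points near the base point have parameters
  -- near (t₀, y₀). Without it another piece of the sheet could approach the base point and H would
  -- not vanish on it.
  obtain ⟨O', hO', hO's⟩ := hr.exists_nhds_of_mem_nhds (h₁ ht₀) hy₀ hN
  have hΓbox : ∀ᶠ q in 𝓝 (t₀, r t₀ y₀), (Φ.symm q).1 ∈ I₁ ×ˢ Metric.ball (0 : Space d) 1 := by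
    refine (hΓ.continuousAt.fst).eventually_mem ?_
    rw [hΓ0]
    exact hopen.mem_nhds hq₀
  have hU₀ : ∀ᶠ q : ℝ × Space (d + 1) in 𝓝 (t₀, r t₀ y₀), q.1 ∈ I₁ ∧ q.2 ∈ U :=
    (hI₁.prod hU).mem_nhds ⟨ht₀, (hr.mem_surface (h₁ ht₀) hy₀).2⟩
  obtain ⟨O, hO, hOo, hOm⟩ := eventually_nhds_iff.1
    ((hΓ.eventually (by simp)).and ((Φ.open_target.eventually_mem htgt).and
      (hΓbox.and (hU₀.and (Filter.eventually_mem_set.2 hO')))))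
  refine ⟨O, H, hOo, hOm, fun q hq => ((hO q hq).1.snd).contDiffWithinAt, ?_, fun q hq => ?_⟩
  · have hHd : HasFDerivAt H (fderiv ℝ H (t₀, r t₀ y₀)) (t₀, r t₀ y₀) :=
      (hΓ.snd.differentiableAt one_ne_zero).hasFDerivAt
    have h1 : HasDerivAt (fun s : ℝ => (t₀, r t₀ y₀ + s • e)) (0, e) 0 := by
      have := ((hasDerivAt_id (0 : ℝ)).smul_const e).const_add (r t₀ y₀)
      simpa using (hasDerivAt_const (0 : ℝ) t₀).prodMk this
    have h2 := HasFDerivAt.comp_hasDerivAt_of_eq (x := (0 : ℝ)) hHd h1 (by simp)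
    have h3 : (H ∘ fun s : ℝ => (t₀, r t₀ y₀ + s • e)) =ᶠ[𝓝 0] fun s => s := by
      have hc : ContinuousAt (fun s : ℝ => (((t₀, y₀), s) : (ℝ × Space d) × ℝ)) 0 := by fun_prop
      filter_upwards [hc.eventually (Φ.open_source.eventually_mem hsrc)] with s hs
      change (Φ.symm (G ((t₀, y₀), s))).2 = s
      rw [← hΦ, Φ.left_inv hs]
    exact h2.unique ((hasDerivAt_id (0 : ℝ)).congr_of_eventuallyEq h3)
  · obtain ⟨-, hqt, hqb, ⟨hq1, hqU⟩, hqO⟩ := hO q hq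
    refine ⟨hq1, hqU, fun h0 => ?_, fun hqS => ?_⟩
    · have h1 : G (Φ.symm q) = q := by rw [← hΦ, Φ.right_inv hqt]
      have h2 : q.1 = (Φ.symm q).1.1 := (congrArg Prod.fst h1).symm
      have h3 : q.2 = r (Φ.symm q).1.1 (Φ.symm q).1.2 := by
        have h4 := (congrArg Prod.snd h1).symm
        have h5 : (Φ.symm q).2 = 0 := h0
        simpa [G, h5] using h4
      rw [h2, h3]
      exact (hr.mem_surface (h₁ hqb.1) hqb.2).1
    · have h1 : q.2 ∈ r q.1 '' Metric.ball 0 1 := by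
        rw [hr.image q.1 (h₁ hq1)]; exact ⟨hqS, hqU⟩
      obtain ⟨y, hy, hyq⟩ := h1
      have h2 : ((q.1, y), (0 : ℝ)) ∈ Φ.source := hO's q.1 (h₁ hq1) y hy (by rw [hyq]; exact hqO)
      have h3 : G ((q.1, y), 0) = q := by ext1 <;> simp [G, hyq]
      change (Φ.symm q).2 = 0
      rw [← h3, ← hΦ, Φ.left_inv h2]

theorem gradient_eq (hr : IsParametrization S ν U I r) (hI₁ : IsOpen I₁) (h₁ : I₁ ⊆ I)
    {q : ℝ × Space d} (hq : q ∈ I₁ ×ˢ Metric.ball (0 : Space d) 1)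
    {H : ℝ × Space (d + 1) → ℝ} (hH : DifferentiableAt ℝ H (q.1, r q.1 q.2))
    (hz : ∀ᶠ z in 𝓝 (q.1, r q.1 q.2), z.1 ∈ I₁ → z.2 ∈ S z.1 → H z = 0)
    (hν : ‖ν q.1 (r q.1 q.2)‖ = 1) :
    gradient (fun x => H (q.1, x)) (r q.1 q.2)
      = fderiv ℝ H (q.1, r q.1 q.2) (0, ν q.1 (r q.1 q.2)) • ν q.1 (r q.1 q.2) := by
  refine ext_inner_right ℝ fun w => ?_
  rw [inner_smul_left, gradient, InnerProductSpace.toDual_symm_apply]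
  have h1 : HasFDerivAt (fun x : Space (d + 1) => (q.1, x))
      (ContinuousLinearMap.inr ℝ ℝ (Space (d + 1))) (r q.1 q.2) := hasFDerivAt_prodMk_right _ _
  have h2 := (HasFDerivAt.comp (r q.1 q.2) hH.hasFDerivAt h1).fderiv
  have h3 : fderiv ℝ (fun x => H (q.1, x)) (r q.1 q.2) w
      = fderiv ℝ H (q.1, r q.1 q.2) (0, w) := by
    rw [show (fun x => H (q.1, x)) = H ∘ fun x => (q.1, x) from rfl, h2]; rfl
  rw [h3, hr.fderiv_eq_of_gradient hI₁ h₁ hq hH hz hν]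
  simp

/-- The density `∂_t H / |∇_x H|` is the negative of the normal velocity of the surface. -/
theorem eq_of_isMuDensityAt (hr : IsParametrization S ν U I r) (hI₁ : IsOpen I₁) (h₁ : I₁ ⊆ I)
    (hT : I₁ ⊆ Icc 0 T) {q : ℝ × Space d} (hq : q ∈ I₁ ×ˢ Metric.ball (0 : Space d) 1)
    (hν : ‖ν q.1 (r q.1 q.2)‖ = 1) {c : ℝ} (hc : IsMuDensityAt T S ν q.1 (r q.1 q.2) c) :
    c = -inner ℝ (ν q.1 (r q.1 q.2)) (derivWithin (fun τ => r τ q.2) I q.1) := by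
  obtain ⟨J, W, H, hJ, hqJ, hW, hqW, hH, hzero, hgrad, rfl⟩ := hc
  have hqS := (hr.mem_surface (h₁ hq.1) hq.2).1
  have hnhds : J ×ˢ W ∈ 𝓝 (q.1, r q.1 q.2) := (hJ.prod hW).mem_nhds ⟨hqJ, hqW⟩
  have hHd : DifferentiableAt ℝ H (q.1, r q.1 q.2) :=
    (hH.contDiffAt hnhds).differentiableAt one_ne_zero
  have hz : ∀ᶠ z in 𝓝 (q.1, r q.1 q.2), z.1 ∈ I₁ → z.2 ∈ S z.1 → H z = 0 := by
    filter_upwards [hnhds] with z hz hz1 hzS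
    have : z.2 ∈ {x ∈ W | H (z.1, x) = 0} := by
      rw [hzero z.1 ⟨hz.1, hT hz1⟩]; exact ⟨hzS, hz.2⟩
    exact this.2
  obtain ⟨a, ha, hga⟩ := hgrad q.1 ⟨hqJ, hT hq.1⟩ _ ⟨hqS, hqW⟩
  have h1 := hr.gradient_eq hI₁ h₁ hq hHd hz hν
  have hn0 : ν q.1 (r q.1 q.2) ≠ 0 := by intro h; simp [h] at hν
  have h2 : fderiv ℝ H (q.1, r q.1 q.2) (0, ν q.1 (r q.1 q.2)) = a := by
    rw [hga] at h1
    exact (smul_left_injective ℝ hn0 h1).symm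
  have h3 : deriv (fun τ => H (τ, r q.1 q.2)) q.1 = fderiv ℝ H (q.1, r q.1 q.2) (1, 0) := by
    have := HasFDerivAt.comp_hasDerivAt_of_eq q.1 hHd.hasFDerivAt
      ((hasDerivAt_id q.1).prodMk (hasDerivAt_const q.1 (r q.1 q.2))) rfl
    exact this.deriv
  rw [hga, norm_smul, hν, mul_one, Real.norm_of_nonneg ha.le, h3,
    hr.fderiv_eq_of_gradient hI₁ h₁ hq hHd hz hν, h2]
  field_simp
  simp

/-- Every admissible value equals minus the normal velocity, so the choice in `muDensity` is
immaterial. -/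
theorem muDensity_eq (hr : IsParametrization S ν U I r) (hI₁ : IsOpen I₁) (h₁ : I₁ ⊆ I)
    (hT : I₁ ⊆ Icc 0 T) {q : ℝ × Space d} (hq : q ∈ I₁ ×ˢ Metric.ball (0 : Space d) 1)
    (hν : ‖ν q.1 (r q.1 q.2)‖ = 1) (hex : ∃ c, IsMuDensityAt T S ν q.1 (r q.1 q.2) c) :
    muDensity T S ν q.1 (r q.1 q.2)
      = -inner ℝ (ν q.1 (r q.1 q.2)) (derivWithin (fun τ => r τ q.2) I q.1) := by
  rw [muDensity, dif_pos hex]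
  exact hr.eq_of_isMuDensityAt hI₁ h₁ hT hq hν hex.choose_spec

/-- This guarantees that `muDensity` is not its default value 0. Positivity of the normal derivative
orients the gradient along ν. -/
theorem exists_isMuDensityAt (hr : IsParametrization S ν U I r) (hI₁ : IsOpen I₁) (h₁ : I₁ ⊆ I)
    (hν : ∀ t ∈ I₁, ∀ x ∈ S t, ‖ν t x‖ = 1)
    {O : Set (ℝ × Space (d + 1))} (hO : IsOpen O) {H : ℝ × Space (d + 1) → ℝ}
    (hH : ContDiffOn ℝ 1 H O)
    (hz : ∀ q ∈ O, q.1 ∈ I₁ ∧ q.2 ∈ U ∧ (H q = 0 ↔ q.2 ∈ S q.1))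
    (hpos : ∀ q ∈ O, q.2 ∈ S q.1 → 0 < fderiv ℝ H q (0, ν q.1 q.2))
    {q : ℝ × Space (d + 1)} (hq : q ∈ O) : ∃ c, IsMuDensityAt T S ν q.1 q.2 c := by
  obtain ⟨J, W, hJ, hqJ, hW, hqW, hJW⟩ := mem_nhds_prod_iff'.1 (hO.mem_nhds hq)
  refine ⟨_, J, W, H, hJ, hqJ, hW, hqW, hH.mono hJW, fun τ hτ => ?_, fun τ hτ z hzz => ?_, rfl⟩
  · ext z
    constructor
    · rintro ⟨hzW, h0⟩
      exact ⟨(hz (τ, z) (hJW ⟨hτ.1, hzW⟩)).2.2.1 h0, hzW⟩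
    · rintro ⟨hzS, hzW⟩
      exact ⟨hzW, (hz (τ, z) (hJW ⟨hτ.1, hzW⟩)).2.2.2 hzS⟩
  · have hm : (τ, z) ∈ O := hJW ⟨hτ.1, hzz.2⟩
    obtain ⟨hτ1, hzU, -⟩ := hz (τ, z) hm
    have h1 : z ∈ r τ '' Metric.ball 0 1 := by
      rw [hr.image τ (h₁ hτ1)]; exact ⟨hzz.1, hzU⟩
    obtain ⟨y, hy, rfl⟩ := h1
    refine ⟨_, hpos (τ, r τ y) hm hzz.1, ?_⟩
    refine hr.gradient_eq (q := (τ, y)) hI₁ h₁ ⟨hτ1, hy⟩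
      ((hH.contDiffAt (hO.mem_nhds hm)).differentiableAt one_ne_zero) ?_ (hν τ hτ1 _ hzz.1)
    filter_upwards [hO.mem_nhds hm] with w hw _ hwS using (hz w hw).2.2.2 hwS

/-- The unit normal field in parameters is differentiable in space. -/
theorem exists_hasFDerivAt_normal (hr : IsParametrization S ν U I r) (hI₁ : IsOpen I₁)
    (h₁ : I₁ ⊆ I) (hν : ∀ t ∈ I₁, ∀ x ∈ S t, ‖ν t x‖ = 1)
    (hνc : ContinuousOn (fun q : ℝ × Space d => ν q.1 (r q.1 q.2))
      (I₁ ×ˢ Metric.ball (0 : Space d) 1))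
    {q₀ : ℝ × Space d} (hq₀ : q₀ ∈ I₁ ×ˢ Metric.ball (0 : Space d) 1) :
    ∃ (D : Set (ℝ × Space d)) (B : ℝ × Space d → Space d →L[ℝ] Space (d + 1)), IsOpen D ∧
      q₀ ∈ D ∧ D ⊆ I₁ ×ˢ Metric.ball (0 : Space d) 1 ∧ ContinuousOn B D ∧
      ∀ q ∈ D, HasFDerivAt (fun y => ν q.1 (r q.1 y)) (B q) q.2 := by
  have hopen : IsOpen (I₁ ×ˢ Metric.ball (0 : Space d) 1) := hI₁.prod Metric.isOpen_ball
  set e := ν q₀.1 (r q₀.1 q₀.2) with he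
  have hn1 : ∀ q ∈ I₁ ×ˢ Metric.ball (0 : Space d) 1, ‖ν q.1 (r q.1 q.2)‖ = 1 := fun q hq =>
    hν _ hq.1 _ (hr.mem_surface (h₁ hq.1) hq.2).1
  have hA : ContinuousOn (fun q : ℝ × Space d => fderiv ℝ (r q.1) q.2)
      (I₁ ×ˢ Metric.ball (0 : Space d) 1) := hr.continuous_fderiv.mono (prod_mono h₁ subset_rfl)
  have hA2 : ContinuousOn (fun q : ℝ × Space d => fderiv ℝ (fderiv ℝ (r q.1)) q.2)
      (I₁ ×ˢ Metric.ball (0 : Space d) 1) :=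
    hr.continuous_fderiv_fderiv.mono (prod_mono h₁ subset_rfl)
  let Ψ : (Space d →L[ℝ] Space (d + 1)) → Space (d + 1) :=
    fun A => ‖normalPart e A‖⁻¹ • normalPart e A
  have hee : 0 < inner ℝ e e := by rw [real_inner_self_eq_norm_sq, he, hn1 q₀ hq₀]; norm_num
  have hΨ0 : ContDiffAt ℝ 1 Ψ (fderiv ℝ (r q₀.1) q₀.2) := by
    refine contDiffAt_normalized_normalPart (hr.immersion _ (h₁ hq₀.1) _ hq₀.2) fun h => ?_
    have := eq_smul_normalPart (hr.immersion _ (h₁ hq₀.1) _ hq₀.2) (hn1 q₀ hq₀)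
      (hr.normal _ (h₁ hq₀.1) _ hq₀.2) hee
    rw [h, smul_zero] at this
    have h1 := hn1 q₀ hq₀
    rw [this] at h1
    simp at h1
  obtain ⟨𝒰, h𝒰, h𝒰o, h𝒰m⟩ := eventually_nhds_iff.1 (hΨ0.eventually (by simp))
  -- Here e is ν at the base point; continuity of ν keeps the orientation, so one formula describes
  -- ν in a whole neighbourhood.
  have hpos : ∀ᶠ q in 𝓝 q₀, 0 < inner ℝ (ν q.1 (r q.1 q.2)) e :=
    ((hνc.continuousAt (hopen.mem_nhds hq₀)).inner continuousAt_const).eventually_const_lt hee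
  have hA𝒰 : ∀ᶠ q in 𝓝 q₀, fderiv ℝ (r q.1) q.2 ∈ 𝒰 :=
    (hA.continuousAt (hopen.mem_nhds hq₀)).eventually_mem (h𝒰o.mem_nhds h𝒰m)
  obtain ⟨D, hD, hDo, hDm⟩ := eventually_nhds_iff.1
    (hpos.and (hA𝒰.and (hopen.eventually_mem hq₀)))
  have hDs : D ⊆ I₁ ×ˢ Metric.ball (0 : Space d) 1 := fun q hq => (hD q hq).2.2
  have hΨc : ContinuousOn (fderiv ℝ Ψ) 𝒰 :=
    (ContDiffOn.continuousOn_fderiv_of_isOpen (n := 1)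
      (fun A hA => (h𝒰 A hA).contDiffWithinAt) h𝒰o le_rfl)
  refine ⟨D, fun q => (fderiv ℝ Ψ (fderiv ℝ (r q.1) q.2)) ∘L (fderiv ℝ (fderiv ℝ (r q.1)) q.2),
    hDo, hDm, hDs, ?_, fun q hq => ?_⟩
  · have h1 : ContinuousOn (fun q : ℝ × Space d => fderiv ℝ Ψ (fderiv ℝ (r q.1) q.2)) D :=
      hΨc.comp (hA.mono hDs) fun q hq => (hD q hq).2.1
    exact h1.clm_comp (hA2.mono hDs)
  · have h1 : HasFDerivAt Ψ (fderiv ℝ Ψ (fderiv ℝ (r q.1) q.2)) (fderiv ℝ (r q.1) q.2) :=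
      ((h𝒰 _ (hD q hq).2.1).differentiableAt one_ne_zero).hasFDerivAt
    have h2 := HasFDerivAt.comp q.2 h1 (hr.hasFDerivAt_fderiv (h₁ (hDs hq).1) (hDs hq).2)
    refine h2.congr_of_eventuallyEq ?_
    have hc : ContinuousAt (fun y : Space d => (q.1, y)) q.2 := by fun_prop
    filter_upwards [hc.eventually (hDo.eventually_mem hq)] with y hy
    have hb := hDs hy
    have h3 : ‖ν q.1 (r q.1 y)‖ = 1 := hn1 (q.1, y) hb
    have h4 : 0 < inner ℝ (ν q.1 (r q.1 y)) e := (hD (q.1, y) hy).1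
    exact eq_smul_normalPart (hr.immersion q.1 (h₁ hb.1) y hb.2) h3
      (hr.normal q.1 (h₁ hb.1) y hb.2) h4

end IsParametrization

end DefiningFunctions

/-! ### Change of variables at each fixed time. -/

section ChangeOfVariables

variable {d : ℕ}

theorem _root_.ContinuousOn.measurableSet_inter_preimage_of_measurableSet {α β : Type*}
    [TopologicalSpace α] [MeasurableSpace α] [OpensMeasurableSpace α] [TopologicalSpace β]
    [MeasurableSpace β] [BorelSpace β] {f : α → β} {s : Set α} (hf : ContinuousOn f s)
    (hs : MeasurableSet s) {A : Set β} (hA : MeasurableSet A) : MeasurableSet (s ∩ f ⁻¹' A) := by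
  have h1 := (continuousOn_iff_continuous_domRestrict.1 hf).measurable hA
  have h2 := hs.subtype_image h1
  convert! h2 using 1
  ext x
  simp [domRestrict, and_comm]

instance : (volume : Measure (Space d × ℝ)).IsAddHaarMeasure :=
  inferInstanceAs (Measure.prod volume volume).IsAddHaarMeasure

/-- Change of variables for one-parameter families of diffeomorphisms `z ↦ N' ((t, z.1), z.2)`. -/
theorem exists_map_withDensity_eq {I : Set ℝ} {B : Set (Space d)} {ε : ℝ}
    {N' : (ℝ × Space d) × ℝ → Space (d + 1)}
    {D : (ℝ × Space d) × ℝ → (Space d × ℝ →L[ℝ] Space (d + 1))}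
    (L : (Space d × ℝ) ≃L[ℝ] Space (d + 1)) (hI : MeasurableSet I) (hB : MeasurableSet B)
    (hN : ContinuousOn N' ((I ×ˢ B) ×ˢ Ioo (-ε) ε)) (hD : ContinuousOn D ((I ×ˢ B) ×ˢ Ioo (-ε) ε))
    (hinj : ∀ t ∈ I, InjOn (fun z : Space d × ℝ => N' ((t, z.1), z.2)) (B ×ˢ Ioo (-ε) ε))
    (hder : ∀ t ∈ I, ∀ z ∈ B ×ˢ Ioo (-ε) ε,
      HasFDerivAt (fun z : Space d × ℝ => N' ((t, z.1), z.2)) (D ((t, z.1), z.2)) z) :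
    ∃ κ : ℝ, 0 < κ ∧
      ((((volume : Measure (ℝ × Space d)).restrict (I ×ˢ B)).prod
        (volume.restrict (Ioo (-ε) ε))).withDensity fun r =>
          ENNReal.ofReal (κ * |((L.symm : Space (d + 1) →L[ℝ] Space d × ℝ) ∘L D r).det|)).map
          (fun r => (r.1.1, N' r))
        = volume.restrict ((fun r => (r.1.1, N' r)) '' ((I ×ˢ B) ×ˢ Ioo (-ε) ε)) := by
  set Q := (I ×ˢ B) ×ˢ Ioo (-ε) ε with hQ
  have hQm : MeasurableSet Q := (hI.prod hB).prod measurableSet_Ioo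
  set N : (ℝ × Space d) × ℝ → ℝ × Space (d + 1) := fun r => (r.1.1, N' r) with hNdef
  have hNc : ContinuousOn N Q := (by fun_prop : Continuous fun r : (ℝ × Space d) × ℝ =>
    r.1.1).continuousOn.prodMk hN
  have hNinj : InjOn N Q := by
    rintro ⟨⟨t, y⟩, s⟩ hr ⟨⟨t', y'⟩, s'⟩ hr' h
    obtain ⟨h1, h2⟩ := Prod.ext_iff.1 h
    obtain rfl : t = t' := h1
    have h3 := hinj t hr.1.1 (show (y, s) ∈ B ×ˢ Ioo (-ε) ε from ⟨hr.1.2, hr.2⟩)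
      (show (y', s') ∈ B ×ˢ Ioo (-ε) ε from ⟨hr'.1.2, hr'.2⟩) h2
    obtain ⟨rfl, rfl⟩ := Prod.ext_iff.1 h3
    rfl
  have := ContinuousLinearEquiv.isAddHaarMeasure_map L.symm (volume : Measure (Space (d + 1)))
  -- Determinants are available only for endomorphisms, so L⁻¹ is composed in front; κ accounts for
  -- the scaling of volume by L.
  let κ := Measure.addHaarScalarFactor ((volume : Measure (Space (d + 1))).map L.symm)
    (volume : Measure (Space d × ℝ))
  have hκ : 0 < κ := Measure.addHaarScalarFactor_pos_of_isAddHaarMeasure _ _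
  have hmap : (volume : Measure (Space (d + 1))).map L.symm
      = κ • (volume : Measure (Space d × ℝ)) := Measure.isAddLeftInvariant_eq_smul _ _
  have hdet : ContinuousOn (fun r => κ * |((L.symm : Space (d + 1) →L[ℝ] Space d × ℝ) ∘L D r).det|)
      Q := by
    have h1 : ContinuousOn (fun r => (L.symm : Space (d + 1) →L[ℝ] Space d × ℝ) ∘L D r) Q :=
      continuousOn_const.clm_comp hD
    exact continuousOn_const.mul (ContinuousLinearMap.continuous_det.comp_continuousOn h1).abs
  let J : (ℝ × Space d) × ℝ → ℝ≥0∞ := fun r =>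
    ENNReal.ofReal (κ * |((L.symm : Space (d + 1) →L[ℝ] Space d × ℝ) ∘L D r).det|)
  have hJ : ContinuousOn J Q := ENNReal.continuous_ofReal.comp_continuousOn hdet
  -- The area formula is used in the space variables alone, because no time derivative of the maps
  -- is assumed. Tonelli then reassembles the slices, since the chart preserves time.
  have hslice : ∀ t ∈ I, ∀ s ⊆ B ×ˢ Ioo (-ε) ε, MeasurableSet s →
      volume ((fun z : Space d × ℝ => N' ((t, z.1), z.2)) '' s)
        = ∫⁻ z in s, J ((t, z.1), z.2) := by
    intro t ht s hs hsm
    let f : Space d × ℝ → Space d × ℝ := fun z => L.symm (N' ((t, z.1), z.2))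
    have h1 := lintegral_abs_det_fderiv_eq_addHaar_image volume (f := f) hsm
      (fun z hz => ((L.symm.hasFDerivAt).comp z (hder t ht z (hs hz))).hasFDerivWithinAt)
      (fun z hz w hw h => hinj t ht (hs hz) (hs hw) (L.symm.injective h))
    have h2 : f '' s = L.symm '' ((fun z : Space d × ℝ => N' ((t, z.1), z.2)) '' s) := by
      rw [image_image]
    have hmE : MeasurableEmbedding (L.symm : Space (d + 1) → Space d × ℝ) :=
      L.symm.toHomeomorph.measurableEmbedding
    have h3 : volume ((fun z : Space d × ℝ => N' ((t, z.1), z.2)) '' s)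
        = ((volume : Measure (Space (d + 1))).map L.symm) (f '' s) := by
      rw [h2, hmE.map_apply, preimage_image_eq _ L.symm.injective]
    rw [h3, hmap, Measure.smul_apply, ← h1, ENNReal.smul_def, smul_eq_mul,
      ← lintegral_const_mul' _ _ ENNReal.coe_ne_top]
    refine lintegral_congr fun z => ?_
    change _ = ENNReal.ofReal (κ * _)
    rw [ENNReal.ofReal_mul κ.coe_nonneg, ENNReal.ofReal_coe_nnreal]
  refine ⟨κ, by exact_mod_cast hκ, ?_⟩
  rw [IsTransversalChart.prod_restrict_eq, ← hQ]
  have hNm : AEMeasurable N ((volume : Measure ((ℝ × Space d) × ℝ)).restrict Q) :=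
    hNc.aemeasurable hQm
  ext A hA
  rw [Measure.map_apply_of_aemeasurable (hNm.mono_ac (withDensity_absolutelyContinuous _ _)) hA,
    withDensity_apply', Measure.restrict_restrict' hQm, Measure.restrict_apply hA]
  change ∫⁻ r in N ⁻¹' A ∩ Q, J r = _
  rw [inter_comm (N ⁻¹' A)]
  set s := Q ∩ N ⁻¹' A with hs
  have hsm : MeasurableSet s := hNc.measurableSet_inter_preimage_of_measurableSet hQm hA
  have hJs : AEMeasurable (s.indicator J) volume :=
    (aemeasurable_indicator_iff hsm).2 ((hJ.mono inter_subset_left).aemeasurable hsm)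
  have hIm : MeasurableSet (A ∩ N '' Q) := hA.inter (hQm.image_of_continuousOn_injOn hNc hNinj)
  have hmp := (volume_preserving_prodAssoc (α₁ := ℝ) (β₁ := Space d) (γ₁ := ℝ)).symm
  rw [← lintegral_indicator hsm, ← hmp.lintegral_comp_emb MeasurableEquiv.prodAssoc.symm.measurableEmbedding]
  have hJs' : AEMeasurable (fun z : ℝ × Space d × ℝ => s.indicator J (MeasurableEquiv.prodAssoc.symm z))
      ((volume : Measure ℝ).prod (volume : Measure (Space d × ℝ))) :=
    hJs.comp_quasiMeasurePreserving hmp.quasiMeasurePreserving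
  have e1 : ∫⁻ z : ℝ × Space d × ℝ, s.indicator J (MeasurableEquiv.prodAssoc.symm z)
      = ∫⁻ t, ∫⁻ z : Space d × ℝ, s.indicator J ((t, z.1), z.2) :=
    lintegral_prod _ hJs'
  have e2 : (volume : Measure (ℝ × Space (d + 1))) (A ∩ N '' Q)
      = ∫⁻ t, volume (Prod.mk t ⁻¹' (A ∩ N '' Q)) := Measure.prod_apply hIm
  rw [e1, e2]
  refine lintegral_congr fun t => ?_
  set st : Set (Space d × ℝ) := (fun z => ((t, z.1), z.2)) ⁻¹' s with hst
  have hstm : MeasurableSet st := (by fun_prop : Measurable fun z : Space d × ℝ => ((t, z.1), z.2)) hsm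
  have h1 : ∫⁻ z : Space d × ℝ, s.indicator J ((t, z.1), z.2)
      = ∫⁻ z in st, J ((t, z.1), z.2) := by
    rw [← lintegral_indicator hstm]
    rfl
  rw [h1]
  by_cases ht : t ∈ I
  · rw [← hslice t ht st (fun z hz => ⟨hz.1.1.2, hz.1.2⟩) hstm]
    congr 1
    ext x
    constructor
    · rintro ⟨z, hz, rfl⟩
      exact ⟨hz.2, ((t, z.1), z.2), hz.1, rfl⟩
    · rintro ⟨hxA, ⟨⟨⟨t', y⟩, σ⟩, hr, hrx⟩⟩
      obtain ⟨h2, h3⟩ := Prod.ext_iff.1 hrx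
      obtain rfl : t' = t := h2
      refine ⟨(y, σ), ⟨hr, ?_⟩, h3⟩
      change N ((t', y), σ) ∈ A
      rw [hrx]
      exact hxA
  · have h2 : st = ∅ := by
      ext z
      simp only [mem_empty_iff_false, iff_false]
      exact fun hz => ht hz.1.1.1
    have h3 : Prod.mk t ⁻¹' (A ∩ N '' Q) = ∅ := by
      ext x
      simp only [mem_empty_iff_false, iff_false]
      rintro ⟨-, ⟨r, hr, hrx⟩⟩
      have : r.1.1 = t := (Prod.ext_iff.1 hrx).1
      exact ht (this ▸ hr.1.1)
    rw [h2, h3]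
    simp

end ChangeOfVariables

/-! ### Linearization of the normal coordinates. -/

section NormalCoordinates

variable {d : ℕ}

/-- Near a point, the maps `(y, s) ↦ r t y + s • n t y` are uniformly close to their common
linearization. -/
theorem eventually_normalCoordinates {D : Set (ℝ × Space d)} (hD : IsOpen D)
    {r n : ℝ → Space d → Space (d + 1)} {A B : ℝ × Space d → (Space d →L[ℝ] Space (d + 1))}
    (hA : ContinuousOn A D) (hB : ContinuousOn B D)
    (hn : ContinuousOn (fun q : ℝ × Space d => n q.1 q.2) D)
    (hrA : ∀ q ∈ D, HasFDerivAt (r q.1) (A q) q.2) (hnB : ∀ q ∈ D, HasFDerivAt (n q.1) (B q) q.2)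
    {q₀ : ℝ × Space d} (hq₀ : q₀ ∈ D) (L : (Space d × ℝ) ≃L[ℝ] Space (d + 1))
    (hL : (L : Space d × ℝ →L[ℝ] Space (d + 1))
      = (A q₀).coprod (ContinuousLinearMap.toSpanSingleton ℝ (n q₀.1 q₀.2)))
    {c : ℝ} (hc : 0 < c) :
    ∃ D' : (ℝ × Space d) × ℝ → (Space d × ℝ →L[ℝ] Space (d + 1)),
      ContinuousOn D' (D ×ˢ univ) ∧
      (∀ q ∈ D, ∀ s, HasFDerivAt (fun z : Space d × ℝ => r q.1 z.1 + z.2 • n q.1 z.1)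
        (D' (q, s)) (q.2, s)) ∧
      (∀ᶠ z in 𝓝 (q₀, (0 : ℝ)), ‖D' z - L‖ ≤ c) ∧
      (∀ᶠ z in 𝓝 (q₀, (0 : ℝ)),
        |((L.symm : Space (d + 1) →L[ℝ] Space d × ℝ) ∘L D' z).det - 1| < 1 / 2) := by
  let fst' := ContinuousLinearMap.fst ℝ (Space d) ℝ
  let snd' := ContinuousLinearMap.snd ℝ (Space d) ℝ
  let D' : (ℝ × Space d) × ℝ → (Space d × ℝ →L[ℝ] Space (d + 1)) := fun z =>
    (A z.1) ∘L fst' + (z.2 • (B z.1 ∘L fst') + snd'.smulRight (n z.1.1 z.1.2))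
  have hD'c : ContinuousOn D' (D ×ˢ univ) := by
    have h1 : ContinuousOn (fun z : (ℝ × Space d) × ℝ => A z.1) (D ×ˢ univ) :=
      hA.comp continuousOn_fst fun z hz => hz.1
    have h2 : ContinuousOn (fun z : (ℝ × Space d) × ℝ => B z.1) (D ×ˢ univ) :=
      hB.comp continuousOn_fst fun z hz => hz.1
    have h3 : ContinuousOn (fun z : (ℝ × Space d) × ℝ => n z.1.1 z.1.2) (D ×ˢ univ) :=
      hn.comp continuousOn_fst fun z hz => hz.1
    have h4 : ContinuousOn (fun z : (ℝ × Space d) × ℝ => snd'.smulRight (n z.1.1 z.1.2))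
        (D ×ˢ univ) :=
      (ContinuousLinearMap.smulRightL ℝ (Space d × ℝ) (Space (d + 1)) snd').continuous.comp_continuousOn
        h3
    exact (h1.clm_comp continuousOn_const).add
      ((continuousOn_snd.smul (h2.clm_comp continuousOn_const)).add h4)
  have hD'0 : D' (q₀, 0) = L := by
    rw [hL]
    ext z <;> simp [D', fst', snd']
  have hat : ContinuousAt D' (q₀, 0) :=
    hD'c.continuousAt ((hD.prod isOpen_univ).mem_nhds ⟨hq₀, mem_univ _⟩)
  refine ⟨D', hD'c, fun q hq s => ?_, ?_, ?_⟩
  · have h1 := HasFDerivAt.comp (q.2, s) (f := Prod.fst) (hrA q hq)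
      (hasFDerivAt_fst (𝕜 := ℝ) (p := (q.2, s)))
    have h2 := HasFDerivAt.comp (q.2, s) (f := Prod.fst) (hnB q hq)
      (hasFDerivAt_fst (𝕜 := ℝ) (p := (q.2, s)))
    exact h1.add ((hasFDerivAt_snd (𝕜 := ℝ) (p := (q.2, s))).smul h2)
  · have h1 : ContinuousAt (fun z => ‖D' z - L‖) (q₀, 0) := (hat.sub continuousAt_const).norm
    have h2 : ‖D' (q₀, 0) - L‖ < c := by rw [hD'0]; simpa using hc
    exact (h1.eventually_lt_const h2).mono fun z hz => hz.le
  · have h1 : ContinuousAt (fun z => (L.symm : Space (d + 1) →L[ℝ] Space d × ℝ) ∘L D' z)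
        (q₀, 0) := continuousAt_const.clm_comp hat
    have h2 : ContinuousAt (fun z =>
        |((L.symm : Space (d + 1) →L[ℝ] Space d × ℝ) ∘L D' z).det - 1|) (q₀, 0) :=
      ((ContinuousLinearMap.continuous_det.continuousAt.comp h1).sub continuousAt_const).abs
    refine h2.eventually_lt_const ?_
    beta_reduce
    rw [hD'0]
    have h3 : (L.symm : Space (d + 1) →L[ℝ] Space d × ℝ) ∘L (L : Space d × ℝ →L[ℝ] Space (d + 1))
        = ContinuousLinearMap.id ℝ _ := by ext z <;> simp
    rw [h3]
    simp [ContinuousLinearMap.det]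

end NormalCoordinates

/-! ### Surface measure under bi-Lipschitz parametrizations. -/

section SurfaceMeasure

variable {d : ℕ}

theorem euclideanHausdorffMeasure_image_le {X Y : Type*} [EMetricSpace X] [MeasurableSpace X]
    [BorelSpace X] [EMetricSpace Y] [MeasurableSpace Y] [BorelSpace Y] {K : NNReal} {f : X → Y}
    {s : Set X} (hf : LipschitzOnWith K f s) (d : ℕ) :
    Measure.euclideanHausdorffMeasure d (f '' s)
      ≤ (K : ℝ≥0∞) ^ (d : ℝ) * Measure.euclideanHausdorffMeasure d s := by
  simp only [Measure.euclideanHausdorffMeasure_def, Measure.smul_apply, ENNReal.smul_def,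
    smul_eq_mul]
  rw [mul_left_comm]
  gcongr
  exact hf.hausdorffMeasure_image_le d.cast_nonneg

/-- Bi-Lipschitz parametrizations compare the surface measure with Lebesgue measure. -/
theorem surfaceMeasure_image_le {K : NNReal} {f : Space d → Space (d + 1)} {B E : Set (Space d)}
    (hf : LipschitzOnWith K f B) (hE : E ⊆ B) (A : Set (Space (d + 1))) :
    surfaceMeasure A (f '' E) ≤ (K : ℝ≥0∞) ^ (d : ℝ) * volume E := by
  rw [← EuclideanSpace.euclideanHausdorffMeasure_eq_volume]
  exact (Measure.restrict_apply_le _ _).trans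
    (euclideanHausdorffMeasure_image_le (hf.mono hE) d)

/-- The inverse of f is K-Lipschitz on f(B), and Hausdorff measure grows by at most K^d under it. -/
theorem map_le_smul_surfaceMeasure {K : NNReal} {f : Space d → Space (d + 1)} {B : Set (Space d)}
    (hB : MeasurableSet B) (hfc : ContinuousOn f B)
    (hf : ∀ x ∈ B, ∀ y ∈ B, edist x y ≤ K * edist (f x) (f y)) {A : Set (Space (d + 1))}
    (hA : ∀ x ∈ B, f x ∈ A) :
    ((volume : Measure (Space d)).restrict B).map f
      ≤ ((K : ℝ≥0∞) ^ (d : ℝ)) • surfaceMeasure A := by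
  have hfm : AEMeasurable f ((volume : Measure (Space d)).restrict B) := hfc.aemeasurable hB
  refine Measure.le_iff.2 fun s hs => ?_
  rw [Measure.map_apply_of_aemeasurable hfm hs, Measure.restrict_apply' hB, Measure.smul_apply,
    smul_eq_mul, surfaceMeasure, Measure.restrict_apply hs,
    ← EuclideanSpace.euclideanHausdorffMeasure_eq_volume]
  have hinj : InjOn f B := fun x hx y hy h => by
    have := hf x hx y hy
    rw [h, edist_self, mul_zero] at this
    exact edist_le_zero.1 this
  by_cases hBn : B.Nonempty
  · have hg : LipschitzOnWith K (Function.invFunOn f B) (f '' (f ⁻¹' s ∩ B)) := by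
      rintro _ ⟨x, hx, rfl⟩ _ ⟨y, hy, rfl⟩
      rw [hinj.leftInvOn_invFunOn hx.2, hinj.leftInvOn_invFunOn hy.2]
      exact hf x hx.2 y hy.2
    have h1 : Function.invFunOn f B '' (f '' (f ⁻¹' s ∩ B)) = f ⁻¹' s ∩ B :=
      (hinj.leftInvOn_invFunOn.mono inter_subset_right).image_image
    have h2 := euclideanHausdorffMeasure_image_le hg d
    rw [h1] at h2
    refine h2.trans ?_
    gcongr
    rintro _ ⟨x, hx, rfl⟩
    exact ⟨hx.1, hA x hx.2⟩
  · rw [not_nonempty_iff_eq_empty] at hBn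
    simp [hBn]

end SurfaceMeasure

/-! ### Normal coordinates on a box, uniformly in time. -/

section NormalBoxes

variable {d : ℕ}

/-- The coordinates `((t, y), s) ↦ (t, r t y + s • n t y)`. -/
def sheetCoord (r n : ℝ → Space d → Space (d + 1)) (z : (ℝ × Space d) × ℝ) :
    ℝ × Space (d + 1) :=
  (z.1.1, r z.1.1 z.1.2 + z.2 • n z.1.1 z.1.2)

theorem sheetCoord_zero (r n : ℝ → Space d → Space (d + 1)) (x : ℝ × Space d) :
    sheetCoord r n (x, 0) = (x.1, r x.1 x.2) := by simp [sheetCoord]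

theorem continuousOn_sheetCoord {r n : ℝ → Space d → Space (d + 1)} {D : Set (ℝ × Space d)}
    (hr : ContinuousOn (fun q : ℝ × Space d => r q.1 q.2) D)
    (hn : ContinuousOn (fun q : ℝ × Space d => n q.1 q.2) D) :
    ContinuousOn (sheetCoord r n) (D ×ˢ univ) := by
  have h1 : ContinuousOn (fun z : (ℝ × Space d) × ℝ => r z.1.1 z.1.2) (D ×ˢ univ) :=
    hr.comp continuousOn_fst fun z hz => hz.1
  have h2 : ContinuousOn (fun z : (ℝ × Space d) × ℝ => n z.1.1 z.1.2) (D ×ˢ univ) :=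
    hn.comp continuousOn_fst fun z hz => hz.1
  exact (continuousOn_fst.fst).prodMk (h1.add (continuousOn_snd.smul h2))

theorem injOn_sheetCoord {r n : ℝ → Space d → Space (d + 1)} {I : Set ℝ} {B : Set (Space d)}
    {E : Set ℝ} (h : ∀ t ∈ I, InjOn (fun z : Space d × ℝ => r t z.1 + z.2 • n t z.1) (B ×ˢ E)) :
    InjOn (sheetCoord r n) ((I ×ˢ B) ×ˢ E) := by
  rintro ⟨⟨t, y⟩, s⟩ hr ⟨⟨t', y'⟩, s'⟩ hr' hN
  obtain ⟨h1, h2⟩ := Prod.ext_iff.1 hN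
  obtain rfl : t = t' := h1
  have h3 := h t hr.1.1 (show (y, s) ∈ B ×ˢ E from ⟨hr.1.2, hr.2⟩)
    (show (y', s') ∈ B ×ˢ E from ⟨hr'.1.2, hr'.2⟩) h2
  obtain ⟨rfl, rfl⟩ := Prod.ext_iff.1 h3
  rfl

/-- The maps `(y, s) ↦ r t y + s • n t y` are uniformly close to a linear equivalence on a box, in
which the Jacobian is controlled. -/
theorem exists_approximatesLinearOn_sheetCoord {D : Set (ℝ × Space d)} (hD : IsOpen D)
    {r n : ℝ → Space d → Space (d + 1)} {A B : ℝ × Space d → (Space d →L[ℝ] Space (d + 1))}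
    (hA : ContinuousOn A D) (hB : ContinuousOn B D)
    (hn : ContinuousOn (fun q : ℝ × Space d => n q.1 q.2) D)
    (hrA : ∀ q ∈ D, HasFDerivAt (r q.1) (A q) q.2) (hnB : ∀ q ∈ D, HasFDerivAt (n q.1) (B q) q.2)
    {t₀ : ℝ} {y₀ : Space d} (hq₀ : (t₀, y₀) ∈ D) (L : (Space d × ℝ) ≃L[ℝ] Space (d + 1))
    (hL : (L : Space d × ℝ →L[ℝ] Space (d + 1))
      = (A (t₀, y₀)).coprod (ContinuousLinearMap.toSpanSingleton ℝ (n t₀ y₀)))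
    {c : NNReal} (hc : 0 < c) {P : Set ((ℝ × Space d) × ℝ)} (hP : P ∈ 𝓝 ((t₀, y₀), 0))
    {ε₀ : ℝ} (hε₀ : 0 < ε₀) :
    ∃ δ, 0 < δ ∧ δ ≤ ε₀ ∧ (Metric.ball t₀ δ ×ˢ Metric.ball y₀ δ) ×ˢ Ioo (-δ) δ ⊆ P ∧
      Metric.ball t₀ δ ×ˢ Metric.ball y₀ δ ⊆ D ∧
      (∀ t ∈ Metric.ball t₀ δ, ApproximatesLinearOn (fun z : Space d × ℝ => r t z.1 + z.2 • n t z.1)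
        (L : Space d × ℝ →L[ℝ] Space (d + 1)) (Metric.ball y₀ δ ×ˢ Ioo (-δ) δ) c) ∧
      ∃ D' : (ℝ × Space d) × ℝ → (Space d × ℝ →L[ℝ] Space (d + 1)),
        ContinuousOn D' ((Metric.ball t₀ δ ×ˢ Metric.ball y₀ δ) ×ˢ Ioo (-δ) δ) ∧
        (∀ t ∈ Metric.ball t₀ δ, ∀ z ∈ Metric.ball y₀ δ ×ˢ Ioo (-δ) δ,
          HasFDerivAt (fun z : Space d × ℝ => r t z.1 + z.2 • n t z.1) (D' ((t, z.1), z.2)) z) ∧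
        ∀ z ∈ (Metric.ball t₀ δ ×ˢ Metric.ball y₀ δ) ×ˢ Ioo (-δ) δ,
          |((L.symm : Space (d + 1) →L[ℝ] Space d × ℝ) ∘L D' z).det - 1| < 1 / 2 := by
  obtain ⟨D', hD'c, hD'd, hD'L, hD'det⟩ := eventually_normalCoordinates hD hA hB hn hrA hnB hq₀ L hL
    (show (0 : ℝ) < c by exact_mod_cast hc)
  have hDev : ∀ᶠ z : (ℝ × Space d) × ℝ in 𝓝 ((t₀, y₀), (0 : ℝ)), z.1 ∈ D :=
    continuousAt_fst.eventually_mem (hD.mem_nhds hq₀)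
  obtain ⟨δ', hδ', hball⟩ := Metric.eventually_nhds_iff_ball.1
    ((Filter.eventually_mem_set.2 hP).and (hDev.and (hD'L.and hD'det)))
  have hδ : 0 < min δ' ε₀ := lt_min hδ' hε₀
  generalize hδdef : min δ' ε₀ = δ at hδ
  have hδδ' : δ ≤ δ' := hδdef ▸ min_le_left _ _
  have hQball : (Metric.ball t₀ δ ×ˢ Metric.ball y₀ δ) ×ˢ Ioo (-δ) δ
      ⊆ Metric.ball ((t₀, y₀), (0 : ℝ)) δ' := by
    rw [← ball_prod_same, ← ball_prod_same]
    refine prod_mono (prod_mono (Metric.ball_subset_ball hδδ')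
      (Metric.ball_subset_ball hδδ')) ?_
    rw [Real.ball_eq_Ioo]
    exact Ioo_subset_Ioo (by simpa using hδδ') (by simpa using hδδ')
  have h0 : (0 : ℝ) ∈ Ioo (-δ) δ := ⟨by linarith, hδ⟩
  have hIBD : Metric.ball t₀ δ ×ˢ Metric.ball y₀ δ ⊆ D := fun x hx =>
    (hball (x, 0) (hQball ⟨hx, h0⟩)).2.1
  refine ⟨δ, hδ, hδdef ▸ min_le_right _ _, fun z hz => (hball z (hQball hz)).1, hIBD, ?_, D',
    hD'c.mono (prod_mono hIBD (subset_univ _)), ?_, fun z hz => (hball z (hQball hz)).2.2.2⟩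
  · intro t ht z hz w hw
    have h1 : ∀ x ∈ Metric.ball y₀ δ ×ˢ Ioo (-δ) δ,
        HasFDerivWithinAt (fun z : Space d × ℝ => r t z.1 + z.2 • n t z.1)
          (D' ((t, x.1), x.2)) (Metric.ball y₀ δ ×ˢ Ioo (-δ) δ) x := fun x hx =>
      (hD'd (t, x.1) (hIBD (mk_mem_prod ht hx.1)) x.2).hasFDerivWithinAt
    have h2 : ∀ x ∈ Metric.ball y₀ δ ×ˢ Ioo (-δ) δ,
        ‖D' ((t, x.1), x.2) - (L : Space d × ℝ →L[ℝ] Space (d + 1))‖ ≤ (c : ℝ) := fun x hx =>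
      (hball ((t, x.1), x.2) (hQball (mk_mem_prod (mk_mem_prod ht hx.1) hx.2))).2.2.1
    -- Convexity of the box lets the mean value inequality turn closeness of derivatives into
    -- closeness of increments.
    have h3 : Convex ℝ (Metric.ball y₀ δ ×ˢ Ioo (-δ) δ) := (convex_ball y₀ δ).prod (convex_Ioo _ _)
    exact h3.norm_image_sub_le_of_norm_hasFDerivWithin_le' h1 h2 hw hz
  · exact fun t ht z hz => hD'd (t, z.1) (hIBD ⟨ht, hz.1⟩) z.2

/-- Coordinates transversal to a family of hypersurfaces, on a box. -/
theorem exists_sheetCoord_box {D : Set (ℝ × Space d)} (hD : IsOpen D)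
    {r n : ℝ → Space d → Space (d + 1)} {A B : ℝ × Space d → (Space d →L[ℝ] Space (d + 1))}
    (hA : ContinuousOn A D) (hB : ContinuousOn B D)
    (hr : ContinuousOn (fun q : ℝ × Space d => r q.1 q.2) D)
    (hn : ContinuousOn (fun q : ℝ × Space d => n q.1 q.2) D)
    (hrA : ∀ q ∈ D, HasFDerivAt (r q.1) (A q) q.2) (hnB : ∀ q ∈ D, HasFDerivAt (n q.1) (B q) q.2)
    {t₀ : ℝ} {y₀ : Space d} (hq₀ : (t₀, y₀) ∈ D) (hAinj : Function.Injective (A (t₀, y₀)))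
    (hn1 : ‖n t₀ y₀‖ = 1) (hperp : ∀ v, inner ℝ (A (t₀, y₀) v) (n t₀ y₀) = 0)
    {P : Set ((ℝ × Space d) × ℝ)} (hP : P ∈ 𝓝 ((t₀, y₀), 0)) {ε₀ : ℝ} (hε₀ : 0 < ε₀) :
    ∃ δ, 0 < δ ∧ δ ≤ ε₀ ∧ (Metric.ball t₀ δ ×ˢ Metric.ball y₀ δ) ×ˢ Ioo (-δ) δ ⊆ P ∧
      Metric.ball t₀ δ ×ˢ Metric.ball y₀ δ ⊆ D ∧
      InjOn (sheetCoord r n) ((Metric.ball t₀ δ ×ˢ Metric.ball y₀ δ) ×ˢ Ioo (-δ) δ) ∧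
      (∃ J : (ℝ × Space d) × ℝ → ℝ,
        ContinuousOn J ((Metric.ball t₀ δ ×ˢ Metric.ball y₀ δ) ×ˢ Ioo (-δ) δ) ∧
        (∀ z ∈ (Metric.ball t₀ δ ×ˢ Metric.ball y₀ δ) ×ˢ Ioo (-δ) δ, 0 < J z) ∧
        (∃ C, ∀ z ∈ (Metric.ball t₀ δ ×ˢ Metric.ball y₀ δ) ×ˢ Ioo (-δ) δ, J z ≤ C) ∧
        ((((volume : Measure (ℝ × Space d)).restrict (Metric.ball t₀ δ ×ˢ Metric.ball y₀ δ)).prod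
          (volume.restrict (Ioo (-δ) δ))).withDensity fun r => ENNReal.ofReal (J r)).map
            (sheetCoord r n) = volume.restrict
              (sheetCoord r n '' ((Metric.ball t₀ δ ×ˢ Metric.ball y₀ δ) ×ˢ Ioo (-δ) δ))) ∧
      (∃ Ω : Set (ℝ × Space (d + 1)), IsOpen Ω ∧ (t₀, r t₀ y₀) ∈ Ω ∧
        Ω ⊆ sheetCoord r n '' ((Metric.ball t₀ δ ×ˢ Metric.ball y₀ δ) ×ˢ Ioo (-δ) δ)) ∧
      (∃ K : NNReal, ∀ t ∈ Metric.ball t₀ δ, LipschitzOnWith K (r t) (Metric.ball y₀ δ)) ∧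
      (∃ K : NNReal, ∀ t ∈ Metric.ball t₀ δ, ∀ y ∈ Metric.ball y₀ δ, ∀ y' ∈ Metric.ball y₀ δ,
        edist y y' ≤ K * edist (r t y) (r t y')) := by
  obtain ⟨L, hL⟩ := exists_coordEquiv hAinj hn1 hperp
  have hLpos : 0 < ‖(L.symm : Space (d + 1) →L[ℝ] Space d × ℝ)‖₊ := L.nnnorm_symm_pos
  -- An error below 1/‖L⁻¹‖ makes the maps injective, bi-Lipschitz and open, with constants
  -- independent of t.
  obtain ⟨c, hcpos, hclt⟩ : ∃ c : NNReal, 0 < c ∧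
      c < ‖(L.symm : Space (d + 1) →L[ℝ] Space d × ℝ)‖₊⁻¹ := exists_between (inv_pos.2 hLpos)
  obtain ⟨δ, hδ, hδε, hQP, hIBD, happrox, D', hD'c, hD'd, hdet⟩ :=
    exists_approximatesLinearOn_sheetCoord hD hA hB hn hrA hnB hq₀ L hL hcpos hP hε₀
  have h0 : (0 : ℝ) ∈ Ioo (-δ) δ := ⟨by linarith, hδ⟩
  have hinj : ∀ t ∈ Metric.ball t₀ δ, InjOn (fun z : Space d × ℝ => r t z.1 + z.2 • n t z.1)
      (Metric.ball y₀ δ ×ˢ Ioo (-δ) δ) := fun t ht => (happrox t ht).injOn (Or.inr hclt)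
  have hzero_mem : ∀ y ∈ Metric.ball y₀ δ,
      ((y, 0) : Space d × ℝ) ∈ Metric.ball y₀ δ ×ˢ Ioo (-δ) δ := fun y hy => ⟨hy, h0⟩
  refine ⟨δ, hδ, hδε, hQP, hIBD, injOn_sheetCoord hinj, ?_, ?_, ?_, ?_⟩
  · have hN' : ContinuousOn (fun z : (ℝ × Space d) × ℝ => r z.1.1 z.1.2 + z.2 • n z.1.1 z.1.2)
        ((Metric.ball t₀ δ ×ˢ Metric.ball y₀ δ) ×ˢ Ioo (-δ) δ) :=
      continuous_snd.comp_continuousOn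
        ((continuousOn_sheetCoord hr hn).mono (prod_mono hIBD (subset_univ _)))
    obtain ⟨κ, hκ, hmap⟩ := exists_map_withDensity_eq L Metric.isOpen_ball.measurableSet
      Metric.isOpen_ball.measurableSet hN' hD'c hinj hD'd
    have hJb : ∀ z ∈ (Metric.ball t₀ δ ×ˢ Metric.ball y₀ δ) ×ˢ Ioo (-δ) δ,
        1 / 2 < |((L.symm : Space (d + 1) →L[ℝ] Space d × ℝ) ∘L D' z).det| ∧
        |((L.symm : Space (d + 1) →L[ℝ] Space d × ℝ) ∘L D' z).det| < 3 / 2 := by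
      intro z hz
      have h1 := abs_lt.1 (hdet z hz)
      rw [abs_of_pos (by linarith [h1.1])]
      constructor <;> linarith [h1.1, h1.2]
    refine ⟨_, ?_, fun z hz => mul_pos hκ (lt_trans (by norm_num) (hJb z hz).1),
      ⟨κ * (3 / 2), fun z hz => mul_le_mul_of_nonneg_left (hJb z hz).2.le hκ.le⟩, hmap⟩
    have h1 : ContinuousOn (fun z => (L.symm : Space (d + 1) →L[ℝ] Space d × ℝ) ∘L D' z)
        ((Metric.ball t₀ δ ×ˢ Metric.ball y₀ δ) ×ˢ Ioo (-δ) δ) :=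
      continuousOn_const.clm_comp hD'c
    exact continuousOn_const.mul (ContinuousLinearMap.continuous_det.comp_continuousOn h1).abs
  · have hcl : Metric.closedBall ((y₀, 0) : Space d × ℝ) (δ / 2)
        ⊆ Metric.ball y₀ δ ×ˢ Ioo (-δ) δ := by
      rw [← closedBall_prod_same]
      refine prod_mono (Metric.closedBall_subset_ball (half_lt_self hδ)) ?_
      rw [Real.closedBall_eq_Icc]
      exact fun s hs => ⟨by linarith [hs.1], by linarith [hs.2]⟩
    -- The radius ρ does not depend on t. This yields an open set of space-time in the image
    -- although the coordinates need not be differentiable in time.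
    obtain ⟨ρ, hρ, hsurj⟩ : ∃ ρ : ℝ, 0 < ρ ∧ ∀ t ∈ Metric.ball t₀ δ, Metric.ball (r t y₀) ρ ⊆
        (fun z : Space d × ℝ => r t z.1 + z.2 • n t z.1) '' (Metric.ball y₀ δ ×ˢ Ioo (-δ) δ) := by
      refine ⟨((‖(L.symm : Space (d + 1) →L[ℝ] Space d × ℝ)‖₊ : ℝ)⁻¹ - c) * (δ / 2),
        mul_pos (sub_pos.2 (by exact_mod_cast hclt)) (half_pos hδ), fun t ht => ?_⟩
      have h1 := (happrox t ht).surjOn_closedBall_of_nonlinearRightInverse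
        L.toNonlinearRightInverse (half_pos hδ).le hcl
      simp only [zero_smul, add_zero] at h1
      exact fun x hx => image_mono hcl (h1 (Metric.ball_subset_closedBall hx))
    have hry₀ : ∀ᶠ t in 𝓝 t₀, t ∈ Metric.ball t₀ δ ∧ r t y₀ ∈ Metric.ball (r t₀ y₀) (ρ / 2) := by
      have h1 : ContinuousAt (fun t => r t y₀) t₀ :=
        ContinuousAt.comp (f := fun t : ℝ => (t, y₀)) (hr.continuousAt (hD.mem_nhds hq₀))
          (by fun_prop)
      exact Filter.Eventually.and (Metric.ball_mem_nhds t₀ hδ)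
        (h1.eventually_mem (Metric.ball_mem_nhds _ (half_pos hρ)))
    obtain ⟨I', hI', hI'o, ht₀I'⟩ := eventually_nhds_iff.1 hry₀
    refine ⟨I' ×ˢ Metric.ball (r t₀ y₀) (ρ / 2), hI'o.prod Metric.isOpen_ball,
      ⟨ht₀I', Metric.mem_ball_self (half_pos hρ)⟩, ?_⟩
    rintro ⟨t, x⟩ ⟨ht, hx⟩
    obtain ⟨htI, htr⟩ := hI' t ht
    obtain ⟨z, hz, hzx⟩ := hsurj t htI (show x ∈ Metric.ball (r t y₀) ρ by
      rw [Metric.mem_ball] at hx htr ⊢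
      rw [dist_comm] at htr
      linarith [dist_triangle x (r t₀ y₀) (r t y₀)])
    exact ⟨((t, z.1), z.2), ⟨⟨htI, hz.1⟩, hz.2⟩, Prod.ext rfl hzx⟩
  · refine ⟨‖(L : Space d × ℝ →L[ℝ] Space (d + 1))‖₊ + c, fun t ht y hy y' hy' => ?_⟩
    have := (happrox t ht).lipschitz ⟨_, hzero_mem y hy⟩ ⟨_, hzero_mem y' hy'⟩
    simpa [domRestrict, Subtype.edist_eq, Prod.edist_eq] using this
  · refine ⟨(‖(L.symm : Space (d + 1) →L[ℝ] Space d × ℝ)‖₊⁻¹ - c)⁻¹, fun t ht y hy y' hy' => ?_⟩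
    have := (happrox t ht).antilipschitz (Or.inr hclt) ⟨_, hzero_mem y hy⟩ ⟨_, hzero_mem y' hy'⟩
    simpa [domRestrict, Subtype.edist_eq, Prod.edist_eq] using this

end NormalBoxes

/-! ### Normal charts of the space-time surface. -/

section NormalCharts

variable {d : ℕ} {T : ℝ} {S : ℝ → Set (Space (d + 1))} {ν : ℝ → Space (d + 1) → Space (d + 1)}

/-- Normal coordinates with image in `V`, together with the comparison of the measure `dy` with
the surface measure and the expression of the derivative of the defining function `H`. -/
structure IsNormalChart (T : ℝ) (S : ℝ → Set (Space (d + 1)))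
    (ν : ℝ → Space (d + 1) → Space (d + 1)) (V : Set (ℝ × Space (d + 1))) (I : Set ℝ)
    (B : Set (Space d)) (ε : ℝ) (r : ℝ → Space d → Space (d + 1)) (J : (ℝ × Space d) × ℝ → ℝ)
    (H : ℝ × Space (d + 1) → ℝ) (a : ℝ × Space d → ℝ) (Ω O : Set (ℝ × Space (d + 1))) : Prop where
  transversal : IsTransversalChart volume I B ε ((sheetCoord r fun t y => ν t (r t y))) J H a Ω O
  time_subset : I ⊆ Ioo 0 T
  image_subset : sheetCoord r (fun t y => ν t (r t y)) '' ((I ×ˢ B) ×ˢ Ioo (-ε) ε) ⊆ V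
  volume_ne_top : (volume : Measure (ℝ × Space d)) (I ×ˢ B) ≠ ⊤
  volume_base_ne_top : volume B ≠ ⊤
  continuousOn : ContinuousOn (fun q : ℝ × Space d => r q.1 q.2) (I ×ˢ B)
  norm_normal : ∀ t ∈ I, ∀ y ∈ B, ‖ν t (r t y)‖ = 1
  exists_parameter : ∀ q ∈ Ω, q.2 ∈ S q.1 → q.1 ∈ I ∧ ∃ y ∈ B, r q.1 y = q.2
  fderiv_eq : ∀ t ∈ I, ∀ y ∈ B, ∀ τ w, fderiv ℝ H (t, r t y) (τ, w)
    = a (t, y) * (muDensity T S ν t (r t y) * τ + inner ℝ (ν t (r t y)) w)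
  image_le : ∃ C : ℝ≥0∞, C ≠ ⊤ ∧ ∀ t ∈ I, ∀ E ⊆ B,
    surfaceMeasure (S t) (r t '' E) ≤ C * volume E
  map_le : ∃ C : ℝ≥0∞, C ≠ ⊤ ∧ ∀ t ∈ I,
    ((volume : Measure (Space d)).restrict B).map (r t) ≤ C • surfaceMeasure (S t)
  density : ∃ (h : ℝ × Space (d + 1) → ℝ) (C : ℝ), ContinuousOn h Ω ∧ (∀ q ∈ Ω, |h q| ≤ C) ∧
    ∀ q ∈ Ω, q.2 ∈ S q.1 → muDensity T S ν q.1 q.2 = h q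

/-- Two systems of coordinates are combined: a frozen direction gives a C¹ defining function,
whereas the chart itself must follow the true normals, along which the one-sided limits are taken.
-/
theorem IsHypersurfaceFamily.exists_normalChart (hS : IsHypersurfaceFamily T S ν) {t₀ : ℝ}
    (ht₀ : t₀ ∈ Ioo 0 T) {x₀ : Space (d + 1)} (hx₀ : x₀ ∈ S t₀) {V : Set (ℝ × Space (d + 1))}
    (hV : V ∈ 𝓝 (t₀, x₀)) {ε₀ : ℝ} (hε₀ : 0 < ε₀) :
    ∃ I B ε r J H a Ω O, IsNormalChart T S ν V I B ε r J H a Ω O ∧ (t₀, x₀) ∈ Ω ∧ ε ≤ ε₀ := by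
  obtain ⟨U, t₁, t₂, r, hU, hxU, ht₁₂, hr⟩ :=
    hS.exists_parametrization t₀ (Ioo_subset_Icc_self ht₀) x₀ hx₀
  set I₁ := Ioo t₁ t₂ ∩ Ioo 0 T with hI₁def
  have hI₁ : IsOpen I₁ := isOpen_Ioo.inter isOpen_Ioo
  have h₁ : I₁ ⊆ Ioo t₁ t₂ ∩ Icc 0 T := inter_subset_inter_right _ Ioo_subset_Icc_self
  have hT : I₁ ⊆ Icc 0 T := h₁.trans inter_subset_right
  have ht₀1 : t₀ ∈ I₁ := ⟨ht₁₂, ht₀⟩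
  have hνS : ∀ t ∈ I₁, ∀ x ∈ S t, ‖ν t x‖ = 1 := fun t ht => hS.norm_normal t (hT ht)
  obtain ⟨y₀, hy₀, rfl⟩ : x₀ ∈ r t₀ '' Metric.ball 0 1 := by
    rw [hr.image t₀ (h₁ ht₀1)]; exact ⟨hx₀, hxU⟩
  set e := ν t₀ (r t₀ y₀) with he
  have he1 : ‖e‖ = 1 := hνS t₀ ht₀1 _ hx₀
  have hbox : IsOpen (I₁ ×ˢ Metric.ball (0 : Space d) 1) := hI₁.prod Metric.isOpen_ball
  have hr_cont : ContinuousOn (fun q : ℝ × Space d => r q.1 q.2)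
      (I₁ ×ˢ Metric.ball (0 : Space d) 1) := (hr.contDiffOn_uncurry hI₁ h₁).continuousOn
  have hn_cont : ContinuousOn (fun q : ℝ × Space d => ν q.1 (r q.1 q.2))
      (I₁ ×ˢ Metric.ball (0 : Space d) 1) :=
    hS.continuous_normal.comp (f := fun q : ℝ × Space d => (q.1, r q.1 q.2))
      (continuousOn_fst.prodMk hr_cont)
      fun q hq => ⟨hT hq.1, (hr.mem_surface (h₁ hq.1) hq.2).1⟩
  obtain ⟨O₁, H, hO₁, hq₀O₁, hHO₁, hHe, hzO₁⟩ := hr.exists_definingFunction hU hI₁ h₁ ht₀1 hy₀ he1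
    (hr.normal t₀ (h₁ ht₀1) y₀ hy₀)
  have hDc : ContinuousOn (fderiv ℝ H) O₁ := hHO₁.continuousOn_fderiv_of_isOpen hO₁ le_rfl
  have hDat : ContinuousAt (fderiv ℝ H) (t₀, r t₀ y₀) := hDc.continuousAt (hO₁.mem_nhds hq₀O₁)
  -- the normal derivative of `H` is positive near the point
  obtain ⟨O₂, hO₂, W, hW, hOW⟩ : ∃ O₂ ∈ 𝓝 (t₀, r t₀ y₀), ∃ W ∈ 𝓝 e, ∀ q ∈ O₂, ∀ w ∈ W,
      1 / 2 < fderiv ℝ H q (0, w) := by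
    have hap : Continuous fun z : ((ℝ × Space (d + 1)) →L[ℝ] ℝ) × (ℝ × Space (d + 1)) => z.1 z.2 :=
      isBoundedBilinearMap_apply.continuous
    have h1 : ContinuousAt (fun z : (ℝ × Space (d + 1)) × Space (d + 1) =>
        fderiv ℝ H z.1 (0, z.2)) ((t₀, r t₀ y₀), e) := by
      have h2 : ContinuousAt (fun z : (ℝ × Space (d + 1)) × Space (d + 1) =>
          (fderiv ℝ H z.1, ((0 : ℝ), z.2))) ((t₀, r t₀ y₀), e) :=
        (ContinuousAt.comp (f := Prod.fst) (x := ((t₀, r t₀ y₀), e)) hDat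
          continuousAt_fst).prodMk (by fun_prop)
      exact hap.continuousAt.comp h2
    have h3 : ∀ᶠ z in 𝓝 ((t₀, r t₀ y₀), e), 1 / 2 < fderiv ℝ H z.1 (0, z.2) :=
      h1.eventually_const_lt (by simp only [hHe]; norm_num)
    obtain ⟨O₂, hO₂, W, hW, hsub⟩ := mem_nhds_prod_iff.1 h3
    exact ⟨O₂, hO₂, W, hW, fun q hq w hw => hsub (mk_mem_prod hq hw)⟩
  have heW : e ∈ W := mem_of_mem_nhds hW
  have hνW : ∀ᶠ q : ℝ × Space (d + 1) in 𝓝 (t₀, r t₀ y₀),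
      q.1 ∈ Icc 0 T ∧ q.2 ∈ S q.1 → ν q.1 q.2 ∈ W := by
    have h1 := hS.continuous_normal (t₀, r t₀ y₀) ⟨hT ht₀1, hx₀⟩
    exact eventually_nhdsWithin_iff.1 (h1.eventually hW)
  obtain ⟨O, hO, hOo, hq₀O⟩ := eventually_nhds_iff.1 ((hO₁.eventually_mem hq₀O₁).and
    ((Filter.eventually_mem_set.2 hO₂).and (hνW.and ((Filter.eventually_mem_set.2 hV).and
      (hDat.norm.eventually_lt_const (lt_add_one _))))))
  have hHO : ContDiffOn ℝ 1 H O := hHO₁.mono fun q hq => (hO q hq).1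
  have hHd : ∀ q ∈ O, HasFDerivAt H (fderiv ℝ H q) q := fun q hq =>
    ((hHO.contDiffAt (hOo.mem_nhds hq)).differentiableAt one_ne_zero).hasFDerivAt
  have hzO : ∀ q ∈ O, q.1 ∈ I₁ ∧ q.2 ∈ U ∧ (H q = 0 ↔ q.2 ∈ S q.1) := fun q hq =>
    hzO₁ q (hO q hq).1
  have hνO : ∀ q ∈ O, q.2 ∈ S q.1 → ν q.1 q.2 ∈ W := fun q hq hqS =>
    (hO q hq).2.2.1 ⟨hT (hzO q hq).1, hqS⟩
  -- normal coordinates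
  obtain ⟨D, Bν, hD, hq₀D, hDs, hBν, hnB⟩ :=
    hr.exists_hasFDerivAt_normal hI₁ h₁ hνS hn_cont (q₀ := (t₀, y₀)) ⟨ht₀1, hy₀⟩
  have hNO : ∀ᶠ z in 𝓝 ((t₀, y₀), (0 : ℝ)), sheetCoord r (fun t y => ν t (r t y)) z ∈ O := by
    have h1 : ContinuousAt (sheetCoord r fun t y => ν t (r t y)) ((t₀, y₀), 0) :=
      (continuousOn_sheetCoord (n := fun t y => ν t (r t y)) hr_cont hn_cont).continuousAt
        ((hbox.prod isOpen_univ).mem_nhds ⟨⟨ht₀1, hy₀⟩, mem_univ _⟩)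
    refine h1.eventually_mem ?_
    rw [sheetCoord_zero]
    exact hOo.mem_nhds hq₀O
  obtain ⟨δ, hδ, hδε, hQO', hIBD, hNinj, ⟨J, hJc, hJpos, hJle, hmap⟩, ⟨Ω, hΩo, hq₀Ω, hΩN⟩,
    ⟨K, hK⟩, ⟨K', hK'⟩⟩ := exists_sheetCoord_box hD (r := r) (n := fun t y => ν t (r t y))
      (A := fun q => fderiv ℝ (r q.1) q.2) (B := Bν)
      (hr.continuous_fderiv.mono (hDs.trans (prod_mono h₁ subset_rfl))) hBν (hr_cont.mono hDs)
      (hn_cont.mono hDs) (fun q hq => hr.hasFDerivAt_space (h₁ (hDs hq).1) (hDs hq).2) hnB hq₀D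
      (hr.immersion t₀ (h₁ ht₀1) y₀ hy₀) he1 (hr.normal t₀ (h₁ ht₀1) y₀ hy₀) hNO hε₀
  generalize hI : Metric.ball t₀ δ = I at *
  generalize hB : Metric.ball y₀ δ = B at *
  have hIo : IsOpen I := hI ▸ Metric.isOpen_ball
  have hBo : IsOpen B := hB ▸ Metric.isOpen_ball
  have hIf : volume I ≠ ⊤ := hI ▸ measure_ball_lt_top.ne
  have hBf : volume B ≠ ⊤ := hB ▸ measure_ball_lt_top.ne
  have hy₀B : y₀ ∈ B := hB ▸ Metric.mem_ball_self hδ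
  generalize hNdef : sheetCoord r (fun t y => ν t (r t y)) = N at *
  have hN0 : ∀ x : ℝ × Space d, N (x, 0) = (x.1, r x.1 x.2) := fun x => by
    rw [← hNdef, sheetCoord_zero]
  have hQO : ∀ z ∈ (I ×ˢ B) ×ˢ Ioo (-δ) δ, N z ∈ O := fun z hz => hQO' hz
  have h0 : (0 : ℝ) ∈ Ioo (-δ) δ := ⟨by linarith, hδ⟩
  have hIBbox : I ×ˢ B ⊆ I₁ ×ˢ Metric.ball (0 : Space d) 1 := hIBD.trans hDs
  have hII₁ : I ⊆ I₁ := fun t ht => (hIBbox (mk_mem_prod ht hy₀B)).1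
  have hrS : ∀ t ∈ I, ∀ y ∈ B, r t y ∈ S t := fun t ht y hy =>
    (hr.mem_surface (h₁ (hII₁ ht)) (hIBbox (mk_mem_prod ht hy)).2).1
  have hrO : ∀ t ∈ I, ∀ y ∈ B, (t, r t y) ∈ O := fun t ht y hy => by
    have := hQO ((t, y), 0) ⟨⟨ht, hy⟩, h0⟩
    rwa [hN0] at this
  have hrW : ∀ t ∈ I, ∀ y ∈ B, ν t (r t y) ∈ W := fun t ht y hy =>
    hνO (t, r t y) (hrO t ht y hy) (hrS t ht y hy)
  have hNQ : ContinuousOn N ((I ×ˢ B) ×ˢ Ioo (-δ) δ) := by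
    rw [← hNdef]
    exact (continuousOn_sheetCoord (n := fun t y => ν t (r t y)) hr_cont hn_cont).mono
      (prod_mono hIBbox (subset_univ _))
  have hHN : ∀ x ∈ I ×ˢ B, ∀ s ∈ Ioo (-δ) δ, HasDerivAt (fun s => H (N (x, s)))
      (fderiv ℝ H (N (x, s)) (0, ν x.1 (r x.1 x.2))) s := by
    intro x hx s hs
    have h1 : HasDerivAt (fun s : ℝ => N (x, s)) (0, ν x.1 (r x.1 x.2)) s := by
      rw [← hNdef]
      have := ((hasDerivAt_id s).smul_const (ν x.1 (r x.1 x.2))).const_add (r x.1 x.2)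
      rw [one_smul] at this
      exact (hasDerivAt_const s x.1).prodMk this
    exact (hHd _ (hQO _ ⟨hx, hs⟩)).comp_hasDerivAt s h1
  have hHN0 : ∀ x ∈ I ×ˢ B, H (N (x, 0)) = 0 := by
    intro x hx
    rw [hN0]
    exact (hzO _ (hrO x.1 hx.1 x.2 hx.2)).2.2.2 (hrS x.1 hx.1 x.2 hx.2)
  -- Along each normal segment H vanishes at s = 0 and has derivative above 1/2, so the mean value
  -- theorem applies.
  have hlow : ∀ x ∈ I ×ˢ B, ∀ s ∈ Ioo (-δ) δ, 1 / 2 * |s| ≤ |H (N (x, s))| := by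
    intro x hx s hs
    have hdiff : ∀ s ∈ Ioo (-δ) δ, 1 / 2 ≤ deriv (fun s => H (N (x, s))) s := fun s hs => by
      rw [(hHN x hx s hs).deriv]
      exact (hOW _ (hO _ (hQO _ ⟨hx, hs⟩)).2.1 _ (hrW x.1 hx.1 x.2 hx.2)).le
    have hmv := Convex.mul_sub_le_image_sub_of_le_deriv (convex_Ioo (-δ) δ)
      (f := fun s => H (N (x, s)))
      (fun s hs => (hHN x hx s hs).continuousAt.continuousWithinAt)
      (fun s hs => (hHN x hx s (interior_subset hs)).differentiableAt.differentiableWithinAt)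
      (fun s hs => hdiff s (interior_subset hs))
    rcases le_total 0 s with h | h
    · have := hmv 0 h0 s hs h
      rw [hHN0 x hx] at this
      rw [abs_of_nonneg h]
      exact le_trans (by linarith) (le_abs_self _)
    · have := hmv s hs 0 h0 h
      rw [hHN0 x hx] at this
      rw [abs_of_nonpos h]
      exact le_trans (by linarith) (neg_le_abs _)
  have hNQO : N '' ((I ×ˢ B) ×ˢ Ioo (-δ) δ) ⊆ O := by rintro _ ⟨z, hz, rfl⟩; exact hQO z hz
  -- On the surface H = 0, and the lower bound just obtained then forces s = 0.
  have hparam : ∀ q ∈ Ω, q.2 ∈ S q.1 → q.1 ∈ I ∧ ∃ y ∈ B, r q.1 y = q.2 := by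
    intro q hq hqS
    obtain ⟨⟨x, s⟩, hz, rfl⟩ := hΩN hq
    have h1 := hlow x hz.1 s hz.2
    rw [(hzO _ (hQO _ hz)).2.2.2 hqS, abs_zero] at h1
    have h2 : s = 0 := abs_eq_zero.1 (le_antisymm (by linarith) (abs_nonneg s))
    subst h2
    rw [hN0]
    exact ⟨hz.1.1, x.2, hz.1.2, rfl⟩
  have hgrad : ∀ t ∈ I, ∀ y ∈ B, ∀ τ w, fderiv ℝ H (t, r t y) (τ, w)
      = fderiv ℝ H (t, r t y) (0, ν t (r t y)) *
        (muDensity T S ν t (r t y) * τ + inner ℝ (ν t (r t y)) w) := by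
    intro t ht y hy τ w
    have hx := hIBbox (mk_mem_prod ht hy)
    have hn1 := hνS t hx.1 _ (hrS t ht y hy)
    have hex : ∃ c, IsMuDensityAt T S ν t (r t y) c :=
      hr.exists_isMuDensityAt hI₁ h₁ hνS hOo hHO hzO (fun q hq hqS =>
        lt_trans (by norm_num) (hOW q (hO q hq).2.1 _ (hνO q hq hqS))) (hrO t ht y hy)
    rw [hr.muDensity_eq (q := (t, y)) hI₁ h₁ hT hx hn1 hex]
    refine hr.fderiv_eq_of_gradient (q := (t, y)) hI₁ h₁ hx
      (hHd _ (hrO t ht y hy)).differentiableAt ?_ hn1 τ w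
    filter_upwards [hOo.mem_nhds (hrO t ht y hy)] with z hz _ hzS using (hzO z hz).2.2.2 hzS
  refine ⟨I, B, δ, r, J, H, fun x => fderiv ℝ H (x.1, r x.1 x.2) (0, ν x.1 (r x.1 x.2)), Ω, O,
    ?_, hq₀Ω, hδε⟩
  refine
    { transversal := ?_
      time_subset := fun t ht => (hII₁ ht).2
      image_subset := hNdef ▸ fun q hq => (hO q (hNQO hq)).2.2.2.1
      volume_ne_top := ?_
      volume_base_ne_top := hBf
      continuousOn := hr_cont.mono hIBbox
      norm_normal := fun t ht y hy => hνS t (hII₁ ht) _ (hrS t ht y hy)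
      exists_parameter := hparam
      fderiv_eq := hgrad
      image_le := ?_
      map_le := ?_
      density := ?_ }
  · rw [hNdef]
    refine
      { measurableSet_time := hIo.measurableSet
        measurableSet_base := hBo.measurableSet
        pos := hδ
        continuousOn := hNQ
        injOn := hNinj
        continuousOn_jacobian := hJc
        jacobian_pos := hJpos
        jacobian_le := hJle
        map_eq := hmap
        isOpen_inner := hΩo
        inner_subset := hΩN
        isOpen_outer := hOo
        subset_outer := hNQO
        contDiffOn := hHO
        fderiv_le := ⟨_, fun q hq => (hO q (hNQO hq)).2.2.2.2.le⟩
        abs_le := ⟨1 / 2, by norm_num, hlow⟩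
        eq_zero := hHN0
        hasDerivAt := fun x hx => ?_
        deriv_pos := fun x hx => lt_trans (by norm_num)
          (hOW _ (hO _ (hrO x.1 hx.1 x.2 hx.2)).2.1 _ (hrW x.1 hx.1 x.2 hx.2)) }
    have := hHN x hx 0 h0
    rwa [hN0] at this
  · rw [show (volume : Measure (ℝ × Space d)) = (volume : Measure ℝ).prod volume from rfl,
      Measure.prod_prod]
    exact ENNReal.mul_ne_top hIf hBf
  · exact ⟨(K : ℝ≥0∞) ^ (d : ℝ), ENNReal.rpow_ne_top_of_nonneg d.cast_nonneg ENNReal.coe_ne_top,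
      fun t ht E hE => surfaceMeasure_image_le (hK t ht) hE _⟩
  · exact ⟨(K' : ℝ≥0∞) ^ (d : ℝ), ENNReal.rpow_ne_top_of_nonneg d.cast_nonneg ENNReal.coe_ne_top,
      fun t ht => map_le_smul_surfaceMeasure hBo.measurableSet
        ((hr_cont.mono hIBbox).comp (by fun_prop) fun y hy => mk_mem_prod ht hy) (hK' t ht)
        (hrS t ht)⟩
  -- The quotient ∂_t H / |∇_x H| makes sense and is continuous on all of Ω, since the derivative in
  -- the direction e keeps |∇_x H| above 1/2. It extends the density off the surface.
  · let ℓ : ℝ × Space (d + 1) → Space (d + 1) →L[ℝ] ℝ := fun q =>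
      fderiv ℝ H q ∘L ContinuousLinearMap.inr ℝ ℝ (Space (d + 1))
    have hΩO : Ω ⊆ O := hΩN.trans hNQO
    have hDΩ : ContinuousOn (fderiv ℝ H) Ω := hDc.mono fun q hq => (hO q (hΩO hq)).1
    have hℓ : ∀ q ∈ Ω, 1 / 2 < ‖ℓ q‖ := by
      intro q hq
      have h1 := hOW q (hO q (hΩO hq)).2.1 e heW
      have h2 := (le_abs_self _).trans ((ℓ q).le_opNorm e)
      rw [he1, mul_one] at h2
      exact h1.trans_le h2
    refine ⟨fun q => fderiv ℝ H q (1, 0) / ‖ℓ q‖, (‖fderiv ℝ H (t₀, r t₀ y₀)‖ + 1) * 2, ?_, ?_, ?_⟩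
    · have h1 : ContinuousOn ℓ Ω := hDΩ.clm_comp continuousOn_const
      exact (hDΩ.clm_apply continuousOn_const).div h1.norm fun q hq =>
        (lt_trans (by norm_num) (hℓ q hq)).ne'
    · intro q hq
      rw [abs_div, abs_norm, div_le_iff₀ (lt_trans (by norm_num) (hℓ q hq))]
      have h1 := (fderiv ℝ H q).le_opNorm (1, 0)
      have h2 := (hO q (hΩO hq)).2.2.2.2
      have h3 : ‖((1 : ℝ), (0 : Space (d + 1)))‖ = 1 := by simp [Prod.norm_def]
      rw [h3, mul_one, Real.norm_eq_abs] at h1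
      nlinarith [hℓ q hq, norm_nonneg (fderiv ℝ H (t₀, r t₀ y₀))]
    · intro q hq hqS
      obtain ⟨htI, y, hy, hyq⟩ := hparam q hq hqS
      have h1 := hgrad q.1 htI y hy
      rw [hyq] at h1
      have hn1 : ‖ν q.1 q.2‖ = 1 := hνS q.1 (hII₁ htI) _ hqS
      have ha : 0 < fderiv ℝ H q (0, ν q.1 q.2) := lt_trans (by norm_num)
        (hOW q (hO q (hΩO hq)).2.1 _ (hνO q (hΩO hq) hqS))
      have h2 : ℓ q = fderiv ℝ H q (0, ν q.1 q.2) • innerSL ℝ (ν q.1 q.2) := by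
        ext w
        have := h1 0 w
        simpa [ℓ] using this
      have h3 : ‖ℓ q‖ = fderiv ℝ H q (0, ν q.1 q.2) := by
        rw [h2, norm_smul, innerSL_apply_norm, hn1, mul_one, Real.norm_of_nonneg ha.le]
      have h4 : fderiv ℝ H q (1, 0)
          = fderiv ℝ H q (0, ν q.1 q.2) * muDensity T S ν q.1 q.2 := by
        have := h1 1 0
        simpa using this
      beta_reduce
      rw [h3, h4, mul_div_cancel_left₀ _ ha.ne']

end NormalCharts

/-! ### Transfer between parameters and the surface. -/

section Transfer

variable {d : ℕ} {T : ℝ} {S : ℝ → Set (Space (d + 1))} {ν : ℝ → Space (d + 1) → Space (d + 1)}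
  {V : Set (ℝ × Space (d + 1))} {I : Set ℝ} {B : Set (Space d)} {ε : ℝ}
  {r : ℝ → Space d → Space (d + 1)} {J : (ℝ × Space d) × ℝ → ℝ} {H : ℝ × Space (d + 1) → ℝ}
  {a : ℝ × Space d → ℝ} {Ω O : Set (ℝ × Space (d + 1))}

namespace IsNormalChart

theorem time_subset_Icc (h : IsNormalChart T S ν V I B ε r J H a Ω O) : I ⊆ Icc 0 T :=
  h.time_subset.trans Ioo_subset_Icc_self

theorem measurableSet_time (h : IsNormalChart T S ν V I B ε r J H a Ω O) : MeasurableSet I :=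
  h.transversal.measurableSet_time

theorem measurableSet_base (h : IsNormalChart T S ν V I B ε r J H a Ω O) : MeasurableSet B :=
  h.transversal.measurableSet_base

theorem zero_mem (h : IsNormalChart T S ν V I B ε r J H a Ω O) : (0 : ℝ) ∈ Ioo (-ε) ε :=
  ⟨neg_lt_zero.2 h.transversal.pos, h.transversal.pos⟩

theorem continuousOn_slice (h : IsNormalChart T S ν V I B ε r J H a Ω O) {t : ℝ} (ht : t ∈ I) :
    ContinuousOn (r t) B :=
  h.continuousOn.comp (f := fun y => (t, y)) (by fun_prop) fun _ hy => mk_mem_prod ht hy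

theorem mem_image (h : IsNormalChart T S ν V I B ε r J H a Ω O) {t : ℝ} (ht : t ∈ I)
    {y : Space d} (hy : y ∈ B) : (t, r t y) ∈ V := by
  refine h.image_subset ⟨((t, y), 0), ⟨⟨ht, hy⟩, h.zero_mem⟩, ?_⟩
  rw [sheetCoord_zero]

/-- Almost everywhere statements on the surface hold almost everywhere in parameters. -/
theorem ae_ae_param (h : IsNormalChart T S ν V I B ε r J H a Ω O)
    {P : ℝ → Space (d + 1) → Prop}
    (hP : ∀ᵐ t ∂(volume.restrict (Icc 0 T)), ∀ᵐ x ∂(surfaceMeasure (S t)), P t x) :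
    ∀ᵐ t ∂(volume.restrict I), ∀ᵐ y ∂(volume.restrict B), P t (r t y) := by
  obtain ⟨C, -, hle⟩ := h.map_le
  filter_upwards [ae_restrict_of_ae_restrict_of_subset h.time_subset_Icc hP,
    ae_restrict_mem h.measurableSet_time] with t ht htI
  have hm : AEMeasurable (r t) (volume.restrict B) :=
    (h.continuousOn_slice htI).aemeasurable h.measurableSet_base
  exact ae_of_ae_map hm (((Measure.absolutelyContinuous_of_le (hle t htI)).trans
    (Measure.smul_absolutelyContinuous)) ht)

/-- Almost everywhere statements in parameters hold almost everywhere on the surface. -/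
theorem ae_ae_surface (h : IsNormalChart T S ν V I B ε r J H a Ω O)
    (hS : ∀ t ∈ Icc 0 T, IsClosed (S t)) {P : ℝ → Space (d + 1) → Prop}
    (hP : ∀ᵐ t ∂(volume.restrict I), ∀ᵐ y ∂(volume.restrict B), (t, r t y) ∈ Ω → P t (r t y)) :
    ∀ᵐ t ∂(volume.restrict (Icc 0 T)), ∀ᵐ x ∂(surfaceMeasure (S t)), (t, x) ∈ Ω → P t x := by
  obtain ⟨C, -, hle⟩ := h.image_le
  filter_upwards [ae_restrict_of_ae ((ae_restrict_iff' h.measurableSet_time).1 hP),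
    ae_restrict_mem measurableSet_Icc] with t ht htT
  have hmem : ∀ᵐ x ∂(surfaceMeasure (S t)), x ∈ S t := ae_restrict_mem (hS t htT).measurableSet
  by_cases htI : t ∈ I
  · have h1 := (ae_restrict_iff' h.measurableSet_base).1 (ht htI)
    -- The bound `image_le` holds for arbitrary subsets of B, so the exceptional set need not be
    -- measurable.
    have h2 : surfaceMeasure (S t)
        (r t '' {y | ¬ (y ∈ B → (t, r t y) ∈ Ω → P t (r t y))}) = 0 := by
      refine le_antisymm ((hle t htI _ fun y hy => ?_).trans ?_) bot_le
      · simp only [mem_ofPred_eq, Classical.not_imp] at hy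
        exact hy.1
      · rw [ae_iff.1 h1, mul_zero]
    filter_upwards [hmem, compl_mem_ae_iff.2 h2] with x hxS hx hxΩ
    obtain ⟨-, y, hy, hyx⟩ := h.exists_parameter (t, x) hxΩ hxS
    by_contra hPx
    refine hx ⟨y, fun hc => hPx ?_, hyx⟩
    simp only at hyx
    rw [← hyx]
    exact hc hy (by rw [hyx]; exact hxΩ)
  · filter_upwards [hmem] with x hxS hxΩ
    exact absurd (h.exists_parameter (t, x) hxΩ hxS).1 htI

open Classical in
/-- A measurable extension of the parametrization. -/
noncomputable def extend (I : Set ℝ) (B : Set (Space d)) (r : ℝ → Space d → Space (d + 1)) :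
    ℝ × Space d → ℝ × Space (d + 1) :=
  (I ×ˢ B).piecewise (fun q => (q.1, r q.1 q.2)) fun _ => 0

theorem extend_eq {q : ℝ × Space d} (hq : q ∈ I ×ˢ B) : extend I B r q = (q.1, r q.1 q.2) := by
  classical
  exact piecewise_eq_of_mem _ _ _ hq

theorem measurable_extend (h : IsNormalChart T S ν V I B ε r J H a Ω O) :
    Measurable (extend I B r) := by
  classical
  exact (continuousOn_fst.prodMk h.continuousOn).measurable_piecewise continuousOn_const
    (h.measurableSet_time.prod h.measurableSet_base)

/-- At each time dy is at most a constant times surface measure, and the constant is uniform in t.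
The extension of the parametrization off the box serves only to make the integrand measurable. -/
theorem lintegral_extend_lt_top (h : IsNormalChart T S ν V I B ε r J H a Ω O) {J' : Set ℝ}
    {U : Set (Space (d + 1))} (hU : MeasurableSet U) (hI : I ⊆ J') (hV : V ⊆ J' ×ˢ U)
    {f : ℝ × Space (d + 1) → ℝ≥0∞} (hf : Measurable f)
    (hfi : ∫⁻ t in J' ∩ Icc 0 T, ∫⁻ x in U, f (t, x) ∂(surfaceMeasure (S t)) < ⊤) :
    ∫⁻ q in I ×ˢ B, f (extend I B r q) < ⊤ := by
  obtain ⟨C, hC, hle⟩ := h.map_le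
  have hIB : (volume : Measure (ℝ × Space d)).restrict (I ×ˢ B)
      = (volume.restrict I).prod (volume.restrict B) := (Measure.prod_restrict I B).symm
  have hfm : Measurable fun q => f (extend I B r q) := hf.comp h.measurable_extend
  rw [hIB, lintegral_prod _ hfm.aemeasurable]
  refine lt_of_le_of_lt ?_ (ENNReal.mul_lt_top hC.lt_top hfi)
  rw [← lintegral_const_mul' _ _ hC]
  refine (setLIntegral_mono' h.measurableSet_time fun t ht => ?_).trans
    (lintegral_mono_set (subset_inter hI h.time_subset_Icc))
  have hm : AEMeasurable (r t) (volume.restrict B) :=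
    (h.continuousOn_slice ht).aemeasurable h.measurableSet_base
  have hft : Measurable fun x => U.indicator (fun x => f (t, x)) x :=
    (hf.comp measurable_prodMk_left).indicator hU
  calc ∫⁻ y in B, f (extend I B r (t, y))
      = ∫⁻ y in B, U.indicator (fun x => f (t, x)) (r t y) := by
        refine setLIntegral_congr_fun h.measurableSet_base fun y hy => ?_
        rw [extend_eq (mk_mem_prod ht hy), indicator_of_mem (hV (h.mem_image ht hy)).2]
    _ = ∫⁻ x, U.indicator (fun x => f (t, x)) x ∂(Measure.map (r t) (volume.restrict B)) :=
        (lintegral_map' hft.aemeasurable hm).symm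
    _ ≤ ∫⁻ x, U.indicator (fun x => f (t, x)) x ∂(C • surfaceMeasure (S t)) :=
        lintegral_mono' (hle t ht) le_rfl
    _ = C * ∫⁻ x in U, f (t, x) ∂(surfaceMeasure (S t)) := by
        rw [lintegral_smul_measure, lintegral_indicator hU, smul_eq_mul]

theorem surfaceMeasure_slice_lt_top (h : IsNormalChart T S ν V I B ε r J H a Ω O)
    (hS : ∀ t ∈ Icc 0 T, IsClosed (S t)) {t : ℝ} (ht : t ∈ Icc 0 T) :
    surfaceMeasure (S t) {x | (t, x) ∈ Ω} < ⊤ := by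
  obtain ⟨C, hC, hle⟩ := h.image_le
  have hmem : ∀ᵐ x ∂(surfaceMeasure (S t)), x ∈ S t := ae_restrict_mem (hS t ht).measurableSet
  by_cases htI : t ∈ I
  · refine lt_of_le_of_lt ?_ (ENNReal.mul_lt_top hC.lt_top h.volume_base_ne_top.lt_top)
    refine le_trans (measure_mono_ae ?_) (hle t htI B subset_rfl)
    filter_upwards [hmem] with x hxS hxΩ
    exact (h.exists_parameter (t, x) hxΩ hxS).2
  · have : surfaceMeasure (S t) {x | (t, x) ∈ Ω} = 0 := by
      refine measure_mono_null (t := {x | ¬ x ∈ S t}) (fun x hxΩ hxS =>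
        htI (h.exists_parameter (t, x) hxΩ hxS).1) hmem
    rw [this]
    exact ENNReal.zero_lt_top

/-- As `muDensity` is chosen point by point, its measurability comes from its agreement on the
surface with a bounded continuous function. -/
theorem integrableOn_muDensity (h : IsNormalChart T S ν V I B ε r J H a Ω O)
    (hS : ∀ t ∈ Icc 0 T, IsClosed (S t)) {t : ℝ} (ht : t ∈ Icc 0 T) :
    IntegrableOn (muDensity T S ν t) {x | (t, x) ∈ Ω} (surfaceMeasure (S t)) := by
  obtain ⟨k, C, hk, hkC, hkμ⟩ := h.density
  have hcont : Continuous fun x : Space (d + 1) => (t, x) := by fun_prop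
  have hΩm : MeasurableSet {x : Space (d + 1) | (t, x) ∈ Ω} :=
    (h.transversal.isOpen_inner.preimage hcont).measurableSet
  have hmem : ∀ᵐ x ∂(surfaceMeasure (S t)), x ∈ S t := ae_restrict_mem (hS t ht).measurableSet
  have h1 : IntegrableOn (fun x => k (t, x)) {x | (t, x) ∈ Ω} (surfaceMeasure (S t)) := by
    refine Integrable.mono' (g := fun _ => C)
      (integrableOn_const (hs := (h.surfaceMeasure_slice_lt_top hS ht).ne))
      ((hk.comp hcont.continuousOn fun x hx => hx).aestronglyMeasurable hΩm) ?_
    filter_upwards [ae_restrict_mem hΩm] with x hx using hkC _ hx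
  refine h1.congr ?_
  filter_upwards [ae_restrict_mem hΩm, ae_restrict_of_ae hmem] with x hx hxS
  exact (hkμ (t, x) hx hxS).symm

end IsNormalChart

end Transfer

/-! ### Jump conditions for velocity and momentum. -/

section JumpConditions

variable {d : ℕ} {T : ℝ} {S : ℝ → Set (Space (d + 1))} {ν : ℝ → Space (d + 1) → Space (d + 1)}
  {u : ℝ → Space (d + 1) → Space (d + 1)} {u₀ : Space (d + 1) → Space (d + 1)}
  {p : ℝ → Space (d + 1) → ℝ}

/-- The jump conditions at a point of the surface. -/
def JumpCondition (T : ℝ) (S : ℝ → Set (Space (d + 1))) (ν : ℝ → Space (d + 1) → Space (d + 1))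
    (u : ℝ → Space (d + 1) → Space (d + 1)) (p : ℝ → Space (d + 1) → ℝ) (t : ℝ)
    (x : Space (d + 1)) : Prop :=
  inner ℝ (plus ν u t x) (ν t x) = inner ℝ (minus ν u t x) (ν t x) ∧
  plus ν p t x = minus ν p t x ∧
  (plus ν u t x ≠ minus ν u t x →
    inner ℝ (plus ν u t x) (ν t x) = -muDensity T S ν t x)

/-- The algebraic form of the Rankine-Hugoniot conditions for the Euler equations. -/
theorem rankineHugoniot {n v w : Space (d + 1)} {π ϖ μ : ℝ} (hn : ‖n‖ = 1)
    (hmass : inner ℝ n (v - w) = 0)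
    (hmom : ∀ i, μ * (v i - w i) + inner ℝ n ((v i • v + π • EuclideanSpace.single i 1)
      - (w i • w + ϖ • EuclideanSpace.single i 1)) = 0) :
    inner ℝ v n = inner ℝ w n ∧ π = ϖ ∧ (v ≠ w → inner ℝ v n = -μ) := by
  have h1 : inner ℝ n v = inner ℝ n w := by
    rw [inner_sub_right] at hmass; linarith
  have h2 : ∀ i, (μ + inner ℝ n v) * (v i - w i) + (π - ϖ) * n i = 0 := by
    intro i
    have h3 := hmom i
    rw [inner_sub_right, inner_add_right, inner_add_right, inner_smul_right, inner_smul_right,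
      inner_smul_right, inner_smul_right, EuclideanSpace.inner_single_right, ← h1] at h3
    simp at h3
    linarith
  -- The jump of v is tangential, so pairing with n isolates the jump of the pressure.
  have h4 : (μ + inner ℝ n v) • (v - w) + (π - ϖ) • n = 0 := by
    ext i
    simpa using h2 i
  have h5 : π - ϖ = 0 := by
    have := congrArg (fun z => inner ℝ n z) h4
    simpa [inner_add_right, inner_smul_right, hmass, real_inner_self_eq_norm_sq, hn] using this
  refine ⟨by rw [real_inner_comm, h1, real_inner_comm], sub_eq_zero.1 h5, fun hvw => ?_⟩
  rw [h5, zero_smul, add_zero] at h4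
  have h6 := (smul_eq_zero.1 h4).resolve_right (sub_ne_zero.2 hvw)
  rw [real_inner_comm]
  linarith

theorem enorm_prodMk_le {E F : Type*} [NormedAddCommGroup E] [NormedAddCommGroup F] {x : E} {y : F}
    {c : ℝ≥0∞} (hx : ‖x‖ₑ ≤ c) (hy : ‖y‖ₑ ≤ c) : ‖(x, y)‖ₑ ≤ c := by
  rw [← ofReal_norm] at hx hy ⊢
  rcases le_total ‖x‖ ‖y‖ with h | h
  · rwa [Prod.norm_mk, max_eq_right h]
  · rwa [Prod.norm_mk, max_eq_left h]

/-- With this, 1 + 2a² + b dominates both the velocity and the momentum flux, where a and b are the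
maximal functions of u and p. It is integrable on the box because a² and b are and the box has
finite measure. -/
theorem le_one_add_two_mul_sq (a : ℝ≥0∞) : a ≤ 1 + 2 * a ^ 2 := by
  rcases le_total a 1 with h | h
  · exact h.trans le_self_add
  · calc a = a * 1 := (mul_one a).symm
      _ ≤ a * a := by gcongr
      _ = a ^ 2 := (sq a).symm
      _ ≤ 2 * a ^ 2 := le_mul_of_one_le_left zero_le one_le_two
      _ ≤ 1 + 2 * a ^ 2 := le_add_self

theorem enorm_momentumFlux_le (i : Fin (d + 1)) (q : ℝ × Space (d + 1)) {a b : ℝ≥0∞}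
    (hu : ‖u q.1 q.2‖ₑ ≤ a) (hp : ‖p q.1 q.2‖ₑ ≤ b) :
    ‖momentumFlux u p i q‖ₑ ≤ 1 + 2 * a ^ 2 + b := by
  have h1 : ‖u q.1 q.2 i‖ₑ ≤ a := by
    refine le_trans ?_ hu
    rw [← ofReal_norm, ← ofReal_norm]
    exact ENNReal.ofReal_le_ofReal (PiLp.norm_apply_le _ _)
  have h2 : ‖u q.1 q.2 i • u q.1 q.2 + p q.1 q.2 • EuclideanSpace.single i (1 : ℝ)‖ₑ
      ≤ a ^ 2 + b := by
    refine (enorm_add_le _ _).trans ?_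
    rw [enorm_smul, enorm_smul, sq]
    have h3 : ‖EuclideanSpace.single i (1 : ℝ)‖ₑ = 1 := by
      rw [← ofReal_norm]; simp
    rw [h3, mul_one]
    gcongr
  refine enorm_prodMk_le ((h1.trans (le_one_add_two_mul_sq a)).trans le_self_add) (h2.trans ?_)
  gcongr
  exact (le_mul_of_one_le_left zero_le one_le_two).trans le_add_self

theorem enorm_le_normalMaximal {G : Type*} [NormedAddCommGroup G] {K : Set ℝ}
    (f : ℝ → Space (d + 1) → G) (t : ℝ) (x : Space (d + 1)) {s : ℝ} (hs : s ∈ K) :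
    ‖f t (x + s • ν t x)‖ₑ ≤ normalMaximal K ν f t x :=
  le_iSup₂ (f := fun s (_ : s ∈ K) => ‖f t (x + s • ν t x)‖ₑ) s hs

variable {V : Set (ℝ × Space (d + 1))} {I : Set ℝ} {B : Set (Space d)} {ε : ℝ}
  {r : ℝ → Space d → Space (d + 1)} {J : (ℝ × Space d) × ℝ → ℝ} {H : ℝ × Space (d + 1) → ℝ}
  {a : ℝ × Space d → ℝ} {Ω O : Set (ℝ × Space (d + 1))}

/-- A measurable function dominating the normal maximal functions in parameters. -/
theorem IsNormalChart.exists_dominating (h : IsNormalChart T S ν V I B ε r J H a Ω O)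
    {J' : Set ℝ} {U : Set (Space (d + 1))} {ε' : ℝ} (hU : MeasurableSet U) (hI : I ⊆ J')
    (hV : V ⊆ J' ×ˢ U) (hε : ε ≤ ε')
    (h₁ : InLq T S J' U 2 (normalMaximal (Icc 0 ε') ν u))
    (h₂ : InLq T S J' U 2 (normalMaximal (Icc (-ε') 0) ν u))
    (h₃ : InLq T S J' U 1 (normalMaximal (Icc 0 ε') ν p))
    (h₄ : InLq T S J' U 1 (normalMaximal (Icc (-ε') 0) ν p)) :
    ∃ g : ℝ × Space d → ℝ≥0∞, Measurable g ∧ ∫⁻ q in I ×ˢ B, g q < ⊤ ∧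
      ∀ᵐ t ∂(volume.restrict I), ∀ᵐ y ∂(volume.restrict B), ∀ s ∈ Ioo (-ε) ε,
        ‖u t (r t y + s • ν t (r t y))‖ₑ ≤ g (t, y) ∧
        ∀ i, ‖momentumFlux u p i (t, r t y + s • ν t (r t y))‖ₑ ≤ g (t, y) := by
  obtain ⟨g₁, hg₁m, hg₁, hg₁i⟩ := h₁
  obtain ⟨g₂, hg₂m, hg₂, hg₂i⟩ := h₂
  obtain ⟨g₃, hg₃m, hg₃, hg₃i⟩ := h₃
  obtain ⟨g₄, hg₄m, hg₄, hg₄i⟩ := h₄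
  simp only [ENNReal.rpow_one, ENNReal.rpow_ofNat] at hg₁i hg₂i hg₃i hg₄i
  let R := IsNormalChart.extend I B r
  have hR : Measurable R := h.measurable_extend
  have i₁ := h.lintegral_extend_lt_top hU hI hV (hg₁m.pow_const 2) hg₁i
  have i₂ := h.lintegral_extend_lt_top hU hI hV (hg₂m.pow_const 2) hg₂i
  have i₃ := h.lintegral_extend_lt_top hU hI hV hg₃m hg₃i
  have i₄ := h.lintegral_extend_lt_top hU hI hV hg₄m hg₄i
  have m₁ : Measurable fun q => g₁ (R q) ^ 2 := (hg₁m.comp hR).pow_const 2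
  have m₂ : Measurable fun q => g₂ (R q) ^ 2 := (hg₂m.comp hR).pow_const 2
  have m₃ : Measurable fun q => g₃ (R q) := hg₃m.comp hR
  have m₄ : Measurable fun q => g₄ (R q) := hg₄m.comp hR
  let a₁ : ℝ × Space d → ℝ≥0∞ := fun q => 1 + 2 * g₁ (R q) ^ 2 + g₃ (R q)
  let a₂ : ℝ × Space d → ℝ≥0∞ := fun q => 1 + 2 * g₂ (R q) ^ 2 + g₄ (R q)
  have ha₁ : Measurable a₁ := ((m₁.const_mul 2).const_add 1).add m₃
  have ha₂ : Measurable a₂ := ((m₂.const_mul 2).const_add 1).add m₄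
  have hone : ∫⁻ _ in I ×ˢ B, (1 : ℝ≥0∞) ∂(volume : Measure (ℝ × Space d)) < ⊤ := by
    rw [setLIntegral_one]; exact h.volume_ne_top.lt_top
  have ia₁ : ∫⁻ q in I ×ˢ B, a₁ q < ⊤ := by
    simp only [a₁]
    rw [lintegral_add_right _ m₃, lintegral_add_left measurable_const, lintegral_const_mul _ m₁]
    exact ENNReal.add_lt_top.2 ⟨ENNReal.add_lt_top.2
      ⟨hone, ENNReal.mul_lt_top ENNReal.ofNat_lt_top i₁⟩, i₃⟩
  have ia₂ : ∫⁻ q in I ×ˢ B, a₂ q < ⊤ := by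
    simp only [a₂]
    rw [lintegral_add_right _ m₄, lintegral_add_left measurable_const, lintegral_const_mul _ m₂]
    exact ENNReal.add_lt_top.2 ⟨ENNReal.add_lt_top.2
      ⟨hone, ENNReal.mul_lt_top ENNReal.ofNat_lt_top i₂⟩, i₄⟩
  refine ⟨fun q => a₁ q + a₂ q, ha₁.add ha₂, ?_, ?_⟩
  · rw [lintegral_add_left ha₁]
    exact ENNReal.add_lt_top.2 ⟨ia₁, ia₂⟩
  filter_upwards [h.ae_ae_param hg₁, h.ae_ae_param hg₂, h.ae_ae_param hg₃, h.ae_ae_param hg₄,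
    ae_restrict_mem h.measurableSet_time] with t k₁ k₂ k₃ k₄ htI
  filter_upwards [k₁, k₂, k₃, k₄, ae_restrict_mem h.measurableSet_base] with y l₁ l₂ l₃ l₄ hyB
  have hm := hV (h.mem_image htI hyB)
  have hRq : R (t, y) = (t, r t y) := IsNormalChart.extend_eq (mk_mem_prod htI hyB)
  intro s hs
  clear_value R
  have hfin : ∀ z₁ z₂ : ℝ≥0∞, ‖u t (r t y + s • ν t (r t y))‖ₑ ≤ z₁ →
      ‖p t (r t y + s • ν t (r t y))‖ₑ ≤ z₂ → 1 + 2 * z₁ ^ 2 + z₂ ≤ a₁ (t, y) + a₂ (t, y) →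
      ‖u t (r t y + s • ν t (r t y))‖ₑ ≤ a₁ (t, y) + a₂ (t, y) ∧
        ∀ i, ‖momentumFlux u p i (t, r t y + s • ν t (r t y))‖ₑ ≤ a₁ (t, y) + a₂ (t, y) :=
    fun z₁ z₂ b₁ b₂ b₃ => ⟨((b₁.trans (le_one_add_two_mul_sq _)).trans le_self_add).trans b₃,
      fun i => (enorm_momentumFlux_le i (t, r t y + s • ν t (r t y)) b₁ b₂).trans b₃⟩
  rcases le_total 0 s with hs0 | hs0
  · have hsm : s ∈ Icc 0 ε' := ⟨hs0, hs.2.le.trans hε⟩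
    refine hfin (g₁ (t, r t y)) (g₃ (t, r t y)) ?_ ?_ ?_
    · rw [← l₁ hm.1 hm.2]; exact enorm_le_normalMaximal u t _ hsm
    · rw [← l₃ hm.1 hm.2]; exact enorm_le_normalMaximal p t _ hsm
    · simp only [a₁, hRq]; exact le_self_add
  · have hsm : s ∈ Icc (-ε') 0 := ⟨(neg_le_neg hε).trans hs.1.le, hs0⟩
    refine hfin (g₂ (t, r t y)) (g₄ (t, r t y)) ?_ ?_ ?_
    · rw [← l₂ hm.1 hm.2]; exact enorm_le_normalMaximal u t _ hsm
    · rw [← l₄ hm.1 hm.2]; exact enorm_le_normalMaximal p t _ hsm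
    · simp only [a₂, hRq]; exact le_add_self

/-- The velocity field has no jump in the normal direction. -/
theorem IsNormalChart.velocity_jump (h : IsNormalChart T S ν V I B ε r J H a Ω O)
    {K : Set (ℝ × Space (d + 1))} (hK : MeasurableSet K) (hVK : V ⊆ K)
    (hint : IntegrableOn (fun q : ℝ × Space (d + 1) => u q.1 q.2) K volume)
    (hdiv : IsDivFreeOn volume (K.indicator fun q => ((0 : ℝ), u q.1 q.2)) Ω)
    {up um : ℝ → Space d → Space (d + 1)}
    (hlim : ∀ᵐ t ∂(volume.restrict I), ∀ᵐ y ∂(volume.restrict B),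
      HasNormalLimit (𝓝[>] 0) ν u t (r t y) (up t y) ∧
      HasNormalLimit (𝓝[<] 0) ν u t (r t y) (um t y))
    {g : ℝ × Space d → ℝ≥0∞} (hg : Measurable g) (hgi : ∫⁻ q in I ×ˢ B, g q < ⊤)
    (hdom : ∀ᵐ t ∂(volume.restrict I), ∀ᵐ y ∂(volume.restrict B), ∀ s ∈ Ioo (-ε) ε,
      ‖u t (r t y + s • ν t (r t y))‖ₑ ≤ g (t, y)) :
    ∀ᵐ t ∂(volume.restrict I), ∀ᵐ y ∂(volume.restrict B), (t, r t y) ∈ Ω →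
      inner ℝ (ν t (r t y)) (up t y - um t y) = 0 := by
  have hmemK : ∀ t ∈ I, ∀ y ∈ B, ∀ s ∈ Ioo (-ε) ε,
      sheetCoord r (fun t y => ν t (r t y)) ((t, y), s) ∈ K := fun t ht y hy s hs =>
    hVK (h.image_subset ⟨((t, y), s), ⟨⟨ht, hy⟩, hs⟩, rfl⟩)
  have hM : Integrable (K.indicator fun q => ((0 : ℝ), u q.1 q.2)) volume := by
    rw [integrable_indicator_iff hK]
    exact Integrable.prodMk (integrable_zero _ _ _) hint
  have hlimM : ∀ t ∈ I, ∀ y ∈ B, ∀ l ≤ 𝓝 (0 : ℝ), ∀ w : Space (d + 1),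
      HasNormalLimit l ν u t (r t y) w →
      Tendsto (fun s => (K.indicator fun q => ((0 : ℝ), u q.1 q.2))
        (sheetCoord r (fun t y => ν t (r t y)) ((t, y), s))) l (𝓝 ((0 : ℝ), w)) := by
    intro t ht y hy l hl w hw
    refine (tendsto_const_nhds.prodMk_nhds hw).congr' ?_
    filter_upwards [hl (Ioo_mem_nhds h.zero_mem.1 h.zero_mem.2)] with s hs
    rw [indicator_of_mem (hmemK t ht y hy s hs)]
    rfl
  have key := h.transversal.jump_eq_zero hM hdiv (Mp := fun t y => ((0 : ℝ), up t y))
    (Mm := fun t y => ((0 : ℝ), um t y)) (by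
      filter_upwards [hlim, ae_restrict_mem h.measurableSet_time] with t ht htI
      filter_upwards [ht, ae_restrict_mem h.measurableSet_base] with y hy hyB
      exact ⟨hlimM t htI y hyB _ nhdsWithin_le_nhds _ hy.1,
        hlimM t htI y hyB _ nhdsWithin_le_nhds _ hy.2⟩) hg hgi (by
      filter_upwards [hdom, ae_restrict_mem h.measurableSet_time] with t ht htI
      filter_upwards [ht, ae_restrict_mem h.measurableSet_base] with y hy hyB s hs
      rw [indicator_of_mem (hmemK t htI y hyB s hs)]
      exact enorm_prodMk_le (by simp) (hy s hs))
  filter_upwards [key, ae_restrict_mem h.measurableSet_time] with t ht htI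
  filter_upwards [ht, ae_restrict_mem h.measurableSet_base] with y hy hyB hΩ
  have h1 := hy (by rw [sheetCoord_zero]; exact hΩ)
  rw [sheetCoord_zero] at h1
  simp only [Prod.mk_sub_mk, sub_zero] at h1
  -- The field (0, u) has no time component, so the density of μ_t drops out.
  rw [h.fderiv_eq t htI y hyB, mul_zero, zero_add] at h1
  exact (mul_eq_zero.1 h1).resolve_left (h.transversal.deriv_pos (t, y) ⟨htI, hyB⟩).ne'

/-- The jump condition for the momentum flux. -/
theorem IsNormalChart.momentum_jump (h : IsNormalChart T S ν V I B ε r J H a Ω O)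
    {K : Set (ℝ × Space (d + 1))} (hK : MeasurableSet K) (hVK : V ⊆ K) (i : Fin (d + 1))
    (hint : IntegrableOn (momentumFlux u p i) K volume) {δ : ℝ} (hδ : 0 < δ)
    (hdiv : IsDivFreeOn volume (fun q => (∫ z, radialKernel (n := d + 1) δ z) •
      K.indicator (momentumFlux u p i) q - smear δ (K.indicator (momentumFlux u p i)) q) Ω)
    {up um : ℝ → Space d → Space (d + 1)} {pp pm : ℝ → Space d → ℝ}
    (hlim : ∀ᵐ t ∂(volume.restrict I), ∀ᵐ y ∂(volume.restrict B),
      HasNormalLimit (𝓝[>] 0) ν u t (r t y) (up t y) ∧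
      HasNormalLimit (𝓝[<] 0) ν u t (r t y) (um t y) ∧
      HasNormalLimit (𝓝[>] 0) ν p t (r t y) (pp t y) ∧
      HasNormalLimit (𝓝[<] 0) ν p t (r t y) (pm t y))
    {g : ℝ × Space d → ℝ≥0∞} (hg : Measurable g) (hgi : ∫⁻ q in I ×ˢ B, g q < ⊤)
    (hdom : ∀ᵐ t ∂(volume.restrict I), ∀ᵐ y ∂(volume.restrict B), ∀ s ∈ Ioo (-ε) ε,
      ‖momentumFlux u p i (t, r t y + s • ν t (r t y))‖ₑ ≤ g (t, y)) :
    ∀ᵐ t ∂(volume.restrict I), ∀ᵐ y ∂(volume.restrict B), (t, r t y) ∈ Ω →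
      muDensity T S ν t (r t y) * (up t y i - um t y i) + inner ℝ (ν t (r t y))
        ((up t y i • up t y + pp t y • EuclideanSpace.single i 1)
          - (um t y i • um t y + pm t y • EuclideanSpace.single i 1)) = 0 := by
  set f := K.indicator (momentumFlux u p i) with hf
  set c := ∫ z, radialKernel (n := d + 1) δ z with hc
  have hcpos : 0 < c := integral_radialKernel_pos hδ
  have hmemK : ∀ t ∈ I, ∀ y ∈ B, ∀ s ∈ Ioo (-ε) ε,
      sheetCoord r (fun t y => ν t (r t y)) ((t, y), s) ∈ K := fun t ht y hy s hs =>
    hVK (h.image_subset ⟨((t, y), s), ⟨⟨ht, hy⟩, hs⟩, rfl⟩)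
  have hfi : Integrable f volume := (integrable_indicator_iff hK).2 hint
  have hslice : ∀ᵐ t ∂(volume.restrict I), Integrable (fun x => f (t, x)) volume :=
    ae_restrict_of_ae (Integrable.prod_right_ae (μ := (volume : Measure ℝ)) hfi)
  have hM : Integrable (fun q => c • f q - smear δ f q) volume :=
    (hfi.smul c).sub (integrable_smear hδ hfi)
  let F : Space (d + 1) → ℝ → ℝ × Space (d + 1) := fun w π =>
    (w i, w i • w + π • EuclideanSpace.single i 1)
  have hFc : Continuous fun z : Space (d + 1) × ℝ => F z.1 z.2 := by
    have h1 : Continuous fun z : Space (d + 1) × ℝ => z.1 i :=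
      (EuclideanSpace.proj (𝕜 := ℝ) i).continuous.comp continuous_fst
    exact h1.prodMk ((h1.smul continuous_fst).add (continuous_snd.smul continuous_const))
  have hlimM : ∀ t ∈ I, Integrable (fun x => f (t, x)) volume → ∀ y ∈ B, ∀ l ≤ 𝓝 (0 : ℝ),
      ∀ (w : Space (d + 1)) (π : ℝ), HasNormalLimit l ν u t (r t y) w →
      HasNormalLimit l ν p t (r t y) π →
      Tendsto (fun s => c • f (sheetCoord r (fun t y => ν t (r t y)) ((t, y), s))
        - smear δ f (sheetCoord r (fun t y => ν t (r t y)) ((t, y), s))) l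
        (𝓝 (c • F w π - smear δ f (t, r t y))) := by
    intro t ht hft y hy l hl w π hw hπ
    have h1 : Tendsto (fun s => f (sheetCoord r (fun t y => ν t (r t y)) ((t, y), s))) l
        (𝓝 (F w π)) := by
      have h2 := (hFc.tendsto (w, π)).comp (hw.prodMk_nhds hπ)
      refine h2.congr' ?_
      filter_upwards [hl (Ioo_mem_nhds h.zero_mem.1 h.zero_mem.2)] with s hs
      rw [hf, indicator_of_mem (hmemK t ht y hy s hs)]
      rfl
    have h3 : Continuous fun s : ℝ => smear δ f (t, r t y + s • ν t (r t y)) :=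
      (continuous_smear_slice δ hft).comp (by fun_prop)
    have h4 : Tendsto (fun s : ℝ => smear δ f (t, r t y + s • ν t (r t y))) l
        (𝓝 (smear δ f (t, r t y))) := by
      have := h3.tendsto 0
      simp only [zero_smul, add_zero] at this
      exact this.mono_left hl
    exact (h1.const_smul c).sub h4
  have hme : AEMeasurable (fun t => ∫⁻ x, ‖f (t, x)‖ₑ) (volume : Measure ℝ) :=
    AEMeasurable.lintegral_prod_right' (μ := (volume : Measure ℝ))
      (f := fun q : ℝ × Space (d + 1) => ‖f q‖ₑ) hfi.aestronglyMeasurable.enorm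
  let m := hme.mk _
  have hm : Measurable m := hme.measurable_mk
  have hmi : ∫⁻ t, m t < ⊤ := by
    have h1 : ∫⁻ t, m t = ∫⁻ t, ∫⁻ x, ‖f (t, x)‖ₑ := (lintegral_congr_ae hme.ae_eq_mk).symm
    have h2 : ∫⁻ q, ‖f q‖ₑ ∂((volume : Measure ℝ).prod (volume : Measure (Space (d + 1))))
        = ∫⁻ t, ∫⁻ x, ‖f (t, x)‖ₑ :=
      lintegral_prod _ hfi.aestronglyMeasurable.enorm
    rw [h1, ← h2]
    exact hfi.hasFiniteIntegral
  -- The second term bounds the average by a function of time alone, integrable over the box because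
  -- B has finite measure.
  let G : ℝ × Space d → ℝ≥0∞ := fun q => ‖c‖ₑ * g q + ENNReal.ofReal (4 * δ ^ 2) * m q.1
  have hm1 : Measurable fun q : ℝ × Space d => m q.1 := hm.comp measurable_fst
  have hG : Measurable G :=
    (hg.const_mul _).add (hm1.const_mul _)
  have hGi : ∫⁻ q in I ×ˢ B, G q < ⊤ := by
    simp only [G]
    rw [lintegral_add_left (hg.const_mul _), lintegral_const_mul _ hg,
      lintegral_const_mul _ hm1]
    refine ENNReal.add_lt_top.2 ⟨ENNReal.mul_lt_top enorm_lt_top hgi,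
      ENNReal.mul_lt_top ENNReal.ofReal_lt_top ?_⟩
    have hIB : (volume : Measure (ℝ × Space d)).restrict (I ×ˢ B)
        = (volume.restrict I).prod (volume.restrict B) := (Measure.prod_restrict I B).symm
    rw [hIB, lintegral_prod _ hm1.aemeasurable]
    simp only [lintegral_const, Measure.restrict_apply_univ]
    rw [lintegral_mul_const _ hm]
    exact ENNReal.mul_lt_top ((setLIntegral_le_lintegral _ _).trans_lt hmi)
      h.volume_base_ne_top.lt_top
  have key := h.transversal.jump_eq_zero hM hdiv
    (Mp := fun t y => c • F (up t y) (pp t y) - smear δ f (t, r t y))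
    (Mm := fun t y => c • F (um t y) (pm t y) - smear δ f (t, r t y)) (by
      filter_upwards [hlim, hslice, ae_restrict_mem h.measurableSet_time] with t ht hft htI
      filter_upwards [ht, ae_restrict_mem h.measurableSet_base] with y hy hyB
      exact ⟨hlimM t htI hft y hyB _ nhdsWithin_le_nhds _ _ hy.1 hy.2.2.1,
        hlimM t htI hft y hyB _ nhdsWithin_le_nhds _ _ hy.2.1 hy.2.2.2⟩) hG hGi (by
      filter_upwards [hdom, ae_restrict_of_ae hme.ae_eq_mk, ae_restrict_mem h.measurableSet_time]
        with t ht hmt htI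
      filter_upwards [ht, ae_restrict_mem h.measurableSet_base] with y hy hyB s hs
      refine enorm_sub_le.trans (add_le_add ?_ ?_)
      · rw [enorm_smul, hf, indicator_of_mem (hmemK t htI y hyB s hs)]
        gcongr
        exact hy s hs
      · refine (enorm_smear_le δ f t _).trans ?_
        rw [hmt])
  filter_upwards [key, ae_restrict_mem h.measurableSet_time] with t ht htI
  filter_upwards [ht, ae_restrict_mem h.measurableSet_base] with y hy hyB hΩ
  have h1 := hy (by rw [sheetCoord_zero]; exact hΩ)
  -- The average has the same value on both sides of the surface and cancels; what remains is c > 0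
  -- times the jump of the momentum flux.
  rw [sheetCoord_zero, sub_sub_sub_cancel_right, ← smul_sub, map_smul] at h1
  have h2 := (smul_eq_zero.1 h1).resolve_left hcpos.ne'
  simp only [F, Prod.mk_sub_mk] at h2
  rw [h.fderiv_eq t htI y hyB] at h2
  exact (mul_eq_zero.1 h2).resolve_left (h.transversal.deriv_pos (t, y) ⟨htI, hyB⟩).ne'

end JumpConditions

/-! ### From charts to the whole surface. -/

variable {d : ℕ} {T : ℝ} {S : ℝ → Set (Space (d + 1))} {ν : ℝ → Space (d + 1) → Space (d + 1)}
  {u : ℝ → Space (d + 1) → Space (d + 1)} {u₀ : Space (d + 1) → Space (d + 1)}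
  {p : ℝ → Space (d + 1) → ℝ}

/-- Near a point of the surface, the jump conditions hold almost everywhere. -/
theorem IsSlit.exists_normalChart_jumpCondition (hslit : IsSlit T u p S ν)
    (hu : IsWeakSolution T u u₀) (hS : IsHypersurfaceFamily T S ν) {t₀ : ℝ} (ht₀ : t₀ ∈ Ioo 0 T)
    {x₀ : Space (d + 1)} (hx₀ : x₀ ∈ S t₀) :
    ∃ V I B ε r J H a Ω O, IsNormalChart T S ν V I B ε r J H a Ω O ∧ (t₀, x₀) ∈ Ω ∧
      ∀ᵐ t ∂(volume.restrict (Icc 0 T)), ∀ᵐ x ∂(surfaceMeasure (S t)),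
        (t, x) ∈ Ω → JumpCondition T S ν u p t x := by
  obtain ⟨W, hWo, hWT, hSW, hpW⟩ := hslit.pressure
  obtain ⟨J', U, ε', hJo, htJ, hUo, hxU, hε', h₁, h₂, h₃, h₄⟩ :=
    hslit.maximal t₀ (Ioo_subset_Icc_self ht₀) x₀ hx₀
  obtain ⟨η, hη, hηW⟩ := Metric.nhds_basis_closedBall.mem_iff.1
    (hWo.mem_nhds (hSW t₀ ht₀ x₀ hx₀))
  -- Half the radius is spent on the chart and half on the averaging, so that all points involved
  -- stay in K.
  set δ := η / 2 with hδdef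
  have hδ : 0 < δ := half_pos hη
  set K := Metric.closedBall (t₀, x₀) η with hKdef
  have hKc : IsCompact K := isCompact_closedBall _ _
  have hKT : K ⊆ Icc 0 T ×ˢ univ :=
    (hηW.trans hWT).trans (prod_mono Ioo_subset_Icc_self subset_rfl)
  set V := Metric.ball (t₀, x₀) δ ∩ J' ×ˢ U with hVdef
  have hV : V ∈ 𝓝 (t₀, x₀) := inter_mem (Metric.ball_mem_nhds _ hδ)
    (prod_mem_nhds (hJo.mem_nhds htJ) (hUo.mem_nhds hxU))
  obtain ⟨I, B, ε, r, J, H, a, Ω, O, h, hΩ, hε⟩ := hS.exists_normalChart ht₀ hx₀ hV hε'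
  refine ⟨V, I, B, ε, r, J, H, a, Ω, O, h, hΩ, h.ae_ae_surface hS.isClosed ?_⟩
  obtain ⟨-, y₀, hy₀, -⟩ := h.exists_parameter _ hΩ hx₀
  have hIJ : I ⊆ J' := fun t ht => (h.mem_image ht hy₀).2.1
  have hVU : V ⊆ J' ×ˢ U := inter_subset_right
  have hVK : V ⊆ K := fun q hq =>
    Metric.closedBall_subset_closedBall (half_le_self hη.le) (Metric.ball_subset_closedBall hq.1)
  have hΩV : Ω ⊆ V := h.transversal.inner_subset.trans h.image_subset
  have hΩK : Ω + ({0} : Set ℝ) ×ˢ Metric.closedBall (0 : Space (d + 1)) δ ⊆ K := by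
    rintro _ ⟨q, hq, ⟨τ, z⟩, ⟨hτ, hz⟩, rfl⟩
    obtain rfl : τ = 0 := hτ
    have h1 : dist q (t₀, x₀) < δ := (hΩV hq).1
    have h2 : dist (q + ((0 : ℝ), z)) q ≤ δ := by
      rw [dist_eq_norm, add_sub_cancel_left, Prod.norm_mk, norm_zero,
        max_eq_right (norm_nonneg z)]
      exact mem_closedBall_zero_iff.1 hz
    have h3 := dist_triangle (q + ((0 : ℝ), z)) q (t₀, x₀)
    rw [hKdef, Metric.mem_closedBall]
    change dist (q + ((0 : ℝ), z)) (t₀, x₀) ≤ η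
    linarith [hδdef]
  obtain ⟨g, hg, hgi, hdom⟩ := h.exists_dominating hUo.measurableSet hIJ hVU hε h₁ h₂ h₃ h₄
  have hlim : ∀ᵐ t ∂(volume.restrict I), ∀ᵐ y ∂(volume.restrict B),
      HasNormalLimit (𝓝[>] 0) ν u t (r t y) (plus ν u t (r t y)) ∧
      HasNormalLimit (𝓝[<] 0) ν u t (r t y) (minus ν u t (r t y)) ∧
      HasNormalLimit (𝓝[>] 0) ν p t (r t y) (plus ν p t (r t y)) ∧
      HasNormalLimit (𝓝[<] 0) ν p t (r t y) (minus ν p t (r t y)) := by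
    filter_upwards [h.ae_ae_param hslit.limits] with t ht
    filter_upwards [ht] with y hy
    exact ⟨tendsto_nhds_limUnder hy.1, tendsto_nhds_limUnder hy.2.1,
      tendsto_nhds_limUnder hy.2.2.1, tendsto_nhds_limUnder hy.2.2.2⟩
  have hpK := hpW.locallyIntegrable.integrableOn_compact_subset hηW hKc
  have hvel := h.velocity_jump hKc.measurableSet hVK (hu.integrableOn_of_isCompact hKT hKc)
    (hu.isDivFreeOn_velocity hKc hKT (hΩV.trans hVK))
    (up := fun t y => plus ν u t (r t y)) (um := fun t y => minus ν u t (r t y))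
    (hlim.mono fun t ht => ht.mono fun y hy => ⟨hy.1, hy.2.1⟩) hg hgi
    (hdom.mono fun t ht => ht.mono fun y hy s hs => (hy s hs).1)
  have hmom : ∀ i, _ := fun i => h.momentum_jump hKc.measurableSet hVK i
    (hu.integrableOn_momentumFlux hKT hKc hpK i) hδ
    (hu.isDivFreeOn_sub_smear (ht₀.1.trans ht₀.2).le hpW hWT hKc hηW hδ hΩK i)
    (up := fun t y => plus ν u t (r t y)) (um := fun t y => minus ν u t (r t y))
    (pp := fun t y => plus ν p t (r t y)) (pm := fun t y => minus ν p t (r t y))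
    hlim hg hgi (hdom.mono fun t ht => ht.mono fun y hy s hs => (hy s hs).2 i)
  filter_upwards [hvel, ae_all_iff.2 hmom, ae_restrict_mem h.measurableSet_time] with t ht hti htI
  filter_upwards [ht, ae_all_iff.2 hti, ae_restrict_mem h.measurableSet_base] with y hy hyi hyB hΩy
  exact rankineHugoniot (h.norm_normal t htI y hyB) (hy hΩy) fun i => hyi i hΩy

/-- The jump conditions hold almost everywhere on the surface. -/
theorem IsSlit.ae_jumpCondition (hslit : IsSlit T u p S ν)
    (hu : IsWeakSolution T u u₀) (hS : IsHypersurfaceFamily T S ν) :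
    ∀ᵐ t ∂(volume.restrict (Icc 0 T)), ∀ᵐ x ∂(surfaceMeasure (S t)),
      JumpCondition T S ν u p t x := by
  let Z := {q : ℝ × Space (d + 1) // q.1 ∈ Ioo 0 T ∧ q.2 ∈ S q.1}
  have hloc : ∀ q : Z, ∃ Ω : Set (ℝ × Space (d + 1)), IsOpen Ω ∧ q.1 ∈ Ω ∧
      ∀ᵐ t ∂(volume.restrict (Icc 0 T)), ∀ᵐ x ∂(surfaceMeasure (S t)),
        (t, x) ∈ Ω → JumpCondition T S ν u p t x := by
    rintro ⟨q, hq⟩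
    obtain ⟨V, I, B, ε, r, J, H, a, Ω, O, h, hΩ, hae⟩ :=
      hslit.exists_normalChart_jumpCondition hu hS hq.1 hq.2
    exact ⟨Ω, h.transversal.isOpen_inner, hΩ, hae⟩
  choose Ω hΩo hΩ hae using hloc
  -- By the Lindelöf property countably many charts suffice, so the exceptional null sets can be
  -- united.
  obtain ⟨C, hC, hCΩ⟩ := TopologicalSpace.isOpen_iUnion_countable Ω hΩo
  have h1 := (ae_ball_iff hC).2 fun q (_ : q ∈ C) => hae q
  have h2 : ∀ᵐ t ∂(volume.restrict (Icc 0 T)), t ∈ Ioo 0 T := by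
    rw [← restrict_Ioo_eq_restrict_Icc]
    exact ae_restrict_mem measurableSet_Ioo
  filter_upwards [h1, h2] with t ht htT
  have h3 : ∀ᵐ x ∂(surfaceMeasure (S t)), x ∈ S t :=
    ae_restrict_mem (hS.isClosed t (Ioo_subset_Icc_self htT)).measurableSet
  filter_upwards [(ae_ball_iff hC).2 ht, h3] with x hx hxS
  have h4 : (t, x) ∈ ⋃ q ∈ C, Ω q := by
    rw [hCΩ]
    exact mem_iUnion.2 ⟨⟨(t, x), htT, hxS⟩, hΩ _⟩
  obtain ⟨q, hq, hqΩ⟩ := mem_iUnion₂.1 h4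
  exact hx q hq hqΩ

/-- The measure `μ_t` is locally finite on the surface. -/
theorem IsHypersurfaceFamily.integrableOn_muDensity (hS : IsHypersurfaceFamily T S ν) {t : ℝ}
    (ht : t ∈ Ioo 0 T) {A : Set (Space (d + 1))} (hA : Bornology.IsBounded A) (hAS : A ⊆ S t) :
    IntegrableOn (muDensity T S ν t) A (surfaceMeasure (S t)) := by
  have hcl := hS.isClosed t (Ioo_subset_Icc_self ht)
  -- Since S(t) is closed, the compact closure of A stays on the surface, where the charts give
  -- local integrability.
  have hsub : closure A ⊆ S t := closure_minimal hAS hcl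
  refine IntegrableOn.mono_set ?_ subset_closure
  refine LocallyIntegrableOn.integrableOn_isCompact (fun x hx => ?_) hA.isCompact_closure
  obtain ⟨I, B, ε, r, J, H, a, Ω, O, h, hΩ, -⟩ :=
    hS.exists_normalChart ht (hsub hx) univ_mem one_pos
  refine ⟨{x | (t, x) ∈ Ω}, mem_nhdsWithin_of_mem_nhds ?_,
    h.integrableOn_muDensity hS.isClosed (Ioo_subset_Icc_self ht)⟩
  exact (h.transversal.isOpen_inner.preimage (by fun_prop : Continuous fun x => (t, x))).mem_nhds hΩ

end SlitEuler

theorem lemma4p4 {d : ℕ} (T : ℝ)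
    (u : ℝ → SlitEuler.Space (d + 1) → SlitEuler.Space (d + 1))
    (u₀ : SlitEuler.Space (d + 1) → SlitEuler.Space (d + 1))
    (p : ℝ → SlitEuler.Space (d + 1) → ℝ)
    (S : ℝ → Set (SlitEuler.Space (d + 1)))
    (ν : ℝ → SlitEuler.Space (d + 1) → SlitEuler.Space (d + 1))
    (hu : SlitEuler.IsWeakSolution T u u₀)
    (hS : SlitEuler.IsHypersurfaceFamily T S ν)
    (hslit : SlitEuler.IsSlit T u p S ν) :
    (∀ᵐ t ∂(volume.restrict (Icc 0 T)), ∀ᵐ x ∂(SlitEuler.surfaceMeasure (S t)),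
      inner ℝ (SlitEuler.plus ν u t x) (ν t x) = inner ℝ (SlitEuler.minus ν u t x) (ν t x) ∧
      SlitEuler.plus ν p t x = SlitEuler.minus ν p t x) ∧
    (∀ᵐ t ∂(volume.restrict (Icc 0 T)), ∀ A : Set (SlitEuler.Space (d + 1)),
      MeasurableSet A → Bornology.IsBounded A →
      A ⊆ {x ∈ S t | SlitEuler.plus ν u t x ≠ SlitEuler.minus ν u t x} →
      IntegrableOn (SlitEuler.muDensity T S ν t) A (SlitEuler.surfaceMeasure (S t)) ∧
      IntegrableOn (fun x => inner ℝ (SlitEuler.plus ν u t x) (ν t x)) A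
        (SlitEuler.surfaceMeasure (S t)) ∧
      SlitEuler.mu T S ν t A
        + ∫ x in A, inner ℝ (SlitEuler.plus ν u t x) (ν t x)
            ∂(SlitEuler.surfaceMeasure (S t)) = 0) := by
  have key := hslit.ae_jumpCondition hu hS
  refine ⟨key.mono fun t ht => ht.mono fun x hx => ⟨hx.1, hx.2.1⟩, ?_⟩
  have hIoo : ∀ᵐ t ∂(volume.restrict (Icc 0 T)), t ∈ Ioo 0 T := by
    rw [← restrict_Ioo_eq_restrict_Icc]
    exact ae_restrict_mem measurableSet_Ioo
  filter_upwards [key, hIoo] with t ht htT A hAm hAb hAS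
  have hμ := hS.integrableOn_muDensity htT hAb fun x hx => (hAS hx).1
  -- On A the normal velocity equals minus the density of μ_t almost everywhere, so its
  -- measurability and integrability come from the density.
  have heq : (fun x => inner ℝ (SlitEuler.plus ν u t x) (ν t x))
      =ᵐ[(SlitEuler.surfaceMeasure (S t)).restrict A] fun x => -SlitEuler.muDensity T S ν t x := by
    filter_upwards [ae_restrict_of_ae ht, ae_restrict_mem hAm] with x hx hxA
    exact hx.2.2 (hAS hxA).2
  refine ⟨hμ, hμ.neg.congr heq.symm, ?_⟩
  rw [SlitEuler.mu, integral_congr_ae heq, integral_neg, add_neg_cancel]
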